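/- **Setting.** Let $\mathcal S$ be a measurable space, $\mathcal A$ a finite action set, $H,d,K\ge 1$, $\lambda>0$, $\delta\in(0,1)$. Let $\phi:\mathcal S\times\mathcal A\to\mathbb R^d$ be a measurable feature map with $\phi_i\ge 0$ and $\sum_{i=1}^d\phi_i(s,a)=1$. For $h\in[H]$ let the rewards be $r_h(s,a)=\langle\phi(s,a),\theta_h\rangle\in[0,1]$ with known $\theta_h$, $\|\theta_h\|_2\le\sqrt d$, and the nominal kernels $P^0_h(\cdot|s,a)=\sum_{i=1}^d\phi_i(s,a)\mu^0_{h,i}(\cdot)$ with $\mu^0_{h,i}\in\Delta(\mathcal S)$, the set of probability measures on $\mathcal S$. Let $D$ be one of: total variation, $D_{\rm TV}(\mu\|\nu)=\frac12|\mu-\nu|(\mathcal S)$; Kullback–Leibler, $D_{\rm KL}(\mu\|\nu)=\int\log\frac{d\mu}{d\nu}\,d\mu$; chi-square, $D_{\chi^2}(\mu\|\nu)=\int(\frac{d\mu}{d\nu}-1)^2d\nu$ (the last two are $+\infty$ if $\mu\not\ll\nu$). For a Markov policy $\pi=(\pi_h)_{h=1}^H$ let $$V_h^{\pi,\lambda}(s)=\inf_{\mu_t\in\Delta(\mathcal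 S)^d,\ P_t=\langle\phi,\mu_t\rangle}\mathbb E^{\{P_t\}_{t=h}^H}\Big[\sum_{t=h}^H\Big(r_t(s_t,a_t)+\lambda\sum_{i=1}^d\phi_i(s_t,a_t)D(\mu_{t,i}\|\mu^0_{t,i})\Big)\,\Big|\,s_h=s,\pi\Big],$$ $V^{\pi,\lambda}_{H+1}=0$ and $V_h^{\star,\lambda}(s)=\sup_\pi V_h^{\pi,\lambda}(s)$. Let $\pi^\star$ be an optimal policy, i.e. $V_1^{\pi^\star,\lambda}(s)=V_1^{\star,\lambda}(s)$ for all $s$, and let $\mathrm{SubOpt}(\pi,s,\lambda)=V_1^{\star,\lambda}(s)-V_1^{\pi,\lambda}(s)$. **Data and algorithm (R2PVI).** The dataset consists of $K$ i.i.d. trajectories $(s_h^\tau,a_h^\tau,s_{h+1}^\tau)_{h=1}^H$ generated under $P^0$ by a behavior policy $\pi^b$ from an arbitrary initial distribution. Put $\hat V_{H+1}=0$. Fix the ridge parameter $\gamma=1$ and a coefficient $\beta\ge0$ (specified in the theorem). For $h=H,\dots,1$ put $\Lambda_h=\sum_{\tau=1}^K\phi(s_h^\tau,a_h^\tau)\phi(s_h^\tau,a_h^\tau)^\top+\gamma\mathbf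 I$ and, for $f:\mathcal S\to\mathbb R$, let $R_h(f)=\Lambda_h^{-1}\sum_{\tau=1}^K\phi(s_h^\tau,a_h^\tau)f(s_{h+1}^\tau)$ be the ridge regression estimate. Write $[V]_\alpha=\min\{V,\alpha\}$ and $[x]_{[0,b]}$ for the clipping of $x$ to $[0,b]$. Define $\hat w_h\in\mathbb R^d$ by - (TV) $\hat w_h=R_h([\hat V_{h+1}]_{\alpha_{h+1}})$ with $\alpha_{h+1}=\inf_{s}\hat V_{h+1}(s)+\lambda$; - (KL) $\hat w_{h,i}=-\lambda\log\max\{R_h(e^{-\hat V_{h+1}/\lambda})_i,\ e^{-H/\lambda}\}$; - ($\chi^2$) $\hat w_{h,i}=\sup_{\alpha\in[\inf\hat V_{h+1},\,\sup\hat V_{h+1}]}\big\{m_i(\alpha)+\frac1{4\lambda}m_i(\alpha)^2-\frac1{4\lambda}q_i(\alpha)\big\}$ with $m_i(\alpha)=\big[R_h([\hat V_{h+1}]_\alpha)_i\big]_{[0,H]}$ and $q_i(\alpha)=\big[R_h([\hat V_{h+1}]_\alpha^2)_i\big]_{[0,H^2]}$. With the penalty $\Gamma_h(s,a)=\beta\sum_{i=1}^d\|\phi_i(s,a)\mathbf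 1_i\|_{\Lambda_h^{-1}}$, where $\mathbf 1_i$ is the $i$-th unit vector and $\|v\|_B=\sqrt{v^\top Bv}$, put $\hat Q_h=\max\{0,\min\{\langle\phi,\theta_h+\hat w_h\rangle-\Gamma_h,\ H-h+1\}\}$, let $\hat\pi_h(\cdot|s)$ be any maximizer of $p\mapsto\sum_a p(a)\hat Q_h(s,a)$ over probability vectors $p$ on $\mathcal A$ (so that $\hat\pi$ is a Markov policy), and $\hat V_h(s)=\sum_a\hat\pi_h(a|s)\hat Q_h(s,a)$. **Theorem.** Let - (TV) $\beta=16Hd\sqrt{\xi_{\rm TV}}$, $\ \xi_{\rm TV}=2\log(1024Hd^{1/2}K^2/\delta)$; - (KL) $\beta=16d\lambda e^{H/\lambda}\sqrt{H/\lambda+\xi_{\rm KL}}$, $\ \xi_{\rm KL}=\log(1024d\lambda^2K^3H/\delta)$; - ($\chi^2$) $\beta=8dH\big(1+\frac{3H}{4\lambda}\big)\sqrt{\xi_{\chi^2}}$, $\ \xi_{\chi^2}=\log\big(192K^5H^6d^3(1+\frac H{2\lambda})^3/\delta\big)$. Then with probability at least $1-\delta$ over the dataset, every policy $\hat\pi$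 output by the algorithm satisfies, for all $s\in\mathcal S$, $$\mathrm{SubOpt}(\hat\pi,s,\lambda)\le 2\beta\sup_{P\in\mathcal U^\lambda(P^0)}\sum_{h=1}^H\mathbb E^{\pi^\star,P}\Big[\sum_{i=1}^d\|\phi_i(s_h,a_h)\mathbf 1_i\|_{\Lambda_h^{-1}}\,\Big|\,s_1=s\Big],$$ where $\mathcal U^\lambda(P^0)$ is the set of all kernels $P_h(\cdot|s,a)=\sum_{i=1}^d\phi_i(s,a)\mu_{h,i}(\cdot)$ with $\mu_{h,i}\in\Delta(\mathcal S)$ and $D(\mu_{h,i}\|\mu^0_{h,i})\le\sup_{s'\in\mathcal S}V_{h+1}^{\star,\lambda}(s')/\lambda$ for all $h\in[H]$, $i\in[d]$. -/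

import Mathlib

open MeasureTheory ProbabilityTheory
open scoped ENNReal Matrix

namespace DRRMDP

/-! ### Divergences between probability measures -/

/-- The three divergences under consideration. -/
inductive Divergence where
  | TV
  | KL
  | chiSq

/-- Total variation, the `f`-divergence with `f x = |x - 1| / 2`. The part of `μ` that is singular
with respect to `ν` contributes its mass times `lim f x / x = 1 / 2`, so that this is
`(1/2) |μ - ν|(S)` for every pair of probability measures. -/
noncomputable def tvDiv {S : Type*} [MeasurableSpace S] (μ ν : Measure S) : ℝ≥0∞ :=
  (∫⁻ s, ENNReal.ofReal |(μ.rnDeriv ν s).toReal - 1| ∂ν + μ.singularPart ν Set.univ) / 2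

open Classical in
/-- The `χ²`-divergence, the `f`-divergence with `f x = (x - 1)²`, infinite if `μ` is not
absolutely continuous with respect to `ν`. -/
noncomputable def chiSqDiv {S : Type*} [MeasurableSpace S] (μ ν : Measure S) : ℝ≥0∞ :=
  if μ ≪ ν then ∫⁻ s, ENNReal.ofReal (((μ.rnDeriv ν s).toReal - 1) ^ 2) ∂ν else ⊤

/-- The divergence `D(μ ‖ ν)`, with values in `[0, ∞]`. -/
noncomputable def Divergence.div {S : Type*} [MeasurableSpace S] (D : Divergence)
    (μ ν : Measure S) : ℝ≥0∞ :=
  match D with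
  | .TV => tvDiv μ ν
  | .KL => InformationTheory.klDiv μ ν
  | .chiSq => chiSqDiv μ ν

/-! ### The model

Steps are numbered from `0`: the steps of an episode of horizon `H` are `0, …, H - 1`, and `H` is
the terminal time. Families indexed by the step are indexed by `ℕ`; only the entries at steps
`h < H` play a role. -/

/-- A `d`-dimensional feature map with values in the probability simplex. -/
structure FeatureMap (S A : Type*) [MeasurableSpace S] [MeasurableSpace A] (d : ℕ) where
  toFun : S → A → Fin d → ℝ
  measurable_toFun : ∀ i, Measurable fun x : S × A => toFun x.1 x.2 i
  nonneg : ∀ s a i, 0 ≤ toFun s a i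
  sum_eq_one : ∀ s a, ∑ i, toFun s a i = 1

/-- The transition kernel `P(· | s, a) = ∑ i, φ_i(s, a) μ_i(·)`. -/
noncomputable def FeatureMap.kernel {S A : Type*} [MeasurableSpace S] [MeasurableSpace A] {d : ℕ}
    (φ : FeatureMap S A d) (μ : Fin d → ProbabilityMeasure S) : Kernel (S × A) S where
  toFun x := ∑ i, ENNReal.ofReal (φ.toFun x.1 x.2 i) • (μ i : Measure S)
  measurable' := by
    refine Measure.measurable_of_measurable_coe _ fun s _ => ?_
    simp only [Measure.coe_finsetSum, Finset.sum_apply, Measure.smul_apply, smul_eq_mul]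
    exact Finset.measurable_sum _ fun i _ =>
      (φ.measurable_toFun i).ennreal_ofReal.mul_const _

/-- A (possibly randomized, step-dependent) Markov policy `π_h(· | s)`. -/
structure Policy (S A : Type*) [MeasurableSpace S] [MeasurableSpace A] where
  kernel : ℕ → Kernel S A
  isMarkov : ∀ h, IsMarkovKernel (kernel h)

/-- The data of a `d`-rectangular linear (regularized) MDP with horizon `H`: a simplex-valued
feature map, rewards `r_h(s, a) = ⟨φ(s, a), θ_h⟩ ∈ [0, 1]` with `‖θ_h‖₂ ≤ √d`, and the nominal
factor distributions `μ⁰_{h,i}`. -/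
structure LinearMDP (S A : Type*) [MeasurableSpace S] [MeasurableSpace A] (d H : ℕ) where
  φ : FeatureMap S A d
  θ : ℕ → Fin d → ℝ
  μ₀ : ℕ → Fin d → ProbabilityMeasure S
  reward_nonneg : ∀ h < H, ∀ s a, 0 ≤ φ.toFun s a ⬝ᵥ θ h
  reward_le_one : ∀ h < H, ∀ s a, φ.toFun s a ⬝ᵥ θ h ≤ 1
  norm_θ_le : ∀ h < H, ‖WithLp.toLp 2 (θ h)‖ ≤ √(d : ℝ)

/-- A trajectory of length `n`: its `j`-th entry is the transition `(s_j, a_j, s_{j+1})`. -/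
abbrev Traj (S A : Type*) (n : ℕ) := Fin n → S × A × S

/-- The law of the trajectory `(s_h, a_h, s_{h+1}), …, (s_{h+n-1}, a_{h+n-1}, s_{h+n})` of `n`
transitions that starts at step `h` in the state `s_h = s`, where `a_t ∼ π_t(· | s_t)` and
`s_{t+1} ∼ P_t(· | s_t, a_t)`. -/
noncomputable def trajKernel {S A : Type*} [MeasurableSpace S] [MeasurableSpace A]
    (π : ℕ → Kernel S A) (P : ℕ → Kernel (S × A) S) :
    (n : ℕ) → (h : ℕ) → Kernel S (Traj S A n)
  | 0, _ => Kernel.const S (Measure.dirac Fin.elim0)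
  | n + 1, h =>
      (Kernel.id ×ₖ ((π h ⊗ₖ P h) ⊗ₖ
        (trajKernel π P n (h + 1)).comap (fun x : S × A × S => x.2.2)
          (measurable_snd.comp measurable_snd))).map
        (fun x : S × (A × S) × Traj S A n =>
          (Fin.cons (x.1, x.2.1.1, x.2.1.2) x.2.2 : Traj S A (n + 1)))

section Model

variable {S A : Type*} [MeasurableSpace S] [MeasurableSpace A] {d H : ℕ}

/-- The regularized one-step reward `r_t(s, a) + λ ⟨φ(s, a), D(μ_t ‖ μ⁰_t)⟩`. -/
noncomputable def LinearMDP.regReward (M : LinearMDP S A d H) (D : Divergence) (lam : ℝ)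
    (μ : ℕ → Fin d → ProbabilityMeasure S) (t : ℕ) (s : S) (a : A) : ℝ≥0∞ :=
  ENNReal.ofReal (M.φ.toFun s a ⬝ᵥ M.θ t) +
    ENNReal.ofReal lam *
      ∑ i, ENNReal.ofReal (M.φ.toFun s a i) * D.div (μ t i : Measure S) (M.μ₀ t i : Measure S)

/-- The robust regularized value function `V_h^{π,λ}(s)`: the infimum, over all factor
distributions `μ_t ∈ Δ(S)^d`, of the expected sum over `t = h, …, H - 1` of the regularized
rewards, given `s_h = s`, under `π` and `P_t = ⟨φ, μ_t⟩`. -/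
noncomputable def LinearMDP.value (M : LinearMDP S A d H) (D : Divergence) (lam : ℝ)
    (π : Policy S A) (h : ℕ) (s : S) : ℝ≥0∞ :=
  ⨅ μ : ℕ → Fin d → ProbabilityMeasure S,
    ∫⁻ τ, ∑ j : Fin (H - h), M.regReward D lam μ (h + j) (τ j).1 (τ j).2.1
      ∂(trajKernel π.kernel (fun t => M.φ.kernel (μ t)) (H - h) h s)

/-- The optimal robust regularized value function `V_h^{⋆,λ}(s) = sup_π V_h^{π,λ}(s)`. -/
noncomputable def LinearMDP.optValue (M : LinearMDP S A d H) (D : Divergence) (lam : ℝ)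
    (h : ℕ) (s : S) : ℝ≥0∞ :=
  ⨆ π : Policy S A, M.value D lam π h s

/-- `π` is an optimal robust policy: it attains the optimal value at the first step from every
initial state. -/
def LinearMDP.IsOptimal (M : LinearMDP S A d H) (D : Divergence) (lam : ℝ)
    (π : Policy S A) : Prop :=
  ∀ s, M.value D lam π 0 s = M.optValue D lam 0 s

/-- The suboptimality gap `V_1^{⋆,λ}(s) - V_1^{π,λ}(s)`. (The first term is the larger one, and
both are at most `H`.) -/
noncomputable def LinearMDP.subOpt (M : LinearMDP S A d H) (D : Divergence) (lam : ℝ)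
    (π : Policy S A) (s : S) : ℝ≥0∞ :=
  M.optValue D lam 0 s - M.value D lam π 0 s

/-- The robustly admissible set `U^λ(P⁰)`: the linear kernels `P_h = ⟨φ, μ_h⟩` such that
`D(μ_{h,i} ‖ μ⁰_{h,i}) ≤ sup_s V_{h+1}^{⋆,λ}(s) / λ` for all steps `h` and all `i`. -/
def LinearMDP.admissible (M : LinearMDP S A d H) (D : Divergence) (lam : ℝ) :
    Set (ℕ → Kernel (S × A) S) :=
  {P | ∃ μ : ℕ → Fin d → ProbabilityMeasure S, (∀ h, P h = M.φ.kernel (μ h)) ∧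
    ∀ h < H, ∀ i, D.div (μ h i : Measure S) (M.μ₀ h i : Measure S) ≤
      (⨆ s, M.optValue D lam (h + 1) s) / ENNReal.ofReal lam}

/-- The law of one trajectory of the offline dataset: initial state drawn from `ρ`, behavior
policy `πb`, nominal transition kernels. -/
noncomputable def LinearMDP.dataTraj (M : LinearMDP S A d H) (ρ : Measure S) (πb : Policy S A) :
    Measure (Traj S A H) :=
  ρ.bind (trajKernel πb.kernel (fun t => M.φ.kernel (M.μ₀ t)) H 0)

/-- The law of the offline dataset: `K` i.i.d. trajectories. -/
noncomputable def LinearMDP.dataLaw (M : LinearMDP S A d H) (ρ : Measure S) (πb : Policy S A)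
    (K : ℕ) : Measure (Fin K → Traj S A H) :=
  Measure.pi fun _ => M.dataTraj ρ πb

end Model

/-! ### The algorithm -/

/-- The weighted norm `‖v‖_B = √(vᵀ B v)`. -/
noncomputable def wnorm {d : ℕ} (B : Matrix (Fin d) (Fin d) ℝ) (v : Fin d → ℝ) : ℝ :=
  √(v ⬝ᵥ (B *ᵥ v))

section Algorithm

variable {S A : Type*} [MeasurableSpace S] [MeasurableSpace A] {d H K : ℕ}

/-- `Λ_h = ∑_τ φ(s_h^τ, a_h^τ) φ(s_h^τ, a_h^τ)ᵀ + γ I`. -/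
noncomputable def gram (φ : FeatureMap S A d) (γ : ℝ) (data : Fin K → Traj S A H) (h : Fin H) :
    Matrix (Fin d) (Fin d) ℝ :=
  ∑ τ, Matrix.vecMulVec (φ.toFun (data τ h).1 (data τ h).2.1)
      (φ.toFun (data τ h).1 (data τ h).2.1) + γ • 1

/-- `∑_i ‖φ_i(s, a) 1_i‖_{Λ_h⁻¹}`. -/
noncomputable def uncertainty (φ : FeatureMap S A d) (γ : ℝ) (data : Fin K → Traj S A H)
    (h : Fin H) (s : S) (a : A) : ℝ :=
  ∑ i, wnorm (gram φ γ data h)⁻¹ (φ.toFun s a i • Pi.single i 1)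

/-- The ridge regression `argmin_w ∑_τ (f(s_{h+1}^τ) - φ(s_h^τ, a_h^τ)ᵀ w)² + γ ‖w‖²`, in the
closed form `Λ_h⁻¹ ∑_τ f(s_{h+1}^τ) φ(s_h^τ, a_h^τ)`. -/
noncomputable def ridge (φ : FeatureMap S A d) (γ : ℝ) (data : Fin K → Traj S A H) (h : Fin H)
    (f : S → ℝ) : Fin d → ℝ :=
  (gram φ γ data h)⁻¹ *ᵥ
    ∑ τ, f (data τ h).2.2 • φ.toFun (data τ h).1 (data τ h).2.1

/-- Clipping of a real number to `[0, b]`. -/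
noncomputable def clip (b x : ℝ) : ℝ := max 0 (min x b)

/-- The parameter estimate `ŵ_h` computed from the next value estimate `V`. -/
noncomputable def weights (φ : FeatureMap S A d) (D : Divergence) (lam γ : ℝ)
    (data : Fin K → Traj S A H) (h : Fin H) (V : S → ℝ) : Fin d → ℝ :=
  match D with
  | .TV => ridge φ γ data h fun s => min (V s) ((⨅ s', V s') + lam)
  | .KL => fun i => -lam * Real.log
      (max (ridge φ γ data h (fun s => Real.exp (-V s / lam)) i) (Real.exp (-(H : ℝ) / lam)))
  | .chiSq => fun i =>
      sSup ((fun α : ℝ =>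
          clip H (ridge φ γ data h (fun s => min (V s) α) i)
          + 1 / (4 * lam) * (clip H (ridge φ γ data h (fun s => min (V s) α) i)) ^ 2
          - 1 / (4 * lam) *
              clip ((H : ℝ) ^ 2) (ridge φ γ data h (fun s => (min (V s) α) ^ 2) i)) ''
        Set.Icc (⨅ s, V s) (⨆ s, V s))

/-- The estimate `Q̂_h = min {⟨φ, θ_h + ŵ_h⟩ - Γ_h, H - h + 1}⁺` (with steps numbered from `1`; here
`H - h`), where `Γ_h = β ∑_i ‖φ_i 1_i‖_{Λ_h⁻¹}`, computed from the next value estimate `V`. -/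
noncomputable def qStep (M : LinearMDP S A d H) (D : Divergence) (lam γ β : ℝ)
    (data : Fin K → Traj S A H) (h : Fin H) (V : S → ℝ) (s : S) (a : A) : ℝ :=
  max (min (M.φ.toFun s a ⬝ᵥ (M.θ h + weights M.φ D lam γ data h V)
    - β * uncertainty M.φ γ data h s a) ((H : ℝ) - (h : ℕ))) 0

variable [Fintype A]

/-- The value estimates `V̂_h`, `h = 0, …, H`, of a run of the algorithm in which the policy `π` is
chosen: `V̂_H = 0` and `V̂_h(s) = ⟨Q̂_h(s, ·), π_h(· | s)⟩_A`. -/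
noncomputable def vHat (M : LinearMDP S A d H) (D : Divergence) (lam γ β : ℝ)
    (data : Fin K → Traj S A H) (π : Policy S A) : Fin (H + 1) → S → ℝ :=
  Fin.reverseInduction (motive := fun _ => S → ℝ) (fun _ => 0)
    (fun h V s => ∑ a, (π.kernel h s).real {a} * qStep M D lam γ β data h V s a)

/-- The action-value estimates `Q̂_h`, `h = 0, …, H - 1`, of that run. -/
noncomputable def qHat (M : LinearMDP S A d H) (D : Divergence) (lam γ β : ℝ)
    (data : Fin K → Traj S A H) (π : Policy S A) (h : Fin H) : S → A → ℝ :=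
  qStep M D lam γ β data h (vHat M D lam γ β data π h.succ)

/-- `π` is an output of the algorithm on the given dataset:
`π_h(· | s) ∈ argmax_{p ∈ Δ(A)} ⟨Q̂_h(s, ·), p⟩_A` for all `h` and `s`. -/
def IsOutput (M : LinearMDP S A d H) (D : Divergence) (lam γ β : ℝ)
    (data : Fin K → Traj S A H) (π : Policy S A) : Prop :=
  ∀ (h : Fin H) (s : S) (p : ProbabilityMeasure A),
    ∑ a, (p : Measure A).real {a} * qHat M D lam γ β data π h s a ≤
      ∑ a, (π.kernel h s).real {a} * qHat M D lam γ β data π h s a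

end Algorithm

/-- The coefficient `β` of the penalty. -/
noncomputable def betaCoeff (D : Divergence) (d H K : ℕ) (lam δ : ℝ) : ℝ :=
  match D with
  | .TV => 16 * H * d * √(2 * Real.log (1024 * H * √(d : ℝ) * K ^ 2 / δ))
  | .KL => 16 * d * lam * Real.exp (H / lam) *
      √(H / lam + Real.log (1024 * d * lam ^ 2 * K ^ 3 * H / δ))
  | .chiSq => 8 * d * H * (1 + 3 * H / (4 * lam)) *
      √(Real.log (192 * K ^ 5 * H ^ 6 * d ^ 3 * (1 + H / (2 * lam)) ^ 3 / δ))

end DRRMDP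

/-!
The proof is pessimism combined with the duality between the regularized robust expectation and a
one-dimensional problem.

*Duality.* For bounded `V ≥ 0` and a probability measure `ν`, the infimum over `μ` of
`∫ V dμ + λ D(μ ‖ ν)` is an explicit functional `dualValue` of `ν`, which depends on `ν` only through
integrals of truncations of `V` (total variation), of `exp (-V / λ)` (Kullback-Leibler) or of
truncations of `V` and their squares (`χ²`). These integrals are what the algorithm estimates by
ridge regression. `weak_duality` gives the lower bound; `strong_duality` gives almost minimizing
measures whose cost `λ D(μ ‖ ν)` does not exceed `sup V`.

*Estimation.* The covariates at step `h` determine the weights of the ridge estimate, and given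
the covariates of all trajectories the next states are independent. Hence a single coordinate of the
estimate obeys Hoeffding's inequality conditionally on the covariates, at the scale `‖1_i‖_{Λ⁻¹}`
(`LinearMDP.measure_noise_gt_le`), without any self-normalized martingale bound. The target functions depend on the data themselves, through the next value estimate.
But whatever maximizers the algorithm chooses, that estimate is a clipped maximum
`s ↦ max_a ⟨φ(s, a), u⟩` with `u ∈ ℝ^d` in a fixed box (`exists_vHat_eq_greedyValue`), because the
penalty `β ∑_i φ_i ‖1_i‖_{Λ⁻¹}` is linear in `φ`. A union bound over a grid in this box
(`LinearMDP.exists_uniform_event`) yields an event of probability at least `1 - δ` on which every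
parameter estimate deviates from its dual value by at most `β ‖1_i‖_{Λ⁻¹}`
(`LinearMDP.exists_estimation_event`, `exists_grid_size`). The metric entropy of the class is of
order `d log K`, which the factor `d` in `β` absorbs.

*Suboptimality.* On that event the estimated action values lie below the dual Bellman backup of the
next value estimate, and at most twice the penalty below it. The first bound and weak duality show
that the value estimates are lower bounds for the value of the output (`LinearMDP.le_value`). The
second bound, along the optimal policy and under the almost minimizing measures of strong
duality for the value estimates, shows that the optimal value exceeds the value estimate by at most
twice the expected penalties (`LinearMDP.expectedSum_le`). Since the value estimates are below the
optimal values, those measures form an admissible kernel.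
-/

namespace DRRMDP

/-! ### Duality for the regularized expectation -/

section Duality

variable {S : Type*} [MeasurableSpace S]

/-- A measurable function with values in `[0, B]` is integrable for a finite measure. -/
lemma integrable_of_bounds {μ : Measure S} [IsFiniteMeasure μ] {f : S → ℝ} {B : ℝ}
    (hf : Measurable f) (h0 : ∀ s, 0 ≤ f s) (hB : ∀ s, f s ≤ B) : Integrable f μ :=
  Integrable.of_mem_Icc 0 B hf.aemeasurable (Filter.Eventually.of_forall fun s => ⟨h0 s, hB s⟩)

/-- The concave dual objective of the `χ²`-regularized infimum. -/
noncomputable def chiSqDual (lam : ℝ) (ν : Measure S) (V : S → ℝ) (α : ℝ) : ℝ :=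
  ∫ s, min (V s) α ∂ν + 1 / (4 * lam) * (∫ s, min (V s) α ∂ν) ^ 2
    - 1 / (4 * lam) * ∫ s, (min (V s) α) ^ 2 ∂ν

/-- The dual expression for `inf_μ (∫ V dμ + λ D(μ ‖ ν))`, the infimum being over all probability
measures `μ`. -/
noncomputable def dualValue (D : Divergence) (lam : ℝ) (ν : Measure S) (V : S → ℝ) : ℝ :=
  match D with
  | .TV => ∫ s, min (V s) ((⨅ s', V s') + lam) ∂ν
  | .KL => -lam * Real.log (∫ s, Real.exp (-V s / lam) ∂ν)
  | .chiSq => sSup (chiSqDual lam ν V '' Set.Icc (⨅ s, V s) (⨆ s, V s))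

/-! #### Total variation -/

/-- For probability measures, the total variation is the `ν`-mass missing from the absolutely
continuous part of `μ`. -/
lemma tvDiv_eq_lintegral (μ ν : Measure S) [IsProbabilityMeasure μ] [IsProbabilityMeasure ν] :
    tvDiv μ ν = ∫⁻ s, (1 - μ.rnDeriv ν s) ∂ν := by
  have hg := Measure.measurable_rnDeriv μ ν
  have h1 : ∫⁻ s, ENNReal.ofReal |(μ.rnDeriv ν s).toReal - 1| ∂ν
      = ∫⁻ s, (1 - μ.rnDeriv ν s) ∂ν + ∫⁻ s, (μ.rnDeriv ν s - 1) ∂ν := by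
    have hg' : Measurable fun s => 1 - μ.rnDeriv ν s := measurable_const.sub hg
    rw [← lintegral_add_left hg']
    refine lintegral_congr_ae ?_
    filter_upwards [Measure.rnDeriv_lt_top μ ν] with s hs
    lift μ.rnDeriv ν s to NNReal using hs.ne with x
    rw [ENNReal.coe_toReal]
    rcases le_total x 1 with h | h
    · have h' : (x : ℝ) - 1 ≤ 0 := by simpa using h
      rw [abs_of_nonpos h', tsub_eq_zero_of_le (by exact_mod_cast h : (x : ℝ≥0∞) ≤ 1), add_zero,
        neg_sub, ENNReal.ofReal_sub _ x.coe_nonneg]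
      simp
    · have h' : 0 ≤ (x : ℝ) - 1 := by simpa using h
      rw [abs_of_nonneg h', tsub_eq_zero_of_le (by exact_mod_cast h : 1 ≤ (x : ℝ≥0∞)), zero_add,
        ENNReal.ofReal_sub _ zero_le_one]
      simp
  have h2 : ∫⁻ s, μ.rnDeriv ν s ∂ν + ∫⁻ s, (1 - μ.rnDeriv ν s) ∂ν
      = 1 + ∫⁻ s, (μ.rnDeriv ν s - 1) ∂ν := by
    rw [← lintegral_add_left hg]
    have h1ν : 1 + ∫⁻ s, (μ.rnDeriv ν s - 1) ∂ν = ∫⁻ s, (1 + (μ.rnDeriv ν s - 1)) ∂ν := by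
      rw [lintegral_add_left measurable_const]; simp
    rw [h1ν]
    refine lintegral_congr fun s => ?_
    rw [add_tsub_eq_max, add_tsub_eq_max, max_comm]
  have h3 : μ.singularPart ν Set.univ + ∫⁻ s, μ.rnDeriv ν s ∂ν = 1 := by
    have := congrArg (fun m : Measure S => m Set.univ) (μ.haveLebesgueDecomposition_add ν)
    simpa using this.symm
  have h4 : ∫⁻ s, (μ.rnDeriv ν s - 1) ∂ν + μ.singularPart ν Set.univ
      = ∫⁻ s, (1 - μ.rnDeriv ν s) ∂ν := by
    have : 1 + (∫⁻ s, (μ.rnDeriv ν s - 1) ∂ν + μ.singularPart ν Set.univ)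
        = 1 + ∫⁻ s, (1 - μ.rnDeriv ν s) ∂ν := by
      rw [← add_assoc, ← h2, ← h3]
      ring
    exact (ENNReal.add_right_inj ENNReal.one_ne_top).1 this
  rw [tvDiv, h1, add_assoc, h4, ← two_mul]
  rw [mul_comm, ENNReal.mul_div_cancel_right (by simp) (by simp)]

lemma tv_weak_duality {μ ν : Measure S} [IsProbabilityMeasure μ] [IsProbabilityMeasure ν]
    {V : S → ℝ} (hV : Measurable V) (h0 : ∀ s, 0 ≤ V s) {lam : ℝ} (hlam : 0 < lam) :
    ENNReal.ofReal (dualValue .TV lam ν V)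
      ≤ ∫⁻ s, ENNReal.ofReal (V s) ∂μ + ENNReal.ofReal lam * tvDiv μ ν := by
  set m := ⨅ s, V s with hm
  have hbdd : BddBelow (Set.range V) := ⟨0, by rintro _ ⟨s, rfl⟩; exact h0 s⟩
  have hm0 : 0 ≤ m := Real.iInf_nonneg h0
  have hmV : ∀ s, m ≤ V s := fun s => ciInf_le hbdd s
  set F : S → ℝ≥0∞ := fun s => ENNReal.ofReal (min (V s) (m + lam) - m) with hF
  have hFm : Measurable F := ((hV.min measurable_const).sub_const m).ennreal_ofReal
  have hFle : ∀ s, F s ≤ ENNReal.ofReal lam := fun s =>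
    ENNReal.ofReal_le_ofReal (by linarith [min_le_right (V s) (m + lam)])
  have hsplit : ∀ s, ENNReal.ofReal (min (V s) (m + lam)) = ENNReal.ofReal m + F s := fun s => by
    have : m ≤ min (V s) (m + lam) := le_min (hmV s) (by linarith)
    rw [hF, ← ENNReal.ofReal_add hm0 (by linarith)]; congr 1; ring
  have hg := Measure.measurable_rnDeriv μ ν
  have h1 : ∫⁻ s, F s ∂ν ≤ ∫⁻ s, F s ∂μ + ENNReal.ofReal lam * tvDiv μ ν := by
    calc ∫⁻ s, F s ∂ν ≤ ∫⁻ s, (μ.rnDeriv ν s * F s + ENNReal.ofReal lam * (1 - μ.rnDeriv ν s)) ∂ν := by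
          refine lintegral_mono fun s => ?_
          calc F s = 1 * F s := (one_mul _).symm
            _ ≤ (μ.rnDeriv ν s + (1 - μ.rnDeriv ν s)) * F s := by gcongr; exact le_add_tsub
            _ = μ.rnDeriv ν s * F s + F s * (1 - μ.rnDeriv ν s) := by ring
            _ ≤ _ := by gcongr; exact hFle s
      _ = ∫⁻ s, F s ∂(ν.withDensity (μ.rnDeriv ν)) + ENNReal.ofReal lam * tvDiv μ ν := by
          have hgF : Measurable fun s => μ.rnDeriv ν s * F s := hg.mul hFm
          have hg' : Measurable fun s => 1 - μ.rnDeriv ν s := measurable_const.sub hg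
          rw [lintegral_add_left hgF, lintegral_const_mul _ hg',
            tvDiv_eq_lintegral, lintegral_withDensity_eq_lintegral_mul _ hg hFm]
          rfl
      _ ≤ _ := by
          gcongr
          exact Measure.withDensity_rnDeriv_le μ ν
  have h2 : ENNReal.ofReal (dualValue .TV lam ν V) ≤ ENNReal.ofReal m + ∫⁻ s, F s ∂ν := by
    rw [dualValue, ofReal_integral_eq_lintegral_ofReal]
    · simp_rw [← hm, hsplit]
      rw [lintegral_add_left measurable_const]; simp
    · exact integrable_of_bounds (hV.min measurable_const)
        (fun s => le_min (h0 s) (by positivity)) (fun s => min_le_right _ _)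
    · exact Filter.Eventually.of_forall fun s => le_min (h0 s) (by positivity)
  calc _ ≤ ENNReal.ofReal m + ∫⁻ s, F s ∂ν := h2
    _ ≤ ENNReal.ofReal m + (∫⁻ s, F s ∂μ + ENNReal.ofReal lam * tvDiv μ ν) := by gcongr
    _ = ∫⁻ s, (ENNReal.ofReal m + F s) ∂μ + ENNReal.ofReal lam * tvDiv μ ν := by
        rw [lintegral_add_left measurable_const]; simp [add_assoc]
    _ ≤ _ := by
        gcongr with s
        rw [← hsplit]
        exact ENNReal.ofReal_le_ofReal (min_le_left _ _)

/-- The infimum in the total variation dual is approached by moving the mass of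
`{V > inf V + λ}` to a point where `V` is almost minimal. -/
lemma tv_strong_duality (ν : Measure S) [IsProbabilityMeasure ν]
    {V : S → ℝ} (hV : Measurable V) (h0 : ∀ s, 0 ≤ V s) {lam : ℝ} (hlam : 0 < lam)
    {ε : ℝ} (hε : 0 < ε) :
    ∃ μ : Measure S, IsProbabilityMeasure μ ∧
      ∫⁻ s, ENNReal.ofReal (V s) ∂μ + ENNReal.ofReal lam * tvDiv μ ν
        ≤ ENNReal.ofReal (dualValue .TV lam ν V + ε) ∧
      ENNReal.ofReal lam * tvDiv μ ν ≤ ⨆ s, ENNReal.ofReal (V s) := by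
  have hne : Nonempty S := ν.nonempty_of_neZero
  set m := ⨅ s, V s with hm
  have hm0 : 0 ≤ m := Real.iInf_nonneg h0
  obtain ⟨s₀, hs₀⟩ : ∃ s, V s < m + ε := exists_lt_of_ciInf_lt (by linarith)
  set A : Set S := {s | V s ≤ m + lam} with hA
  have hAm : MeasurableSet A := measurableSet_le hV measurable_const
  set μ : Measure S := ν.restrict A + ν Aᶜ • Measure.dirac s₀ with hμ
  have hprob : IsProbabilityMeasure μ := ⟨by
    simp only [hμ, Measure.coe_add, Pi.add_apply, Measure.restrict_apply_univ,
      Measure.smul_apply, measure_univ, smul_eq_mul, mul_one]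
    rw [measure_add_measure_compl hAm, measure_univ]⟩
  have htv : tvDiv μ ν ≤ ν Aᶜ := by
    rw [tvDiv_eq_lintegral]
    have : IsFiniteMeasure (ν Aᶜ • Measure.dirac s₀) :=
      (Measure.dirac s₀).smul_finite (measure_ne_top _ _)
    have hae : ∀ᵐ s ∂ν, 1 - μ.rnDeriv ν s ≤ Aᶜ.indicator 1 s := by
      filter_upwards [Measure.rnDeriv_add' (ν.restrict A) (ν Aᶜ • Measure.dirac s₀) ν,
        Measure.rnDeriv_restrict_self ν hAm] with s h1 h2
      rw [hμ, h1, Pi.add_apply, h2]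
      by_cases hs : s ∈ A
      · simp [hs, tsub_eq_zero_of_le]
      · simp [hs]
    calc _ ≤ ∫⁻ s, Aᶜ.indicator 1 s ∂ν := lintegral_mono_ae hae
      _ = ν Aᶜ := lintegral_indicator_one hAm.compl
  have hf0 : ∀ s, 0 ≤ min (V s) (m + lam) := fun s => le_min (h0 s) (by positivity)
  refine ⟨μ, hprob, ?_, ?_⟩
  · have h1 : ENNReal.ofReal (dualValue .TV lam ν V + ε)
        = ∫⁻ s, (ENNReal.ofReal (min (V s) (m + lam)) + ENNReal.ofReal ε) ∂ν := by
      rw [dualValue, ENNReal.ofReal_add (integral_nonneg hf0) hε.le,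
        ofReal_integral_eq_lintegral_ofReal, lintegral_add_right _ measurable_const]
      · simp
      · exact integrable_of_bounds (hV.min measurable_const) hf0 (fun s => min_le_right _ _)
      · exact Filter.Eventually.of_forall hf0
    have h2 : ∫⁻ s, ENNReal.ofReal (V s) ∂μ
        = ∫⁻ s in A, ENNReal.ofReal (V s) ∂ν + ν Aᶜ * ENNReal.ofReal (V s₀) := by
      rw [hμ, lintegral_add_measure, lintegral_smul_measure,
        lintegral_dirac' _ hV.ennreal_ofReal, smul_eq_mul]
    rw [h1, ← lintegral_add_compl (μ := ν) _ hAm, h2, add_assoc]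
    refine add_le_add ?_ ?_
    · refine setLIntegral_mono' hAm fun s hs => ?_
      rw [min_eq_left hs]
      exact le_self_add
    · calc ν Aᶜ * ENNReal.ofReal (V s₀) + ENNReal.ofReal lam * tvDiv μ ν
          ≤ ν Aᶜ * ENNReal.ofReal (m + ε) + ENNReal.ofReal lam * ν Aᶜ := by
            gcongr
        _ = (ENNReal.ofReal (m + lam) + ENNReal.ofReal ε) * ν Aᶜ := by
            rw [ENNReal.ofReal_add hm0 hε.le, ENNReal.ofReal_add hm0 hlam.le]; ring
        _ = ∫⁻ _ in Aᶜ, (ENNReal.ofReal (m + lam) + ENNReal.ofReal ε) ∂ν := by simp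
        _ ≤ _ := by
            refine setLIntegral_mono' hAm.compl fun s hs => ?_
            have : m + lam ≤ V s := by
              have : m + lam < V s := not_le.1 hs
              exact this.le
            rw [min_eq_right this]
  · by_cases hAe : ∃ s, s ∈ Aᶜ
    · obtain ⟨s, hs⟩ := hAe
      have : lam ≤ V s := by
        have : m + lam < V s := not_le.1 hs
        linarith
      calc _ ≤ ENNReal.ofReal lam * 1 := by gcongr; exact htv.trans prob_le_one
        _ ≤ ENNReal.ofReal (V s) := by rw [mul_one]; exact ENNReal.ofReal_le_ofReal this
        _ ≤ _ := le_iSup (fun s => ENNReal.ofReal (V s)) s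
    · have : Aᶜ = ∅ := Set.eq_empty_of_forall_notMem fun s hs => hAe ⟨s, hs⟩
      rw [this, measure_empty, nonpos_iff_eq_zero] at htv
      simp [htv]

/-! #### Kullback-Leibler divergence -/

lemma integrable_exp_neg_div {ν : Measure S} [IsProbabilityMeasure ν]
    {V : S → ℝ} (hV : Measurable V) (h0 : ∀ s, 0 ≤ V s) {lam : ℝ} (hlam : 0 < lam) :
    Integrable (fun s => Real.exp (-V s / lam)) ν :=
  integrable_of_bounds (B := 1) (hV.neg.div_const lam).exp (fun s => (Real.exp_pos _).le)
    fun s => Real.exp_le_one_iff.2 (div_nonpos_of_nonpos_of_nonneg (by linarith [h0 s]) hlam.le)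

lemma kl_weak_duality {μ ν : Measure S} [IsProbabilityMeasure μ] [IsProbabilityMeasure ν]
    {V : S → ℝ} (hV : Measurable V) (h0 : ∀ s, 0 ≤ V s) {B : ℝ} (hB : ∀ s, V s ≤ B)
    {lam : ℝ} (hlam : 0 < lam) :
    ENNReal.ofReal (dualValue .KL lam ν V)
      ≤ ∫⁻ s, ENNReal.ofReal (V s) ∂μ
        + ENNReal.ofReal lam * InformationTheory.klDiv μ ν := by
  by_cases htop : InformationTheory.klDiv μ ν = ⊤
  · rw [htop, ENNReal.mul_top (by simpa using hlam)]; simp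
  obtain ⟨hac, hint⟩ := InformationTheory.klDiv_ne_top_iff.1 htop
  have hexp := integrable_exp_neg_div (ν := ν) hV h0 hlam
  have hVi : Integrable V μ := integrable_of_bounds hV h0 hB
  have hfi : Integrable (fun s => -V s / lam) μ := hVi.neg.div_const lam
  have := isProbabilityMeasure_tilted hexp
  have h1 := InformationTheory.integral_llr_add_sub_measure_univ_nonneg
    (hac.trans (absolutelyContinuous_tilted hexp))
    (integrable_llr_tilted_right hac hfi hint hexp)
  rw [integral_llr_tilted_right hac hfi hexp hint] at h1
  simp only [probReal_univ, add_sub_cancel_right] at h1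
  have h2 : ∫ s, -V s / lam ∂μ = -(∫ s, V s ∂μ) / lam := by
    rw [integral_div, integral_neg]
  have h3 : 0 ≤ ∫ s, llr μ ν s ∂μ := by
    simpa using InformationTheory.integral_llr_add_sub_measure_univ_nonneg hac hint
  rw [InformationTheory.klDiv_of_ac_of_integrable hac hint,
    ← ofReal_integral_eq_lintegral_ofReal hVi (Filter.Eventually.of_forall h0),
    ← ENNReal.ofReal_mul hlam.le, ← ENNReal.ofReal_add (integral_nonneg h0) (by simp; positivity)]
  refine ENNReal.ofReal_le_ofReal ?_
  simp only [dualValue, probReal_univ, add_sub_cancel_right]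
  rw [h2] at h1
  have h4 : 0 ≤ lam * (∫ x, llr μ ν x ∂μ - -(∫ s, V s ∂μ) / lam
      + Real.log (∫ x, Real.exp (-V x / lam) ∂ν)) := by positivity
  have h5 : lam * (-(∫ s, V s ∂μ) / lam) = -∫ s, V s ∂μ := by field_simp
  linarith

/-- The infimum in the Kullback-Leibler dual is attained at the Gibbs measure. -/
lemma kl_strong_duality (ν : Measure S) [IsProbabilityMeasure ν]
    {V : S → ℝ} (hV : Measurable V) (h0 : ∀ s, 0 ≤ V s) {B : ℝ} (hB : ∀ s, V s ≤ B)
    {lam : ℝ} (hlam : 0 < lam) :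
    ∃ μ : Measure S, IsProbabilityMeasure μ ∧
      ∫⁻ s, ENNReal.ofReal (V s) ∂μ + ENNReal.ofReal lam * InformationTheory.klDiv μ ν
        ≤ ENNReal.ofReal (dualValue .KL lam ν V) := by
  have hexp := integrable_exp_neg_div (ν := ν) hV h0 hlam
  have hprob := isProbabilityMeasure_tilted hexp
  set μ := ν.tilted fun s => -V s / lam with hμ
  have hac : μ ≪ ν := tilted_absolutelyContinuous _ _
  have hVi : Integrable V μ := integrable_of_bounds hV h0 hB
  have hfi : Integrable (fun s => -V s / lam) μ := hVi.neg.div_const lam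
  have hllr : llr μ ν =ᵐ[μ] fun s => -V s / lam - Real.log (∫ s, Real.exp (-V s / lam) ∂ν) :=
    hac.ae_le (log_rnDeriv_tilted_left_self hexp)
  have hint : Integrable (llr μ ν) μ := (integrable_congr hllr).2 (hfi.sub (integrable_const _))
  have h1 : ∫ s, llr μ ν s ∂μ
      = -(∫ s, V s ∂μ) / lam - Real.log (∫ s, Real.exp (-V s / lam) ∂ν) := by
    rw [integral_congr_ae hllr, integral_sub hfi (integrable_const _), integral_div, integral_neg]
    simp
  have h3 : 0 ≤ ∫ s, llr μ ν s ∂μ := by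
    simpa using InformationTheory.integral_llr_add_sub_measure_univ_nonneg hac hint
  refine ⟨μ, hprob, ?_⟩
  rw [InformationTheory.klDiv_of_ac_of_integrable hac hint,
    ← ofReal_integral_eq_lintegral_ofReal hVi (Filter.Eventually.of_forall h0),
    ← ENNReal.ofReal_mul hlam.le, ← ENNReal.ofReal_add (integral_nonneg h0) (by simp; positivity)]
  refine ENNReal.ofReal_le_ofReal ?_
  simp only [dualValue, probReal_univ, add_sub_cancel_right]
  have h5 : lam * (-(∫ s, V s ∂μ) / lam) = -∫ s, V s ∂μ := by field_simp
  rw [h1, mul_sub, h5]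
  linarith

/-! #### The `χ²`-divergence -/

lemma iInf_le_iSup_of_bounds {T : Type*} [Nonempty T] {V : T → ℝ} {B : ℝ} (h0 : ∀ s, 0 ≤ V s)
    (hB : ∀ s, V s ≤ B) : ⨅ s, V s ≤ ⨆ s, V s :=
  ciInf_le_ciSup ⟨0, by rintro _ ⟨s, rfl⟩; exact h0 s⟩ ⟨B, by rintro _ ⟨s, rfl⟩; exact hB s⟩

section ChiSq

variable {V : S → ℝ} {B α lam : ℝ}

lemma integrable_min (ν : Measure S) [IsFiniteMeasure ν] (hV : Measurable V) (h0 : ∀ s, 0 ≤ V s)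
    (hα : 0 ≤ α) : Integrable (fun s => min (V s) α) ν :=
  integrable_of_bounds (hV.min measurable_const) (fun s => le_min (h0 s) hα)
    fun _ => min_le_right _ _

lemma integrable_min_sq (ν : Measure S) [IsFiniteMeasure ν] (hV : Measurable V)
    (h0 : ∀ s, 0 ≤ V s) (hα : 0 ≤ α) : Integrable (fun s => (min (V s) α) ^ 2) ν :=
  integrable_of_bounds (B := α ^ 2) ((hV.min measurable_const).pow_const 2)
    (fun _ => sq_nonneg _)
    fun s => pow_le_pow_left₀ (le_min (h0 s) hα) (min_le_right _ _) 2

/-- The difference of the two sides is the integral of the square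
`λ (dμ/dν - 1 + (f - ν f) / (2 λ)) ^ 2` with `f = min V α`. -/
lemma chiSqDual_le {μ ν : Measure S} [IsProbabilityMeasure μ] [IsProbabilityMeasure ν]
    (hV : Measurable V) (h0 : ∀ s, 0 ≤ V s) (hα : 0 ≤ α) (hlam : 0 < lam) :
    ENNReal.ofReal (chiSqDual lam ν V α)
      ≤ ∫⁻ s, ENNReal.ofReal (V s) ∂μ + ENNReal.ofReal lam * chiSqDiv μ ν := by
  by_cases htop : chiSqDiv μ ν = ⊤
  · rw [htop, ENNReal.mul_top (by simpa using hlam)]; simp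
  have hac : μ ≪ ν := by
    by_contra h
    exact htop (by rw [chiSqDiv, if_neg h])
  have hD : chiSqDiv μ ν = ∫⁻ s, ENNReal.ofReal (((μ.rnDeriv ν s).toReal - 1) ^ 2) ∂ν := by
    rw [chiSqDiv, if_pos hac]
  rw [hD] at htop ⊢
  set g : S → ℝ := fun s => (μ.rnDeriv ν s).toReal with hg
  set f : S → ℝ := fun s => min (V s) α with hf
  have hgm : Measurable g := (Measure.measurable_rnDeriv μ ν).ennreal_toReal
  have hf0 : ∀ s, 0 ≤ f s := fun s => le_min (h0 s) hα
  have hgi : Integrable g ν := Measure.integrable_toReal_rnDeriv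
  have hfi : Integrable f ν := integrable_min ν hV h0 hα
  have hf2i : Integrable (fun s => f s ^ 2) ν := integrable_min_sq ν hV h0 hα
  have hsqi : Integrable (fun s => (g s - 1) ^ 2) ν :=
    ⟨((hgm.sub_const 1).pow_const 2).aestronglyMeasurable, by
      rw [hasFiniteIntegral_iff_ofReal (Filter.Eventually.of_forall fun s => sq_nonneg _)]
      exact lt_top_iff_ne_top.2 htop⟩
  have hgf : Integrable (fun s => g s * f s) ν :=
    hgi.mul_bdd (c := α) (hV.min measurable_const).aestronglyMeasurable
      (Filter.Eventually.of_forall fun s => by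
        rw [Real.norm_of_nonneg (hf0 s)]; exact min_le_right _ _)
  have hg1 : ∫ s, g s ∂ν = 1 := by
    rw [Measure.integral_toReal_rnDeriv hac]; simp
  have hμf : ∫ s, f s ∂μ = ∫ s, g s * f s ∂ν := by
    rw [← integral_rnDeriv_smul hac]; rfl
  set c := ∫ s, f s ∂ν with hc
  have hsq : 0 ≤ ∫ s, lam * (g s - 1 + (f s - c) / (2 * lam)) ^ 2 ∂ν :=
    integral_nonneg fun s => by positivity
  have hexp : ∫ s, lam * (g s - 1 + (f s - c) / (2 * lam)) ^ 2 ∂ν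
      = lam * ∫ s, (g s - 1) ^ 2 ∂ν + ∫ s, g s * f s ∂ν - c * ∫ s, g s ∂ν - c + c
        + 1 / (4 * lam) * ∫ s, f s ^ 2 ∂ν - 1 / (2 * lam) * c * c + 1 / (4 * lam) * c ^ 2 := by
    have : ∀ s, lam * (g s - 1 + (f s - c) / (2 * lam)) ^ 2
        = lam * (g s - 1) ^ 2 + g s * f s - c * g s - f s + c
          + 1 / (4 * lam) * f s ^ 2 - 1 / (2 * lam) * c * f s + 1 / (4 * lam) * c ^ 2 := by
      intro s; field_simp; ring
    simp_rw [this]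
    have i1 := hsqi.const_mul lam
    have i2 := i1.add hgf
    have i3 := i2.sub (hgi.const_mul c)
    have i4 := i3.sub hfi
    have i5 := i4.add (integrable_const c)
    have i6 := i5.add (hf2i.const_mul (1 / (4 * lam)))
    have i7 := i6.sub (hfi.const_mul (1 / (2 * lam) * c))
    refine (integral_add i7 (integrable_const _)).trans ?_
    rw [integral_sub' i6 (hfi.const_mul _),
      integral_add' i5 (hf2i.const_mul _), integral_add' i4 (integrable_const _),
      integral_sub' i3 hfi, integral_sub' i2 (hgi.const_mul _), integral_add' i1 hgf,
      integral_const_mul, integral_const_mul, integral_const_mul, integral_const_mul]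
    simp [← hc]
  rw [hexp, hg1, ← hμf] at hsq
  have hfμ : ∫⁻ s, ENNReal.ofReal (f s) ∂μ ≤ ∫⁻ s, ENNReal.ofReal (V s) ∂μ :=
    lintegral_mono fun s => ENNReal.ofReal_le_ofReal (min_le_left _ _)
  refine le_trans ?_ (add_le_add_left hfμ _)
  rw [← ofReal_integral_eq_lintegral_ofReal (integrable_min μ hV h0 hα)
      (Filter.Eventually.of_forall hf0),
    ← ofReal_integral_eq_lintegral_ofReal hsqi (Filter.Eventually.of_forall fun s => sq_nonneg _),
    ← ENNReal.ofReal_mul hlam.le, ← ENNReal.ofReal_add (integral_nonneg hf0)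
      (mul_nonneg hlam.le (integral_nonneg fun s => sq_nonneg _))]
  refine ENNReal.ofReal_le_ofReal ?_
  rw [chiSqDual]
  have e : 1 / (2 * lam) * c * c = 2 * (1 / (4 * lam) * c ^ 2) := by field_simp; ring
  rw [e] at hsq
  change c + 1 / (4 * lam) * c ^ 2 - 1 / (4 * lam) * ∫ s, f s ^ 2 ∂ν ≤ _
  linarith

lemma chiSqDiv_self (ν : Measure S) [IsProbabilityMeasure ν] : chiSqDiv ν ν = 0 := by
  rw [chiSqDiv, if_pos Measure.AbsolutelyContinuous.rfl]
  rw [lintegral_congr_ae (g := fun _ => 0)]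
  · simp
  · filter_upwards [Measure.rnDeriv_self ν] with s hs
    simp [hs]

lemma chiSqDual_le_integral {ν : Measure S} [IsProbabilityMeasure ν]
    (hV : Measurable V) (h0 : ∀ s, 0 ≤ V s) (hB : ∀ s, V s ≤ B) (hα : 0 ≤ α) (hlam : 0 < lam) :
    chiSqDual lam ν V α ≤ ∫ s, V s ∂ν := by
  have h := chiSqDual_le (μ := ν) (ν := ν) hV h0 hα hlam
  rw [chiSqDiv_self, mul_zero, add_zero, ← ofReal_integral_eq_lintegral_ofReal
    (integrable_of_bounds hV h0 hB) (Filter.Eventually.of_forall h0)] at h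
  exact (ENNReal.ofReal_le_ofReal_iff (integral_nonneg h0)).1 h

lemma bddAbove_chiSqDual {ν : Measure S} [IsProbabilityMeasure ν]
    (hV : Measurable V) (h0 : ∀ s, 0 ≤ V s) (hB : ∀ s, V s ≤ B) (hlam : 0 < lam) :
    BddAbove (chiSqDual lam ν V '' Set.Icc (⨅ s, V s) (⨆ s, V s)) := by
  refine ⟨∫ s, V s ∂ν, ?_⟩
  rintro _ ⟨α, hα, rfl⟩
  exact chiSqDual_le_integral hV h0 hB ((Real.iInf_nonneg h0).trans hα.1) hlam

lemma chiSq_weak_duality {μ ν : Measure S} [IsProbabilityMeasure μ] [IsProbabilityMeasure ν]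
    (hV : Measurable V) (h0 : ∀ s, 0 ≤ V s) (hB : ∀ s, V s ≤ B) (hlam : 0 < lam) :
    ENNReal.ofReal (dualValue .chiSq lam ν V)
      ≤ ∫⁻ s, ENNReal.ofReal (V s) ∂μ + ENNReal.ofReal lam * chiSqDiv μ ν := by
  have hne : Nonempty S := ν.nonempty_of_neZero
  rcases eq_or_ne (∫⁻ s, ENNReal.ofReal (V s) ∂μ + ENNReal.ofReal lam * chiSqDiv μ ν) ⊤ with h | h
  · rw [h]; exact le_top
  refine ENNReal.ofReal_le_of_le_toReal (csSup_le ?_ ?_)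
  · exact (Set.nonempty_Icc.2 (iInf_le_iSup_of_bounds h0 hB)).image _
  · rintro _ ⟨α, hα, rfl⟩
    exact (ENNReal.ofReal_le_iff_le_toReal h).1
      (chiSqDual_le hV h0 ((Real.iInf_nonneg h0).trans hα.1) hlam)

/-- The infimum in the `χ²` dual is attained at the density `1 + (ν f - f) / (2 λ)` with
`f = min V α`, where `α` is the supremum of `V` if this density is nonnegative, and is chosen such
that the density vanishes on `{V ≥ α}` otherwise. -/
lemma chiSq_strong_duality (ν : Measure S) [IsProbabilityMeasure ν]
    (hV : Measurable V) (h0 : ∀ s, 0 ≤ V s) (hB : ∀ s, V s ≤ B) (hlam : 0 < lam) :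
    ∃ μ : Measure S, IsProbabilityMeasure μ ∧
      ∫⁻ s, ENNReal.ofReal (V s) ∂μ + ENNReal.ofReal lam * chiSqDiv μ ν
        ≤ ENNReal.ofReal (dualValue .chiSq lam ν V) := by
  have hne : Nonempty S := ν.nonempty_of_neZero
  have hsup : ∀ s, V s ≤ ⨆ s, V s := fun s => le_ciSup ⟨B, by rintro _ ⟨s, rfl⟩; exact hB s⟩ s
  have hinf : ∀ s, ⨅ s, V s ≤ V s := fun s => ciInf_le ⟨0, by rintro _ ⟨s, rfl⟩; exact h0 s⟩ s
  have hinf0 : 0 ≤ ⨅ s, V s := Real.iInf_nonneg h0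
  obtain ⟨α, hα, hle, hzero⟩ : ∃ α ∈ Set.Icc (⨅ s, V s) (⨆ s, V s),
      α - ∫ s, min (V s) α ∂ν ≤ 2 * lam ∧
      ∀ s, α < V s → α - ∫ s, min (V s) α ∂ν = 2 * lam := by
    by_cases hcase : (⨆ s, V s) - ∫ s, min (V s) (⨆ s, V s) ∂ν ≤ 2 * lam
    · exact ⟨⨆ s, V s, ⟨iInf_le_iSup_of_bounds h0 hB, le_rfl⟩, hcase,
        fun s hs => absurd (hsup s) (not_le.2 hs)⟩
    · have hcont : ContinuousOn (fun α => α - ∫ s, min (V s) α ∂ν)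
          (Set.Icc (⨅ s, V s) (⨆ s, V s)) := by
        refine continuousOn_id.sub ?_
        refine continuousOn_of_dominated (bound := fun _ => |B|)
          (fun α _ => (hV.min measurable_const).aestronglyMeasurable) ?_ (integrable_const _)
          (Filter.Eventually.of_forall fun _ => (continuous_const.min continuous_id).continuousOn)
        intro α hα
        refine Filter.Eventually.of_forall fun s => ?_
        rw [Real.norm_of_nonneg (le_min (h0 s) (hinf0.trans hα.1))]
        exact (min_le_left _ _).trans ((hB s).trans (le_abs_self B))
      have hmem : 2 * lam ∈ Set.Icc ((⨅ s, V s) - ∫ s, min (V s) (⨅ s, V s) ∂ν)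
          ((⨆ s, V s) - ∫ s, min (V s) (⨆ s, V s) ∂ν) := by
        refine ⟨?_, (not_le.1 hcase).le⟩
        simp_rw [min_eq_right (hinf _)]
        simp [hlam.le]
      obtain ⟨α, hα, h⟩ := intermediate_value_Icc (iInf_le_iSup_of_bounds h0 hB) hcont hmem
      exact ⟨α, hα, h.le, fun s _ => h⟩
  have hα0 : 0 ≤ α := hinf0.trans hα.1
  set f : S → ℝ := fun s => min (V s) α with hf
  set c := ∫ s, f s ∂ν with hc
  set g : S → ℝ := fun s => 1 + (c - f s) / (2 * lam) with hg
  have hfm : Measurable f := hV.min measurable_const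
  have hgm : Measurable g := ((hfm.const_sub c).div_const _).const_add 1
  have hf0 : ∀ s, 0 ≤ f s := fun s => le_min (h0 s) hα0
  have hg0 : ∀ s, 0 ≤ g s := fun s => by
    have : f s ≤ α := min_le_right _ _
    have : -1 ≤ (c - f s) / (2 * lam) := by
      rw [le_div_iff₀ (by positivity)]; linarith
    simp only [hg]; linarith
  have hgV : ∀ s, g s * V s = g s * f s := fun s => by
    rcases le_or_gt (V s) α with h | h
    · simp [hf, min_eq_left h]
    · have h1 := hzero s h
      have : g s = 0 := by
        simp only [hg, hf, min_eq_right h.le]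
        rw [← neg_sub, h1]; field_simp; ring
      simp [this]
  have hfi : Integrable f ν := integrable_min ν hV h0 hα0
  have hf2i : Integrable (fun s => f s ^ 2) ν := integrable_min_sq ν hV h0 hα0
  have hgi : Integrable g ν := (integrable_const _).add (((integrable_const _).sub hfi).div_const _)
  have hg1 : ∫ s, g s ∂ν = 1 := by
    simp only [hg]
    refine (integral_add (integrable_const _) (((integrable_const c).sub hfi).div_const _)).trans ?_
    rw [integral_div, integral_sub' (integrable_const _) hfi]
    simp [← hc]
  set μ := ν.withDensity fun s => ENNReal.ofReal (g s) with hμ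
  have hprob : IsProbabilityMeasure μ := ⟨by
    rw [hμ, withDensity_apply _ MeasurableSet.univ, Measure.restrict_univ,
      ← ofReal_integral_eq_lintegral_ofReal hgi (Filter.Eventually.of_forall hg0), hg1]
    simp⟩
  have hD : chiSqDiv μ ν = ENNReal.ofReal (∫ s, (g s - 1) ^ 2 ∂ν) := by
    rw [chiSqDiv, if_pos (withDensity_absolutelyContinuous _ _),
      ofReal_integral_eq_lintegral_ofReal]
    · refine lintegral_congr_ae ?_
      filter_upwards [Measure.rnDeriv_withDensity ν hgm.ennreal_ofReal] with s hs
      rw [hμ, hs, ENNReal.toReal_ofReal (hg0 s)]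
    · have : (fun s => (g s - 1) ^ 2) = fun s =>
          (1 / (4 * lam ^ 2)) * (c ^ 2 - 2 * c * f s + f s ^ 2) := by
        funext s; simp only [hg]; field_simp; ring
      rw [this]
      exact (((integrable_const _).sub (hfi.const_mul _)).add hf2i).const_mul _
    · exact Filter.Eventually.of_forall fun s => sq_nonneg _
  have hVμ : ∫⁻ s, ENNReal.ofReal (V s) ∂μ = ENNReal.ofReal (∫ s, g s * f s ∂ν) := by
    rw [hμ, lintegral_withDensity_eq_lintegral_mul _ hgm.ennreal_ofReal hV.ennreal_ofReal,
      ofReal_integral_eq_lintegral_ofReal]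
    · refine lintegral_congr fun s => ?_
      rw [Pi.mul_apply, ← ENNReal.ofReal_mul (hg0 s), hgV]
    · exact hgi.mul_bdd (c := α) hfm.aestronglyMeasurable
        (Filter.Eventually.of_forall fun s => by
          rw [Real.norm_of_nonneg (hf0 s)]; exact min_le_right _ _)
    · exact Filter.Eventually.of_forall fun s => mul_nonneg (hg0 s) (hf0 s)
  refine ⟨μ, hprob, ?_⟩
  rw [hD, hVμ, ← ENNReal.ofReal_mul hlam.le, ← ENNReal.ofReal_add
    (integral_nonneg fun s => mul_nonneg (hg0 s) (hf0 s))
    (mul_nonneg hlam.le (integral_nonneg fun s => sq_nonneg _))]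
  refine ENNReal.ofReal_le_ofReal ?_
  refine le_trans (le_of_eq ?_) (le_csSup (bddAbove_chiSqDual hV h0 hB hlam) ⟨α, hα, rfl⟩)
  have e1 : ∫ s, (g s - 1) ^ 2 ∂ν
      = 1 / (4 * lam ^ 2) * (c ^ 2 - 2 * c * c + ∫ s, f s ^ 2 ∂ν) := by
    have : (fun s => (g s - 1) ^ 2) = fun s =>
        (1 / (4 * lam ^ 2)) * (c ^ 2 - 2 * c * f s + f s ^ 2) := by
      funext s; simp only [hg]; field_simp; ring
    have i1 : Integrable (fun s => 2 * c * f s) ν := hfi.const_mul _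
    have i2 : Integrable (fun s => c ^ 2 - 2 * c * f s) ν := (integrable_const _).sub i1
    rw [this, integral_const_mul, integral_add i2 hf2i, integral_sub (integrable_const _) i1,
      integral_const_mul]
    simp [← hc]
  have e2 : ∫ s, g s * f s ∂ν = (1 + c / (2 * lam)) * c - 1 / (2 * lam) * ∫ s, f s ^ 2 ∂ν := by
    have : (fun s => g s * f s) = fun s =>
        (1 + c / (2 * lam)) * f s - 1 / (2 * lam) * f s ^ 2 := by
      funext s; simp only [hg]; field_simp; ring
    rw [this, integral_sub (hfi.const_mul _) (hf2i.const_mul _), integral_const_mul,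
      integral_const_mul]
  rw [e1, e2, chiSqDual]
  change _ = c + 1 / (4 * lam) * c ^ 2 - 1 / (4 * lam) * ∫ s, f s ^ 2 ∂ν
  field_simp
  ring

end ChiSq

/-! #### The three divergences together -/

/-- Weak duality: the dual value is a lower bound for the regularized expectation. -/
lemma weak_duality (D : Divergence) {μ ν : Measure S} [IsProbabilityMeasure μ]
    [IsProbabilityMeasure ν] {V : S → ℝ} (hV : Measurable V) (h0 : ∀ s, 0 ≤ V s) {B : ℝ}
    (hB : ∀ s, V s ≤ B) {lam : ℝ} (hlam : 0 < lam) :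
    ENNReal.ofReal (dualValue D lam ν V)
      ≤ ∫⁻ s, ENNReal.ofReal (V s) ∂μ + ENNReal.ofReal lam * D.div μ ν := by
  cases D with
  | TV => exact tv_weak_duality hV h0 hlam
  | KL => exact kl_weak_duality hV h0 hB hlam
  | chiSq => exact chiSq_weak_duality hV h0 hB hlam

lemma Divergence.div_self (D : Divergence) (ν : Measure S) [IsProbabilityMeasure ν] :
    D.div ν ν = 0 := by
  cases D with
  | TV =>
    rw [Divergence.div, tvDiv_eq_lintegral, lintegral_congr_ae (g := fun _ => 0)]
    · simp
    · filter_upwards [Measure.rnDeriv_self ν] with s hs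
      simp [hs]
  | KL => exact InformationTheory.klDiv_self ν
  | chiSq => exact chiSqDiv_self ν

lemma ofReal_dualValue_le_lintegral (D : Divergence) {ν : Measure S}
    [IsProbabilityMeasure ν] {V : S → ℝ} (hV : Measurable V) (h0 : ∀ s, 0 ≤ V s) {B : ℝ}
    (hB : ∀ s, V s ≤ B) {lam : ℝ} (hlam : 0 < lam) :
    ENNReal.ofReal (dualValue D lam ν V) ≤ ∫⁻ s, ENNReal.ofReal (V s) ∂ν := by
  simpa [D.div_self] using weak_duality D (μ := ν) (ν := ν) hV h0 hB hlam

/-- Strong duality: the dual value is approached by measures `μ` whose regularization cost is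
at most the supremum of `V`. -/
lemma strong_duality (D : Divergence) (ν : Measure S)
    [IsProbabilityMeasure ν] {V : S → ℝ} (hV : Measurable V) (h0 : ∀ s, 0 ≤ V s) {B : ℝ}
    (hB : ∀ s, V s ≤ B) {lam : ℝ} (hlam : 0 < lam) {ε : ℝ} (hε : 0 < ε) :
    ∃ μ : ProbabilityMeasure S,
      ∫⁻ s, ENNReal.ofReal (V s) ∂(μ : Measure S) + ENNReal.ofReal lam * D.div μ ν
        ≤ ENNReal.ofReal (dualValue D lam ν V) + ENNReal.ofReal ε ∧
      ENNReal.ofReal lam * D.div (μ : Measure S) ν ≤ ⨆ s, ENNReal.ofReal (V s) := by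
  have key : ∀ D : Divergence, (∃ μ : Measure S, IsProbabilityMeasure μ ∧
      ∫⁻ s, ENNReal.ofReal (V s) ∂μ + ENNReal.ofReal lam * D.div μ ν
        ≤ ENNReal.ofReal (dualValue D lam ν V)) → ∃ μ : ProbabilityMeasure S,
      ∫⁻ s, ENNReal.ofReal (V s) ∂(μ : Measure S) + ENNReal.ofReal lam * D.div μ ν
        ≤ ENNReal.ofReal (dualValue D lam ν V) + ENNReal.ofReal ε ∧
      ENNReal.ofReal lam * D.div (μ : Measure S) ν ≤ ⨆ s, ENNReal.ofReal (V s) := by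
    rintro D ⟨μ, hμ, h⟩
    refine ⟨⟨μ, hμ⟩, h.trans le_self_add, (le_add_self.trans h).trans
      ((ofReal_dualValue_le_lintegral D hV h0 hB hlam).trans ?_)⟩
    calc ∫⁻ s, ENNReal.ofReal (V s) ∂ν ≤ ∫⁻ _, (⨆ s, ENNReal.ofReal (V s)) ∂ν :=
          lintegral_mono fun s => le_iSup (fun s => ENNReal.ofReal (V s)) s
      _ = _ := by simp
  cases D with
  | TV =>
    obtain ⟨μ, hμ, h1, h2⟩ := tv_strong_duality ν hV h0 hlam hε
    exact ⟨⟨μ, hμ⟩, h1.trans ENNReal.ofReal_add_le, h2⟩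
  | KL => exact key .KL (kl_strong_duality ν hV h0 hB hlam)
  | chiSq => exact key .chiSq (chiSq_strong_duality ν hV h0 hB hlam)

end Duality

/-! ### Trajectories and the dual Bellman backup -/

section Trajectories

variable {S A : Type*} [MeasurableSpace S] [MeasurableSpace A]

instance FeatureMap.isMarkovKernel_kernel {d : ℕ} (φ : FeatureMap S A d)
    (μ : Fin d → ProbabilityMeasure S) : IsMarkovKernel (φ.kernel μ) :=
  ⟨fun x => ⟨by
    change (∑ i, ENNReal.ofReal (φ.toFun x.1 x.2 i) • (μ i : Measure S)) Set.univ = 1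
    simp only [Measure.coe_finsetSum, Finset.sum_apply, Measure.smul_apply, smul_eq_mul,
      measure_univ, mul_one]
    rw [← ENNReal.ofReal_sum_of_nonneg fun i _ => φ.nonneg _ _ _, φ.sum_eq_one,
      ENNReal.ofReal_one]⟩⟩

lemma FeatureMap.lintegral_kernel {d : ℕ} (φ : FeatureMap S A d)
    (μ : Fin d → ProbabilityMeasure S) (x : S × A) (f : S → ℝ≥0∞) :
    ∫⁻ s, f s ∂(φ.kernel μ x)
      = ∑ i, ENNReal.ofReal (φ.toFun x.1 x.2 i) * ∫⁻ s, f s ∂(μ i : Measure S) := by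
  change ∫⁻ s, f s ∂(∑ i, ENNReal.ofReal (φ.toFun x.1 x.2 i) • (μ i : Measure S)) = _
  rw [lintegral_finsetSum_measure]
  simp_rw [lintegral_smul_measure, smul_eq_mul]

instance Policy.isMarkovKernel (π : Policy S A) (h : ℕ) : IsMarkovKernel (π.kernel h) :=
  π.isMarkov h

variable (π : ℕ → Kernel S A) (P : ℕ → Kernel (S × A) S)

lemma measurable_cons_traj (n : ℕ) :
    Measurable fun x : S × (A × S) × Traj S A n =>
      (Fin.cons (x.1, x.2.1.1, x.2.1.2) x.2.2 : Traj S A (n + 1)) := by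
  refine measurable_pi_iff.2 fun j => ?_
  refine Fin.cases ?_ (fun j => ?_) j
  · simp only [Fin.cons_zero]; fun_prop
  · simp only [Fin.cons_succ]; fun_prop

instance isMarkovKernel_trajKernel [∀ h, IsMarkovKernel (π h)] [∀ h, IsMarkovKernel (P h)] :
    ∀ n h, IsMarkovKernel (trajKernel π P n h)
  | 0, _ => by rw [trajKernel]; infer_instance
  | n + 1, h => by
      have := isMarkovKernel_trajKernel n (h + 1)
      rw [trajKernel]
      exact Kernel.IsMarkovKernel.map _ (measurable_cons_traj n)

lemma lintegral_trajKernel_succ [∀ h, IsMarkovKernel (π h)] [∀ h, IsMarkovKernel (P h)]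
    (n h : ℕ) (s : S) {F : Traj S A (n + 1) → ℝ≥0∞} (hF : Measurable F) :
    ∫⁻ τ, F τ ∂(trajKernel π P (n + 1) h s)
      = ∫⁻ a, ∫⁻ s', ∫⁻ τ, F (Fin.cons (s, a, s') τ) ∂(trajKernel π P n (h + 1) s')
          ∂(P h (s, a)) ∂(π h s) := by
  have hm : Measurable fun x : S × (A × S) × Traj S A n =>
      F (Fin.cons (x.1, x.2.1.1, x.2.1.2) x.2.2 : Traj S A (n + 1)) :=
    hF.comp (measurable_cons_traj n)
  have hm' : Measurable fun x : (A × S) × Traj S A n =>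
      F (Fin.cons (s, x.1.1, x.1.2) x.2 : Traj S A (n + 1)) :=
    hm.comp (measurable_const.prodMk measurable_id)
  rw [trajKernel, Kernel.lintegral_map _ (measurable_cons_traj n) _ hF,
    Kernel.lintegral_prod _ _ _ hm, Kernel.lintegral_id' hm.lintegral_prod_right']
  rw [Kernel.lintegral_compProd _ _ _ hm', Kernel.lintegral_compProd _ _ _ ]
  · rfl
  · exact Measurable.lintegral_kernel_prod_right'
      (κ := (trajKernel π P n (h + 1)).comap (fun b : A × S => b.2) measurable_snd) hm'

/-- The expected sum of the one-step quantities `g_h(s_h, a_h), …, g_{h+n-1}(s_{h+n-1}, a_{h+n-1})`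
along a trajectory started at step `h` in the state `s`. -/
noncomputable def expectedSum (g : ℕ → S → A → ℝ≥0∞) (n h : ℕ) (s : S) : ℝ≥0∞ :=
  ∫⁻ τ, ∑ j : Fin n, g (h + j) (τ j).1 (τ j).2.1 ∂(trajKernel π P n h s)

variable {g : ℕ → S → A → ℝ≥0∞}

lemma measurable_expectedSum [∀ h, IsMarkovKernel (π h)] [∀ h, IsMarkovKernel (P h)]
    (hg : ∀ t, Measurable (Function.uncurry (g t))) (n h : ℕ) :
    Measurable (expectedSum π P g n h) := by
  refine Measurable.lintegral_kernel ?_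
  refine Finset.measurable_sum _ fun j _ => ?_
  have : Measurable fun τ : Traj S A n => ((τ j).1, (τ j).2.1) := by fun_prop
  exact (hg (h + j)).comp this

@[simp]
lemma expectedSum_zero (h : ℕ) (s : S) : expectedSum π P g 0 h s = 0 := by
  simp [expectedSum]

lemma expectedSum_succ [∀ h, IsMarkovKernel (π h)] [∀ h, IsMarkovKernel (P h)]
    (hg : ∀ t, Measurable (Function.uncurry (g t))) (n h : ℕ) (s : S) :
    expectedSum π P g (n + 1) h s
      = ∫⁻ a, (g h s a + ∫⁻ s', expectedSum π P g n (h + 1) s' ∂(P h (s, a))) ∂(π h s) := by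
  have hm : ∀ (n h : ℕ) (j : Fin n),
      Measurable fun τ : Traj S A n => g (h + j) (τ j).1 (τ j).2.1 := fun n h j => by
    have : Measurable fun τ : Traj S A n => ((τ j).1, (τ j).2.1) := by fun_prop
    exact (hg (h + j)).comp this
  rw [expectedSum, lintegral_trajKernel_succ _ _ _ _ _
    (Finset.measurable_sum _ fun j _ => hm _ _ j)]
  refine lintegral_congr fun a => ?_
  simp_rw [Fin.sum_univ_succ]
  simp only [Fin.cons_zero, Fin.cons_succ, Fin.val_zero, add_zero, Fin.val_succ]
  have : ∀ s', ∫⁻ τ : Traj S A n, (g h s a + ∑ j : Fin n, g (h + (j + 1)) (τ j).1 (τ j).2.1)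
        ∂(trajKernel π P n (h + 1) s') = g h s a + expectedSum π P g n (h + 1) s' := fun s' => by
    rw [lintegral_add_left measurable_const, expectedSum]
    simp only [lintegral_const, measure_univ, mul_one]
    congr 1
    refine lintegral_congr fun τ => Finset.sum_congr rfl fun j _ => ?_
    rw [show h + ((j : ℕ) + 1) = h + 1 + j by ring]
  simp_rw [this]
  rw [lintegral_add_left measurable_const]
  simp

/-- Along a trajectory, `s_{j+1}` is drawn from `P_j(· | s_j, a_j)`. -/
lemma lintegral_trajKernel_step [∀ h, IsMarkovKernel (π h)] [∀ h, IsMarkovKernel (P h)]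
    {F : S × A × S → ℝ≥0∞} (hF : Measurable F) (n h : ℕ) (s : S) (j : Fin n) :
    ∫⁻ τ, F (τ j) ∂(trajKernel π P n h s)
      = ∫⁻ τ, ∫⁻ s', F ((τ j).1, (τ j).2.1, s') ∂(P (h + j) ((τ j).1, (τ j).2.1))
          ∂(trajKernel π P n h s) := by
  have hG : ∀ t, Measurable fun x : S × A => ∫⁻ s', F (x.1, x.2, s') ∂(P t x) := fun t =>
    Measurable.lintegral_kernel_prod_right' (κ := P t) (f := fun y => F (y.1.1, y.1.2, y.2))
      (hF.comp (by fun_prop))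
  induction n generalizing h s with
  | zero => exact j.elim0
  | succ n ih =>
    have hm1 : ∀ (n : ℕ) (j : Fin n), Measurable fun τ : Traj S A n => F (τ j) :=
      fun n j => hF.comp (measurable_pi_apply j)
    have hm2 : ∀ (n h : ℕ) (j : Fin n), Measurable fun τ : Traj S A n =>
        ∫⁻ s', F ((τ j).1, (τ j).2.1, s') ∂(P (h + j) ((τ j).1, (τ j).2.1)) := fun n h j => by
      have : Measurable fun τ : Traj S A n => ((τ j).1, (τ j).2.1) := by fun_prop
      exact (hG _).comp this
    rw [lintegral_trajKernel_succ _ _ _ _ _ (hm1 _ j),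
      lintegral_trajKernel_succ _ _ _ _ _ (hm2 _ _ j)]
    refine lintegral_congr fun a => ?_
    induction j using Fin.cases with
    | zero => simp
    | succ j =>
      refine lintegral_congr fun s' => ?_
      simp only [Fin.cons_succ]
      rw [ih]
      simp only [Fin.val_succ, show h + ((j : ℕ) + 1) = h + 1 + j by ring]

end Trajectories

section Data

variable {S A : Type*} [MeasurableSpace S] [MeasurableSpace A] {d H : ℕ}
  (M : LinearMDP S A d H) (ρ : Measure S) (πb : Policy S A)

instance LinearMDP.isProbabilityMeasure_dataTraj [IsProbabilityMeasure ρ] :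
    IsProbabilityMeasure (M.dataTraj ρ πb) := by
  rw [LinearMDP.dataTraj]
  infer_instance

instance LinearMDP.isProbabilityMeasure_dataLaw [IsProbabilityMeasure ρ] (K : ℕ) :
    IsProbabilityMeasure (M.dataLaw ρ πb K) := by
  rw [LinearMDP.dataLaw]
  infer_instance

/-- Under the law of the data, `s_{h+1}` is drawn from `P⁰_h(· | s_h, a_h)`. -/
lemma LinearMDP.lintegral_dataTraj_step {F : S × A × S → ℝ≥0∞} (hF : Measurable F) (h : Fin H) :
    ∫⁻ τ, F (τ h) ∂(M.dataTraj ρ πb)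
      = ∫⁻ τ, ∫⁻ s', F ((τ h).1, (τ h).2.1, s') ∂(M.φ.kernel (M.μ₀ h) ((τ h).1, (τ h).2.1))
          ∂(M.dataTraj ρ πb) := by
  have hG : Measurable fun x : S × A => ∫⁻ s', F (x.1, x.2, s') ∂(M.φ.kernel (M.μ₀ h) x) :=
    Measurable.lintegral_kernel_prod_right' (κ := M.φ.kernel (M.μ₀ h))
      (f := fun y => F (y.1.1, y.1.2, y.2)) (hF.comp (by fun_prop))
  have hm : Measurable fun τ : Traj S A H => ((τ h).1, (τ h).2.1) := by fun_prop
  have hm2 : Measurable fun τ : Traj S A H =>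
      ∫⁻ s', F ((τ h).1, (τ h).2.1, s') ∂(M.φ.kernel (M.μ₀ h) ((τ h).1, (τ h).2.1)) :=
    hG.comp hm
  have hm1 : Measurable fun τ : Traj S A H => F (τ h) := hF.comp (measurable_pi_apply h)
  rw [LinearMDP.dataTraj, Measure.lintegral_bind (Kernel.aemeasurable _) hm1.aemeasurable,
    Measure.lintegral_bind (Kernel.aemeasurable _) hm2.aemeasurable]
  refine lintegral_congr fun s => ?_
  rw [lintegral_trajKernel_step _ _ hF]
  simp

end Data

section Bellman

variable {S A : Type*} [MeasurableSpace S] [MeasurableSpace A] {d H : ℕ}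
  (M : LinearMDP S A d H) (D : Divergence) (lam : ℝ)

lemma LinearMDP.measurable_reward (θ : Fin d → ℝ) :
    Measurable (Function.uncurry fun s a => M.φ.toFun s a ⬝ᵥ θ) := by
  change Measurable fun x : S × A => ∑ i, M.φ.toFun x.1 x.2 i * θ i
  exact Finset.measurable_sum _ fun i _ => (M.φ.measurable_toFun i).mul_const _

lemma LinearMDP.measurable_regReward (μ : ℕ → Fin d → ProbabilityMeasure S) (t : ℕ) :
    Measurable (Function.uncurry (M.regReward D lam μ t)) :=
  ((M.measurable_reward (M.θ t)).ennreal_ofReal).add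
    ((Finset.measurable_sum _ fun i _ =>
      ((M.φ.measurable_toFun i).ennreal_ofReal).mul_const _).const_mul _)

lemma LinearMDP.value_eq (π : Policy S A) (h : ℕ) (s : S) :
    M.value D lam π h s = ⨅ μ : ℕ → Fin d → ProbabilityMeasure S,
      expectedSum π.kernel (fun t => M.φ.kernel (μ t)) (M.regReward D lam μ) (H - h) h s := rfl

/-- The right-hand side of the dual form of the robust Bellman equation at step `t`, applied to
the function `V` at step `t + 1`. -/
noncomputable def LinearMDP.dualBackup (t : ℕ) (V : S → ℝ) (s : S) (a : A) : ℝ≥0∞ :=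
  ENNReal.ofReal (M.φ.toFun s a ⬝ᵥ M.θ t)
    + ∑ i, ENNReal.ofReal (M.φ.toFun s a i)
        * ENNReal.ofReal (dualValue D lam (M.μ₀ t i : Measure S) V)

lemma LinearMDP.measurable_dualBackup (t : ℕ) (V : S → ℝ) :
    Measurable (Function.uncurry (M.dualBackup D lam t V)) :=
  ((M.measurable_reward (M.θ t)).ennreal_ofReal).add
    (Finset.measurable_sum _ fun i _ =>
      ((M.φ.measurable_toFun i).ennreal_ofReal).mul_const _)

lemma FeatureMap.sum_ofReal (φ : FeatureMap S A d) (s : S) (a : A) :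
    ∑ i, ENNReal.ofReal (φ.toFun s a i) = 1 := by
  rw [← ENNReal.ofReal_sum_of_nonneg fun i _ => φ.nonneg _ _ _, φ.sum_eq_one, ENNReal.ofReal_one]

variable {lam}

/-- The expected regularized return splits over the factors. -/
lemma LinearMDP.regReward_add_lintegral (μ : ℕ → Fin d → ProbabilityMeasure S) (t : ℕ) (s : S)
    (a : A) (f : S → ℝ≥0∞) :
    M.regReward D lam μ t s a + ∫⁻ s', f s' ∂(M.φ.kernel (μ t) (s, a))
      = ENNReal.ofReal (M.φ.toFun s a ⬝ᵥ M.θ t) + ∑ i, ENNReal.ofReal (M.φ.toFun s a i)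
          * (∫⁻ s', f s' ∂(μ t i : Measure S)
            + ENNReal.ofReal lam * D.div (μ t i : Measure S) (M.μ₀ t i : Measure S)) := by
  rw [LinearMDP.regReward, FeatureMap.lintegral_kernel, add_assoc, Finset.mul_sum,
    ← Finset.sum_add_distrib]
  congr 1
  refine Finset.sum_congr rfl fun i _ => ?_
  ring

variable (hlam : 0 < lam) {V : ℕ → S → ℝ} (hV : ∀ t, Measurable (V t)) (h0 : ∀ t s, 0 ≤ V t s)
  {B : ℝ} (hB : ∀ t s, V t s ≤ B) (hVH : ∀ s, V H s = 0)

include hlam hV h0 hB hVH in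
/-- A function below its dual Bellman backup under `π` is below the value of `π` for every choice of
the factor distributions. -/
lemma LinearMDP.le_expectedSum (π : Policy S A)
    (hle : ∀ t < H, ∀ s, ENNReal.ofReal (V t s)
      ≤ ∫⁻ a, M.dualBackup D lam t (V (t + 1)) s a ∂(π.kernel t s))
    (μ : ℕ → Fin d → ProbabilityMeasure S) (n t : ℕ) (hn : t + n = H) (s : S) :
    ENNReal.ofReal (V t s)
      ≤ expectedSum π.kernel (fun t => M.φ.kernel (μ t)) (M.regReward D lam μ) n t s := by
  induction n generalizing t s with
  | zero =>
    obtain rfl : t = H := by omega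
    simp [hVH]
  | succ n ih =>
    rw [expectedSum_succ _ _ (M.measurable_regReward D lam μ)]
    refine (hle t (by omega) s).trans (lintegral_mono fun a => ?_)
    rw [LinearMDP.regReward_add_lintegral, LinearMDP.dualBackup]
    gcongr with i
    refine (weak_duality D (μ := (μ t i : Measure S)) (hV (t + 1)) (h0 _) (hB _) hlam).trans ?_
    gcongr with s'
    exact ih (t + 1) (by omega) s'

include hlam hV h0 hB hVH in
lemma LinearMDP.le_value (π : Policy S A)
    (hle : ∀ t < H, ∀ s, ENNReal.ofReal (V t s)
      ≤ ∫⁻ a, M.dualBackup D lam t (V (t + 1)) s a ∂(π.kernel t s))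
    (t : ℕ) (ht : t ≤ H) (s : S) : ENNReal.ofReal (V t s) ≤ M.value D lam π t s :=
  le_iInf fun μ =>
    M.le_expectedSum D hlam hV h0 hB hVH π hle μ (H - t) t (by omega) s

/-- If the dual Bellman backup of `V` under `π` exceeds `V` by at most the expectation of `g`, and
the factor distributions `μ` are `ε`-optimal in the duality for `V`, then the regularized return
exceeds `V` by at most the expected sum of `g`, up to `n ε`. -/
lemma LinearMDP.expectedSum_le (π : Policy S A) {g : ℕ → S → A → ℝ≥0∞}
    (hg : ∀ t, Measurable (Function.uncurry (g t)))
    (hle : ∀ t < H, ∀ s, ∫⁻ a, M.dualBackup D lam t (V (t + 1)) s a ∂(π.kernel t s)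
      ≤ ENNReal.ofReal (V t s) + ∫⁻ a, g t s a ∂(π.kernel t s))
    (μ : ℕ → Fin d → ProbabilityMeasure S) (ε : ℝ≥0∞)
    (hμ : ∀ t < H, ∀ i, ∫⁻ s, ENNReal.ofReal (V (t + 1) s) ∂(μ t i : Measure S)
        + ENNReal.ofReal lam * D.div (μ t i : Measure S) (M.μ₀ t i : Measure S)
      ≤ ENNReal.ofReal (dualValue D lam (M.μ₀ t i : Measure S) (V (t + 1))) + ε)
    (n t : ℕ) (hn : t + n = H) (s : S) :
    expectedSum π.kernel (fun t => M.φ.kernel (μ t)) (M.regReward D lam μ) n t s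
      ≤ ENNReal.ofReal (V t s) + expectedSum π.kernel (fun t => M.φ.kernel (μ t)) g n t s
        + n * ε := by
  induction n generalizing t s with
  | zero => simp
  | succ n ih =>
    have hEm := measurable_expectedSum π.kernel (fun t => M.φ.kernel (μ t)) hg n (t + 1)
    rw [expectedSum_succ _ _ (M.measurable_regReward D lam μ), expectedSum_succ _ _ hg]
    have hstep : ∀ a, M.regReward D lam μ t s a
        + ∫⁻ s', expectedSum π.kernel (fun t => M.φ.kernel (μ t)) (M.regReward D lam μ) n (t + 1) s'
          ∂(M.φ.kernel (μ t) (s, a))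
        ≤ M.dualBackup D lam t (V (t + 1)) s a
          + (∫⁻ s', expectedSum π.kernel (fun t => M.φ.kernel (μ t)) g n (t + 1) s'
            ∂(M.φ.kernel (μ t) (s, a)) + (n + 1 : ℕ) * ε) := by
      intro a
      have h1 : ∫⁻ s', expectedSum π.kernel (fun t => M.φ.kernel (μ t)) (M.regReward D lam μ) n
            (t + 1) s' ∂(M.φ.kernel (μ t) (s, a))
          ≤ ∫⁻ s', ENNReal.ofReal (V (t + 1) s') ∂(M.φ.kernel (μ t) (s, a))
            + ∫⁻ s', expectedSum π.kernel (fun t => M.φ.kernel (μ t)) g n (t + 1) s'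
              ∂(M.φ.kernel (μ t) (s, a)) + n * ε := by
        calc _ ≤ ∫⁻ s', (ENNReal.ofReal (V (t + 1) s')
                + expectedSum π.kernel (fun t => M.φ.kernel (μ t)) g n (t + 1) s' + n * ε)
                ∂(M.φ.kernel (μ t) (s, a)) := lintegral_mono fun s' => ih (t + 1) (by omega) s'
          _ = _ := by
            rw [lintegral_add_right _ measurable_const, lintegral_add_right _ hEm]
            simp
      have h2 : M.regReward D lam μ t s a
          + ∫⁻ s', ENNReal.ofReal (V (t + 1) s') ∂(M.φ.kernel (μ t) (s, a))
          ≤ M.dualBackup D lam t (V (t + 1)) s a + ε := by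
        rw [LinearMDP.regReward_add_lintegral, LinearMDP.dualBackup, add_assoc]
        gcongr
        calc _ ≤ ∑ i, ENNReal.ofReal (M.φ.toFun s a i)
              * (ENNReal.ofReal (dualValue D lam (M.μ₀ t i : Measure S) (V (t + 1))) + ε) := by
              exact Finset.sum_le_sum fun i _ => mul_le_mul' le_rfl (hμ t (by omega) i)
          _ = _ := by
              simp_rw [mul_add]
              rw [Finset.sum_add_distrib, ← Finset.sum_mul, FeatureMap.sum_ofReal, one_mul]
      calc _ ≤ _ := add_le_add_right h1 _
        _ = (M.regReward D lam μ t s a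
            + ∫⁻ s', ENNReal.ofReal (V (t + 1) s') ∂(M.φ.kernel (μ t) (s, a)))
            + (∫⁻ s', expectedSum π.kernel (fun t => M.φ.kernel (μ t)) g n (t + 1) s'
              ∂(M.φ.kernel (μ t) (s, a)) + n * ε) := by ring
        _ ≤ _ := add_le_add_left h2 _
        _ = _ := by push_cast; ring
    have hm1 : Measurable (M.dualBackup D lam t (V (t + 1)) s) :=
      (M.measurable_dualBackup D lam t (V (t + 1))).of_uncurry_left
    have hm2 : Measurable (g t s) := (hg t).of_uncurry_left
    refine (lintegral_mono hstep).trans ?_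
    calc _ = ∫⁻ a, M.dualBackup D lam t (V (t + 1)) s a ∂(π.kernel t s)
          + (∫⁻ a, ∫⁻ s', expectedSum π.kernel (fun t => M.φ.kernel (μ t)) g n (t + 1) s'
            ∂(M.φ.kernel (μ t) (s, a)) ∂(π.kernel t s) + (n + 1 : ℕ) * ε) := by
          rw [lintegral_add_left hm1, lintegral_add_right _ measurable_const]
          simp
      _ ≤ _ := add_le_add_left (hle t (by omega) s) _
      _ = _ := by
          rw [lintegral_add_left hm2]
          ring

end Bellman

/-! ### Ridge regression -/

section Ridge

variable {d K : ℕ}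

/-- The regularized Gram matrix `∑ τ, x_τ x_τᵀ + I` of a family of vectors. -/
noncomputable def regGram (x : Fin K → Fin d → ℝ) : Matrix (Fin d) (Fin d) ℝ :=
  ∑ τ, Matrix.vecMulVec (x τ) (x τ) + (1 : ℝ) • 1

/-- The coefficient of the `τ`-th observation in the `i`-th coordinate of the ridge estimate. -/
noncomputable def ridgeCoeff (x : Fin K → Fin d → ℝ) (i : Fin d) (τ : Fin K) : ℝ :=
  (regGram x)⁻¹.row i ⬝ᵥ x τ

/-- The length of the `i`-th unit vector in the norm of the inverse Gram matrix. -/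
noncomputable def ridgeWidth (x : Fin K → Fin d → ℝ) (i : Fin d) : ℝ :=
  √((regGram x)⁻¹ i i)

variable (x : Fin K → Fin d → ℝ) (i : Fin d)

lemma regGram_mulVec (v : Fin d → ℝ) :
    regGram x *ᵥ v = ∑ τ, (x τ ⬝ᵥ v) • x τ + v := by
  rw [regGram, Matrix.add_mulVec, Matrix.sum_mulVec, one_smul, Matrix.one_mulVec]
  congr 1
  refine Finset.sum_congr rfl fun τ _ => ?_
  rw [Matrix.vecMulVec_mulVec]
  ext j
  simp [mul_comm]

lemma posDef_regGram : (regGram x).PosDef := by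
  rw [regGram, one_smul]
  refine Matrix.PosDef.posSemidef_add ?_ Matrix.PosDef.one
  refine Matrix.posSemidef_sum _ fun τ _ => ?_
  simpa using Matrix.posSemidef_vecMulVec_self_star (x τ)

lemma inv_mul_regGram : (regGram x)⁻¹ * regGram x = 1 :=
  Matrix.nonsing_inv_mul _ (Matrix.isUnit_iff_isUnit_det _ |>.1 (posDef_regGram x).isUnit)

lemma inv_regGram_dotProduct (v : Fin d → ℝ) :
    ∑ τ, (x τ ⬝ᵥ v) * ridgeCoeff x i τ + (regGram x)⁻¹.row i ⬝ᵥ v = v i := by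
  have h : ((regGram x)⁻¹ *ᵥ (regGram x *ᵥ v)) i = v i := by
    rw [Matrix.mulVec_mulVec, inv_mul_regGram, Matrix.one_mulVec]
  rw [← h, regGram_mulVec]
  change _ = (regGram x)⁻¹.row i ⬝ᵥ _
  rw [dotProduct_add, dotProduct_sum]
  simp [ridgeCoeff]

/-- The coefficients of the ridge estimate and its bias share the budget `(Λ⁻¹)_ii`. -/
lemma sum_sq_ridgeCoeff_add :
    ∑ τ, ridgeCoeff x i τ ^ 2 + (regGram x)⁻¹.row i ⬝ᵥ (regGram x)⁻¹.row i = (regGram x)⁻¹ i i := by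
  refine Eq.trans ?_ (inv_regGram_dotProduct x i ((regGram x)⁻¹.row i))
  congr 1
  refine Finset.sum_congr rfl fun τ _ => ?_
  rw [ridgeCoeff, dotProduct_comm (x τ), sq]

lemma dotProduct_self_nonneg' (v : Fin d → ℝ) : 0 ≤ v ⬝ᵥ v :=
  Finset.sum_nonneg fun j _ => mul_self_nonneg (v j)

lemma inv_regGram_diag_nonneg : 0 ≤ (regGram x)⁻¹ i i := by
  rw [← sum_sq_ridgeCoeff_add]
  exact add_nonneg (Finset.sum_nonneg fun τ _ => sq_nonneg _) (dotProduct_self_nonneg' _)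

lemma ridgeWidth_nonneg : 0 ≤ ridgeWidth x i := Real.sqrt_nonneg _

lemma ridgeWidth_sq : ridgeWidth x i ^ 2 = (regGram x)⁻¹ i i :=
  Real.sq_sqrt (inv_regGram_diag_nonneg x i)

lemma sum_sq_ridgeCoeff_le : ∑ τ, ridgeCoeff x i τ ^ 2 ≤ ridgeWidth x i ^ 2 := by
  rw [ridgeWidth_sq, ← sum_sq_ridgeCoeff_add]
  exact le_add_of_nonneg_right (dotProduct_self_nonneg' _)

lemma inv_regGram_row_le :
    (regGram x)⁻¹.row i ⬝ᵥ (regGram x)⁻¹.row i ≤ ridgeWidth x i ^ 2 := by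
  rw [ridgeWidth_sq]
  rw [← sum_sq_ridgeCoeff_add]
  exact le_add_of_nonneg_left (Finset.sum_nonneg fun τ _ => sq_nonneg _)

lemma ridgeWidth_le_one : ridgeWidth x i ≤ 1 := by
  have h1 : ((regGram x)⁻¹ i i) ^ 2 ≤ (regGram x)⁻¹.row i ⬝ᵥ (regGram x)⁻¹.row i := by
    rw [sq]
    exact Finset.single_le_sum (f := fun j => (regGram x)⁻¹ i j * (regGram x)⁻¹ i j)
      (fun j _ => mul_self_nonneg _) (Finset.mem_univ i)
  have h2 := inv_regGram_row_le x i
  rw [ridgeWidth_sq] at h2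
  have h3 := inv_regGram_diag_nonneg x i
  rw [ridgeWidth, Real.sqrt_le_one]
  by_contra! h
  nlinarith

/-- Cauchy-Schwarz for a weighted sum of bounded terms. -/
lemma abs_sum_mul_le {ι : Type*} [Fintype ι] (c y : ι → ℝ) {w b : ℝ} (hw : 0 ≤ w) (hb : 0 ≤ b)
    (hc : ∑ j, c j ^ 2 ≤ w ^ 2) (hy : ∀ j, |y j| ≤ b) :
    |∑ j, c j * y j| ≤ w * (b * √(Fintype.card ι : ℝ)) := by
  have h1 : (∑ j, c j * y j) ^ 2 ≤ (∑ j, c j ^ 2) * ∑ j, y j ^ 2 :=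
    Finset.sum_mul_sq_le_sq_mul_sq _ _ _
  have h2 : ∑ j, y j ^ 2 ≤ Fintype.card ι * b ^ 2 := by
    calc ∑ j, y j ^ 2 ≤ ∑ _j : ι, b ^ 2 := Finset.sum_le_sum fun j _ => by
          rw [← sq_abs]; exact pow_le_pow_left₀ (abs_nonneg _) (hy j) 2
      _ = _ := by simp
  refine abs_le_of_sq_le_sq ?_ (by positivity)
  calc _ ≤ _ := h1
    _ ≤ w ^ 2 * (Fintype.card ι * b ^ 2) := by
      gcongr
    _ = _ := by
      rw [mul_pow, mul_pow, Real.sq_sqrt (by positivity)]; ring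

/-- The ridge estimate of `m` from the observations `y` deviates from `m` by a linear combination of
the noise terms and a bias, which is small relative to the width. -/
lemma abs_sum_ridgeCoeff_sub_le (y : Fin K → ℝ) (m : Fin d → ℝ) {b : ℝ} (hb : 0 ≤ b)
    (hm : ∀ j, |m j| ≤ b) :
    |∑ τ, ridgeCoeff x i τ * y τ - m i|
      ≤ |∑ τ, ridgeCoeff x i τ * (y τ - x τ ⬝ᵥ m)| + ridgeWidth x i * (b * √(d : ℝ)) := by
  have h := inv_regGram_dotProduct x i m
  have h1 : ∑ τ, ridgeCoeff x i τ * y τ - m i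
      = ∑ τ, ridgeCoeff x i τ * (y τ - x τ ⬝ᵥ m) - (regGram x)⁻¹.row i ⬝ᵥ m := by
    rw [← h]
    simp_rw [mul_sub]
    rw [Finset.sum_sub_distrib]
    simp_rw [mul_comm (ridgeCoeff x i _) (x _ ⬝ᵥ m)]
    ring
  have h2 : |(regGram x)⁻¹.row i ⬝ᵥ m| ≤ ridgeWidth x i * (b * √(d : ℝ)) := by
    have := abs_sum_mul_le ((regGram x)⁻¹.row i) m (ridgeWidth_nonneg x i) hb
      (by simpa [dotProduct, sq] using inv_regGram_row_le x i) hm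
    simpa [dotProduct] using this
  rw [h1]
  exact (abs_sub _ _).trans (by gcongr)

lemma wnorm_inv_regGram {c : ℝ} (hc : 0 ≤ c) :
    wnorm (regGram x)⁻¹ (c • Pi.single i 1) = c * ridgeWidth x i := by
  rw [wnorm, Matrix.mulVec_smul, smul_dotProduct, dotProduct_smul, Matrix.mulVec_single_one,
    single_one_dotProduct, ridgeWidth, smul_eq_mul, smul_eq_mul, ← mul_assoc,
    Real.sqrt_mul (mul_nonneg hc hc), Real.sqrt_mul_self hc]
  rfl

end Ridge

section Measurability

variable {d K : ℕ} {Ω : Type*} [MeasurableSpace Ω] {x : Ω → Fin K → Fin d → ℝ}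

lemma measurable_det {M : Ω → Matrix (Fin d) (Fin d) ℝ} (hM : ∀ i j, Measurable fun ω => M ω i j) :
    Measurable fun ω => (M ω).det := by
  simp_rw [Matrix.det_apply]
  refine Finset.measurable_sum _ fun σ _ => ?_
  exact (Finset.measurable_prod _ fun j _ => hM _ _).const_smul _

lemma measurable_inv_regGram (hx : ∀ τ i, Measurable fun ω => x ω τ i) (i j : Fin d) :
    Measurable fun ω => (regGram (x ω))⁻¹ i j := by
  have hG : ∀ i j, Measurable fun ω => regGram (x ω) i j := fun i j => by
    simp only [regGram, Matrix.add_apply, Matrix.sum_apply, Matrix.vecMulVec_apply]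
    exact (Finset.measurable_sum _ fun τ _ => (hx τ i).mul (hx τ j)).add measurable_const
  simp only [Matrix.inv_def, Ring.inverse_eq_inv', Matrix.smul_apply, smul_eq_mul]
  refine (measurable_det hG).inv.mul ?_
  simp only [Matrix.adjugate_apply]
  refine measurable_det fun k l => ?_
  simp only [Matrix.updateRow_apply]
  split_ifs
  · exact measurable_const
  · exact hG _ _

lemma measurable_ridgeWidth (hx : ∀ τ i, Measurable fun ω => x ω τ i) (i : Fin d) :
    Measurable fun ω => ridgeWidth (x ω) i :=
  (measurable_inv_regGram hx i i).sqrt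

lemma measurable_ridgeCoeff (hx : ∀ τ i, Measurable fun ω => x ω τ i) (i : Fin d) (τ : Fin K) :
    Measurable fun ω => ridgeCoeff (x ω) i τ := by
  change Measurable fun ω => ∑ j, (regGram (x ω))⁻¹ i j * x ω τ j
  exact Finset.measurable_sum _ fun j _ => (measurable_inv_regGram hx i j).mul (hx τ j)

end Measurability

/-! ### Concentration of weighted sums with random weights -/

section Concentration

variable {Ω X S : Type*} [MeasurableSpace Ω] [MeasurableSpace X] [MeasurableSpace S]
  {P : Measure Ω} [IsProbabilityMeasure P] {κ : Kernel X S}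
  {ξ : Ω → X} {ζ : Ω → S} {K : ℕ}

/-- `ζ` has the conditional law `κ (ξ)` given `ξ`, in the form of an identity of integrals. -/
def HasCondLaw (P : Measure Ω) (κ : Kernel X S) (ξ : Ω → X) (ζ : Ω → S) : Prop :=
  ∀ F : X × S → ℝ≥0∞, Measurable F →
    ∫⁻ ω, F (ξ ω, ζ ω) ∂P = ∫⁻ ω, ∫⁻ y, F (ξ ω, y) ∂(κ (ξ ω)) ∂P

/-- Conditionally on the covariates of all samples, the responses are independent: a product of
factors whose conditional expectations are at most `1` has expectation at most `1`, even though
each factor may depend on all the covariates. -/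
lemma lintegral_prod_le_one (hξ : Measurable ξ) (hζ : Measurable ζ) (hlaw : HasCondLaw P κ ξ ζ)
    (G : Fin K → (Fin K → X) → S → ℝ≥0∞) (hG : ∀ τ, Measurable (Function.uncurry (G τ)))
    (hG1 : ∀ τ x, ∫⁻ y, G τ x y ∂(κ (x τ)) ≤ 1) (T : Finset (Fin K)) :
    ∫⁻ ω, ∏ τ ∈ T, G τ (fun σ => ξ (ω σ)) (ζ (ω τ)) ∂(Measure.pi fun _ : Fin K => P) ≤ 1 := by
  classical
  have hm : ∀ T : Finset (Fin K), Measurable fun ω : Fin K → Ω =>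
      ∏ τ ∈ T, G τ (fun σ => ξ (ω σ)) (ζ (ω τ)) := fun T => by
    refine Finset.measurable_prod _ fun τ _ => ?_
    have : Measurable fun ω : Fin K → Ω => ((fun σ => ξ (ω σ)), ζ (ω τ)) :=
      (measurable_pi_lambda _ fun σ => hξ.comp (measurable_pi_apply σ)).prodMk
        (hζ.comp (measurable_pi_apply τ))
    exact (hG τ).comp this
  induction T using Finset.induction_on with
  | empty => simp
  | insert a T ha ih =>
    refine (lintegral_le_of_lmarginal_le {a} (hm _) (hm T) ?_).trans ih
    intro ω
    rw [lmarginal_singleton, lmarginal_singleton]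
    have hup : ∀ ω' : Ω, (fun σ => ξ (Function.update ω a ω' σ))
        = Function.update (fun σ => ξ (ω σ)) a (ξ ω') := fun ω' => by
      funext σ
      by_cases h : σ = a
      · subst h; simp
      · simp [h]
    -- the factors indexed by `T` depend on the `a`-th sample through its covariate only
    set R : X → ℝ≥0∞ := fun x' =>
      ∏ τ ∈ T, G τ (Function.update (fun σ => ξ (ω σ)) a x') (ζ (ω τ)) with hR
    have hupm : Measurable fun x' : X => Function.update (fun σ => ξ (ω σ)) a x' :=
      measurable_update _
    have hRm : Measurable R := Finset.measurable_prod _ fun τ _ =>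
      (hG τ).comp (hupm.prodMk measurable_const)
    have hprod : ∀ ω' : Ω, ∏ τ ∈ T, G τ (fun σ => ξ (Function.update ω a ω' σ))
        (ζ (Function.update ω a ω' τ)) = R (ξ ω') := fun ω' => by
      rw [hup]
      refine Finset.prod_congr rfl fun τ hτ => ?_
      rw [Function.update_of_ne (ne_of_mem_of_not_mem hτ ha)]
    simp_rw [Finset.prod_insert ha, hprod, hup, Function.update_self]
    have hGm : Measurable fun p : X × S => G a (Function.update (fun σ => ξ (ω σ)) a p.1) p.2 :=
      (hG a).comp ((hupm.comp measurable_fst).prodMk measurable_snd)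
    rw [hlaw (fun p => G a (Function.update (fun σ => ξ (ω σ)) a p.1) p.2 * R p.1)
      (hGm.mul (hRm.comp measurable_fst))]
    refine lintegral_mono fun ω' => ?_
    dsimp only
    have hGm' : Measurable fun y => G a (Function.update (fun σ => ξ (ω σ)) a (ξ ω')) y :=
      hGm.comp measurable_prodMk_left
    rw [lintegral_mul_const _ hGm']
    calc _ ≤ 1 * R (ξ ω') := by
          gcongr
          simpa using hG1 a (Function.update (fun σ => ξ (ω σ)) a (ξ ω'))
      _ = R (ξ ω') := one_mul _

/-- Hoeffding's lemma. -/
lemma lintegral_exp_hoeffding (ν : Measure S) [IsProbabilityMeasure ν] {f : S → ℝ} {B : ℝ}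
    (hf : Measurable f) (h0 : ∀ s, 0 ≤ f s) (hB : ∀ s, f s ≤ B) (u : ℝ) :
    ∫⁻ y, ENNReal.ofReal (Real.exp (u * (f y - ∫ s, f s ∂ν) - u ^ 2 * B ^ 2 / 8)) ∂ν ≤ 1 := by
  have hsub := hasSubgaussianMGF_of_mem_Icc (μ := ν) hf.aemeasurable
    (Filter.Eventually.of_forall fun s => ⟨h0 s, hB s⟩)
  have hint := hsub.integrable_exp_mul u
  have hmgf := hsub.mgf_le u
  rw [mgf] at hmgf
  have hexp : (∫ y, Real.exp (u * (f y - ∫ s, f s ∂ν) - u ^ 2 * B ^ 2 / 8) ∂ν) ≤ 1 := by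
    simp_rw [Real.exp_sub, div_eq_mul_inv]
    rw [integral_mul_const, ← div_eq_mul_inv, div_le_one (Real.exp_pos _)]
    refine hmgf.trans (le_of_eq ?_)
    congr 1
    simp only [sub_zero, NNReal.coe_pow, NNReal.coe_div, coe_nnnorm, Real.norm_eq_abs,
      NNReal.coe_ofNat, div_pow, sq_abs]
    ring
  rw [← ofReal_integral_eq_lintegral_ofReal]
  · exact ENNReal.ofReal_le_one.2 hexp
  · simp_rw [Real.exp_sub]
    exact hint.div_const _
  · exact Filter.Eventually.of_forall fun y => (Real.exp_pos _).le

/-- A weighted sum of the conditionally centred variables `f (ζ_τ)`, whose weights are functions of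
the covariates of all samples and have Euclidean norm at most `1`, satisfies Hoeffding's
inequality. -/
lemma measure_weighted_sum_gt_le [IsMarkovKernel κ] (hξ : Measurable ξ) (hζ : Measurable ζ)
    (hlaw : HasCondLaw P κ ξ ζ) {c : Fin K → (Fin K → X) → ℝ} (hc : ∀ τ, Measurable (c τ))
    (hc1 : ∀ x, ∑ τ, c τ x ^ 2 ≤ 1) {f : S → ℝ} {B : ℝ} (hBpos : 0 < B)
    (hf : Measurable f) (h0 : ∀ s, 0 ≤ f s) (hB : ∀ s, f s ≤ B) {t : ℝ} (ht : 0 < t) :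
    (Measure.pi fun _ : Fin K => P) {ω | B * √(t / 2)
        < ∑ τ, c τ (fun σ => ξ (ω σ)) * (f (ζ (ω τ)) - ∫ s, f s ∂(κ (ξ (ω τ))))}
      ≤ ENNReal.ofReal (Real.exp (-t)) := by
  -- the exponential moment is taken at the point that minimizes Chernoff's bound
  set r : ℝ := √(8 * t) / B with hr
  have hrpos : 0 < r := by positivity
  have hr2 : r ^ 2 * B ^ 2 / 8 = t := by
    rw [hr, div_pow, Real.sq_sqrt (by positivity)]; field_simp
  have hrt : r * (B * √(t / 2)) = 2 * t := by
    have : √(8 * t) * √(t / 2) = 2 * t := by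
      rw [← Real.sqrt_mul (by positivity), show 8 * t * (t / 2) = (2 * t) ^ 2 by ring,
        Real.sqrt_sq (by positivity)]
    rw [hr, ← this]; field_simp
  set G : Fin K → (Fin K → X) → S → ℝ≥0∞ := fun τ x y =>
    ENNReal.ofReal (Real.exp ((r * c τ x) * (f y - ∫ s, f s ∂(κ (x τ)))
      - (r * c τ x) ^ 2 * B ^ 2 / 8)) with hG
  have hκf : Measurable fun x : X => ∫ s, f s ∂(κ x) :=
    (hf.stronglyMeasurable.integral_kernel).measurable
  have hGm : ∀ τ, Measurable (Function.uncurry (G τ)) := fun τ => by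
    have h1 : Measurable fun p : (Fin K → X) × S => c τ p.1 := (hc τ).comp measurable_fst
    have h2 : Measurable fun p : (Fin K → X) × S => f p.2 := hf.comp measurable_snd
    have h3 : Measurable fun p : (Fin K → X) × S => ∫ s, f s ∂(κ (p.1 τ)) :=
      hκf.comp ((measurable_pi_apply τ).comp measurable_fst)
    exact ((((h1.const_mul r).mul (h2.sub h3)).sub
      ((((h1.const_mul r).pow_const 2).mul_const _).div_const _)).exp).ennreal_ofReal
  have hle := lintegral_prod_le_one hξ hζ hlaw G hGm
    (fun τ x => lintegral_exp_hoeffding (κ (x τ)) hf h0 hB _) Finset.univ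
  have hprod : ∀ ω : Fin K → Ω, ∏ τ, G τ (fun σ => ξ (ω σ)) (ζ (ω τ))
      = ENNReal.ofReal (Real.exp (r * ∑ τ, c τ (fun σ => ξ (ω σ))
          * (f (ζ (ω τ)) - ∫ s, f s ∂(κ (ξ (ω τ)))) - t * ∑ τ, c τ (fun σ => ξ (ω σ)) ^ 2)) := by
    intro ω
    simp only [hG]
    rw [← ENNReal.ofReal_prod_of_nonneg fun τ _ => (Real.exp_pos _).le, ← Real.exp_sum,
      Finset.mul_sum, Finset.mul_sum, ← Finset.sum_sub_distrib]
    congr 2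
    refine Finset.sum_congr rfl fun τ _ => ?_
    rw [← hr2]
    ring
  have hsub : {ω : Fin K → Ω | B * √(t / 2)
        < ∑ τ, c τ (fun σ => ξ (ω σ)) * (f (ζ (ω τ)) - ∫ s, f s ∂(κ (ξ (ω τ))))}
      ⊆ {ω | ENNReal.ofReal (Real.exp t) ≤ ∏ τ, G τ (fun σ => ξ (ω σ)) (ζ (ω τ))} := by
    intro ω hω
    simp only [Set.mem_ofPred_eq] at hω ⊢
    rw [hprod]
    refine ENNReal.ofReal_le_ofReal (Real.exp_le_exp.2 ?_)
    have h1 := mul_lt_mul_of_pos_left hω hrpos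
    have h2 : t * ∑ τ, c τ (fun σ => ξ (ω σ)) ^ 2 ≤ t * 1 := by
      gcongr; exact hc1 _
    linarith
  have hmG : Measurable fun ω : Fin K → Ω => ∏ τ, G τ (fun σ => ξ (ω σ)) (ζ (ω τ)) := by
    refine Finset.measurable_prod _ fun τ _ => ?_
    have : Measurable fun ω : Fin K → Ω => ((fun σ => ξ (ω σ)), ζ (ω τ)) :=
      (measurable_pi_lambda _ fun σ => hξ.comp (measurable_pi_apply σ)).prodMk
        (hζ.comp (measurable_pi_apply τ))
    exact (hGm τ).comp this
  refine (measure_mono hsub).trans ((meas_ge_le_lintegral_div hmG.aemeasurable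
    (by simpa using Real.exp_pos t) ENNReal.ofReal_ne_top).trans ?_)
  rw [Real.exp_neg, ENNReal.ofReal_inv_of_pos (Real.exp_pos t), ← one_div]
  gcongr

/-- The two-sided form of `measure_weighted_sum_gt_le`. -/
lemma measure_abs_weighted_sum_gt_le [IsMarkovKernel κ] (hξ : Measurable ξ) (hζ : Measurable ζ)
    (hlaw : HasCondLaw P κ ξ ζ) {c : Fin K → (Fin K → X) → ℝ} (hc : ∀ τ, Measurable (c τ))
    (hc1 : ∀ x, ∑ τ, c τ x ^ 2 ≤ 1) {f : S → ℝ} {B : ℝ} (hBpos : 0 < B)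
    (hf : Measurable f) (h0 : ∀ s, 0 ≤ f s) (hB : ∀ s, f s ≤ B) {t : ℝ} (ht : 0 < t) :
    (Measure.pi fun _ : Fin K => P) {ω | B * √(t / 2)
        < |∑ τ, c τ (fun σ => ξ (ω σ)) * (f (ζ (ω τ)) - ∫ s, f s ∂(κ (ξ (ω τ))))|}
      ≤ ENNReal.ofReal (2 * Real.exp (-t)) := by
  have h1 := measure_weighted_sum_gt_le hξ hζ hlaw hc hc1 hBpos hf h0 hB ht
  have h2 := measure_weighted_sum_gt_le hξ hζ hlaw (c := fun τ x => -c τ x) (fun τ => (hc τ).neg)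
    (fun x => by simpa using hc1 x) hBpos hf h0 hB ht
  refine (measure_mono (t := _ ∪ _) ?_).trans ((measure_union_le _ _).trans
    ((add_le_add h1 h2).trans (le_of_eq ?_)))
  · intro ω hω
    rcases lt_abs.1 (Set.mem_ofPred_eq ▸ hω) with h | h
    · exact Or.inl h
    · refine Or.inr ?_
      simpa only [Set.mem_ofPred_eq, neg_mul, Finset.sum_neg_distrib] using h
  · rw [← ENNReal.ofReal_add (Real.exp_pos _).le (Real.exp_pos _).le]
    congr 1
    ring

end Concentration

/-! ### Uniform accuracy of the ridge estimates -/

section Features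

variable {S A : Type*} [MeasurableSpace S] [MeasurableSpace A] {d H K : ℕ}

/-- The feature vectors of the observed state-action pairs at step `h`. -/
def features (φ : FeatureMap S A d) (data : Fin K → Traj S A H) (h : Fin H) :
    Fin K → Fin d → ℝ :=
  fun τ => φ.toFun (data τ h).1 (data τ h).2.1

variable (φ : FeatureMap S A d) (data : Fin K → Traj S A H) (h : Fin H)

lemma uncertainty_eq (s : S) (a : A) :
    uncertainty φ 1 data h s a
      = ∑ i, φ.toFun s a i * ridgeWidth (features φ data h) i := by
  rw [uncertainty]
  exact Finset.sum_congr rfl fun i _ => wnorm_inv_regGram _ _ (φ.nonneg s a i)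

lemma ridge_eq (f : S → ℝ) (i : Fin d) :
    ridge φ 1 data h f i
      = ∑ τ, ridgeCoeff (features φ data h) i τ * f (data τ h).2.2 := by
  rw [ridge, Matrix.mulVec_sum, Finset.sum_apply]
  refine Finset.sum_congr rfl fun τ _ => ?_
  rw [Matrix.mulVec_smul, Pi.smul_apply, smul_eq_mul, mul_comm]
  rfl

lemma abs_ridge_le {f : S → ℝ} {B : ℝ} (hB0 : 0 ≤ B) (hf : ∀ s, |f s| ≤ B) (i : Fin d) :
    |ridge φ 1 data h f i| ≤ B * K := by
  rw [ridge_eq]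
  refine (abs_sum_mul_le _ _ (ridgeWidth_nonneg _ i) hB0 (sum_sq_ridgeCoeff_le _ i)
    fun τ => hf _).trans ?_
  rw [Fintype.card_fin]
  have h1 := ridgeWidth_le_one (features φ data h) i
  have h2 : √(K : ℝ) ≤ K := by
    rcases Nat.eq_zero_or_pos K with h | h
    · simp [h]
    · refine Real.sqrt_le_iff.2 ⟨by positivity, ?_⟩
      have : (1 : ℝ) ≤ K := by exact_mod_cast h
      nlinarith
  calc _ ≤ 1 * (B * √(K : ℝ)) := by gcongr
    _ ≤ B * K := by rw [one_mul]; gcongr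

lemma FeatureMap.dotProduct_le {u : Fin d → ℝ} {b : ℝ} (s : S) (a : A) (hu : ∀ i, u i ≤ b) :
    φ.toFun s a ⬝ᵥ u ≤ b := by
  calc φ.toFun s a ⬝ᵥ u ≤ ∑ i, φ.toFun s a i * b :=
        Finset.sum_le_sum fun i _ => mul_le_mul_of_nonneg_left (hu i) (φ.nonneg s a i)
    _ = b := by rw [← Finset.sum_mul, φ.sum_eq_one, one_mul]

lemma FeatureMap.abs_dotProduct_le {u : Fin d → ℝ} {b : ℝ} (s : S) (a : A)
    (hu : ∀ i, |u i| ≤ b) : |φ.toFun s a ⬝ᵥ u| ≤ b := by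
  refine abs_le.2 ⟨?_, φ.dotProduct_le s a fun i => (abs_le.1 (hu i)).2⟩
  have := φ.dotProduct_le s a (u := -u) (b := b) fun i => by
    have := (abs_le.1 (hu i)).1
    simp only [Pi.neg_apply]; linarith
  rw [dotProduct_neg] at this
  linarith

lemma FeatureMap.integral_kernel (μ : Fin d → ProbabilityMeasure S) (x : S × A) {f : S → ℝ}
    (hf : ∀ i, Integrable f (μ i : Measure S)) :
    ∫ s, f s ∂(φ.kernel μ x)
      = φ.toFun x.1 x.2 ⬝ᵥ fun i => ∫ s, f s ∂(μ i : Measure S) := by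
  change ∫ s, f s ∂(∑ i, ENNReal.ofReal (φ.toFun x.1 x.2 i) • (μ i : Measure S)) = _
  rw [integral_finsetSum_measure fun i _ => (hf i).smul_measure ENNReal.ofReal_ne_top]
  refine Finset.sum_congr rfl fun i _ => ?_
  rw [integral_smul_measure, ENNReal.toReal_ofReal (φ.nonneg _ _ _), smul_eq_mul]

end Features

section UniformEvent

variable {S A : Type*} [MeasurableSpace S] [MeasurableSpace A] {d H K : ℕ}
  (M : LinearMDP S A d H) (ρ : Measure S) [IsProbabilityMeasure ρ] (πb : Policy S A)

/-- The weighted sum of the regression noise in the `i`-th coordinate of the ridge estimate at step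
`h` with target function `f`. -/
noncomputable def LinearMDP.noise (data : Fin K → Traj S A H) (h : Fin H) (i : Fin d)
    (f : S → ℝ) : ℝ :=
  ∑ τ, ridgeCoeff (features M.φ data h) i τ * (f (data τ h).2.2
    - features M.φ data h τ ⬝ᵥ fun j => ∫ s, f s ∂(M.μ₀ h j : Measure S))

lemma measurable_features (h : Fin H) (τ : Fin K) (i : Fin d) :
    Measurable fun data : Fin K → Traj S A H => features M.φ data h τ i := by
  have : Measurable fun data : Fin K → Traj S A H => ((data τ h).1, (data τ h).2.1) := by fun_prop
  exact (M.φ.measurable_toFun i).comp this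

lemma LinearMDP.measurable_noise (h : Fin H) (i : Fin d) {f : S → ℝ} (hf : Measurable f) :
    Measurable fun data : Fin K → Traj S A H => M.noise data h i f := by
  refine Finset.measurable_sum _ fun τ _ =>
    (measurable_ridgeCoeff (measurable_features M h) i τ).mul (Measurable.sub ?_ ?_)
  · have : Measurable fun data : Fin K → Traj S A H => (data τ h).2.2 := by fun_prop
    exact hf.comp this
  · exact Finset.measurable_sum (f := fun j (data : Fin K → Traj S A H) =>
      features M.φ data h τ j * ∫ s, f s ∂(M.μ₀ h j : Measure S)) _
      fun j _ => (measurable_features M h τ j).mul_const _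

/-- For a fixed target function, the noise is bounded by the width of the confidence interval,
conditionally on the observed state-action pairs. -/
lemma LinearMDP.measure_noise_gt_le (h : Fin H) (i : Fin d) {f : S → ℝ} {B : ℝ} (hBpos : 0 < B)
    (hf : Measurable f) (h0 : ∀ s, 0 ≤ f s) (hB : ∀ s, f s ≤ B) {t : ℝ} (ht : 0 < t) :
    M.dataLaw ρ πb K {data | ridgeWidth (features M.φ data h) i * (B * √(t / 2))
        < |M.noise data h i f|} ≤ ENNReal.ofReal (2 * Real.exp (-t)) := by
  set feat : (Fin K → S × A) → Fin K → Fin d → ℝ := fun x τ => M.φ.toFun (x τ).1 (x τ).2 with hfeat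
  have hfeatm : ∀ τ i, Measurable fun x => feat x τ i := fun τ i =>
    (M.φ.measurable_toFun i).comp (measurable_pi_apply τ)
  set c : Fin K → (Fin K → S × A) → ℝ := fun τ x =>
    ridgeCoeff (feat x) i τ / ridgeWidth (feat x) i with hc
  have hcm : ∀ τ, Measurable (c τ) := fun τ =>
    (measurable_ridgeCoeff hfeatm i τ).div (measurable_ridgeWidth hfeatm i)
  have hc1 : ∀ x, ∑ τ, c τ x ^ 2 ≤ 1 := fun x => by
    simp only [hc, div_pow]
    rw [← Finset.sum_div]
    exact div_le_one_of_le₀ (sum_sq_ridgeCoeff_le _ i) (sq_nonneg _)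
  have hξ : Measurable fun τ : Traj S A H => ((τ h).1, (τ h).2.1) := by fun_prop
  have hζ : Measurable fun τ : Traj S A H => (τ h).2.2 := by fun_prop
  have hlaw : HasCondLaw (M.dataTraj ρ πb) (M.φ.kernel (M.μ₀ h))
      (fun τ => ((τ h).1, (τ h).2.1)) (fun τ => (τ h).2.2) := fun F hF => by
    exact M.lintegral_dataTraj_step ρ πb
      (F := fun z : S × A × S => F ((z.1, z.2.1), z.2.2)) (hF.comp (by fun_prop)) h
  refine (measure_mono fun data hdata => ?_).trans
    (measure_abs_weighted_sum_gt_le hξ hζ hlaw hcm hc1 hBpos hf h0 hB ht)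
  rw [Set.mem_ofPred_eq] at hdata ⊢
  set w := ridgeWidth (features M.φ data h) i with hw
  have hint : ∀ τ : Fin K, ∫ s, f s ∂(M.φ.kernel (M.μ₀ h) ((data τ h).1, (data τ h).2.1))
      = features M.φ data h τ ⬝ᵥ fun j => ∫ s, f s ∂(M.μ₀ h j : Measure S) := fun τ =>
    M.φ.integral_kernel _ _ fun j => integrable_of_bounds hf h0 hB
  have hsum : ∑ τ, c τ (fun σ => ((data σ h).1, (data σ h).2.1)) * (f (data τ h).2.2
      - ∫ s, f s ∂(M.φ.kernel (M.μ₀ h) ((data τ h).1, (data τ h).2.1)))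
      = M.noise data h i f / w := by
    rw [LinearMDP.noise, Finset.sum_div]
    refine Finset.sum_congr rfl fun τ _ => ?_
    rw [hint, mul_div_right_comm]
    rfl
  rw [hsum]
  rcases (ridgeWidth_nonneg (features M.φ data h) i).eq_or_lt with hw0 | hw0
  · -- all coefficients vanish if the width does
    exfalso
    have h1 := abs_sum_mul_le (ridgeCoeff (features M.φ data h) i)
      (fun τ => f (data τ h).2.2
        - features M.φ data h τ ⬝ᵥ fun j => ∫ s, f s ∂(M.μ₀ h j : Measure S))
      (ridgeWidth_nonneg _ i) (Finset.sum_nonneg fun τ _ => abs_nonneg _)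
      (sum_sq_ridgeCoeff_le _ i) fun τ =>
        Finset.single_le_sum (f := fun τ => |f (data τ h).2.2
          - features M.φ data h τ ⬝ᵥ fun j => ∫ s, f s ∂(M.μ₀ h j : Measure S)|)
          (fun τ _ => abs_nonneg _) (Finset.mem_univ τ)
    rw [← hw0, zero_mul] at h1
    rw [hw, ← hw0, zero_mul] at hdata
    exact absurd (lt_of_lt_of_le hdata h1) (lt_irrefl _)
  · rw [abs_div, abs_of_pos hw0, lt_div_iff₀ hw0, mul_comm]
    exact hdata

/-- A uniform grid of spacing `ε` and radius `n ε`. -/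
lemma exists_grid_near {n : ℕ} {ε z : ℝ} (hε : 0 < ε) (hz : |z| ≤ n * ε) :
    ∃ j : Fin (2 * n + 1), |z - ((j : ℕ) - n : ℝ) * ε| ≤ ε := by
  obtain ⟨h1, h2⟩ := abs_le.1 hz
  have h3 : 0 ≤ z / ε + n := by
    have : -(n : ℝ) ≤ z / ε := by rw [le_div_iff₀ hε]; linarith
    linarith
  have h4 : z / ε + n ≤ (2 * n : ℕ) := by
    have : z / ε ≤ n := by rw [div_le_iff₀ hε]; linarith
    push_cast; linarith
  refine ⟨⟨⌊z / ε + n⌋₊, ?_⟩, ?_⟩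
  · have := Nat.floor_le_of_le h4
    omega
  · have h5 := Nat.floor_le h3
    have h6 := (Nat.lt_floor_add_one (z / ε + n)).le
    have h7 : z = z / ε * ε := by field_simp
    have h8 : z - ((⌊z / ε + n⌋₊ : ℝ) - n) * ε = (z / ε + n - ⌊z / ε + n⌋₊) * ε := by
      rw [sub_mul, sub_mul, add_mul, ← h7]; ring
    simp only
    rw [h8, abs_mul, abs_of_pos hε]
    have : |z / ε + n - (⌊z / ε + n⌋₊ : ℝ)| ≤ 1 := abs_le.2 ⟨by linarith, by linarith⟩
    nlinarith

/-- Simultaneous accuracy of the ridge estimates for all target functions of a family that depends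
on `m` bounded real parameters in a Lipschitz way, by a union bound over a grid. -/
lemma LinearMDP.exists_uniform_event {m n : ℕ} {B L R ε t δ : ℝ}
    (f : Fin H → (Fin m → ℝ) → S → ℝ) (hBpos : 0 < B)
    (hf : ∀ h u, Measurable (f h u)) (h0 : ∀ h u s, 0 ≤ f h u s) (hB : ∀ h u s, f h u s ≤ B)
    (hL : ∀ h u u' e, (∀ j, |u j - u' j| ≤ e) → ∀ s, |f h u s - f h u' s| ≤ L * e)
    (hε : 0 < ε) (hR : R ≤ n * ε) (hLε : 2 * (L * ε) * √(K : ℝ) ≤ B) (hL0 : 0 ≤ L)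
    (ht : 0 < t) (hcount : 2 * H * d * (2 * n + 1 : ℝ) ^ m * Real.exp (-t) ≤ δ) :
    ∃ E : Set (Fin K → Traj S A H), MeasurableSet E ∧
      M.dataLaw ρ πb K Eᶜ ≤ ENNReal.ofReal δ ∧
      ∀ data ∈ E, ∀ h u, (∀ j, |u j| ≤ R) → ∀ i,
        |ridge M.φ 1 data h (f h u) i - ∫ s, f h u s ∂(M.μ₀ h i : Measure S)|
          ≤ ridgeWidth (features M.φ data h) i * (B * (√(d : ℝ) + 1 + √(t / 2))) := by
  set pt : (Fin m → Fin (2 * n + 1)) → Fin m → ℝ := fun g j => ((g j : ℕ) - n : ℝ) * ε with hpt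
  set bad : Fin H × Fin d × (Fin m → Fin (2 * n + 1)) → Set (Fin K → Traj S A H) := fun p =>
    {data | ridgeWidth (features M.φ data p.1) p.2.1 * (B * √(t / 2))
      < |M.noise data p.1 p.2.1 (f p.1 (pt p.2.2))|} with hbad
  have hbadm : ∀ p, MeasurableSet (bad p) := fun p =>
    measurableSet_lt ((measurable_ridgeWidth (measurable_features M p.1) p.2.1).mul_const _)
      (M.measurable_noise p.1 p.2.1 (hf _ _)).abs
  refine ⟨(⋃ p, bad p)ᶜ, (MeasurableSet.iUnion hbadm).compl, ?_, ?_⟩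
  · rw [compl_compl]
    refine (measure_iUnion_fintype_le _ _).trans ?_
    calc _ ≤ ∑ _p : Fin H × Fin d × (Fin m → Fin (2 * n + 1)),
          ENNReal.ofReal (2 * Real.exp (-t)) := Finset.sum_le_sum fun p _ =>
            M.measure_noise_gt_le ρ πb p.1 p.2.1 hBpos (hf _ _) (h0 _ _) (hB _ _) ht
      _ ≤ _ := by
        rw [Finset.sum_const, nsmul_eq_mul, ← ENNReal.ofReal_natCast,
          ← ENNReal.ofReal_mul (by positivity)]
        refine ENNReal.ofReal_le_ofReal (le_trans (le_of_eq ?_) hcount)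
        simp
        ring
  · intro data hdata h u hu i
    choose g hg using fun j => exists_grid_near hε ((hu j).trans hR)
    have hnear : ∀ s, |f h u s - f h (pt g) s| ≤ L * ε := hL h u (pt g) ε hg
    have hgood : |M.noise data h i (f h (pt g))|
        ≤ ridgeWidth (features M.φ data h) i * (B * √(t / 2)) := by
      have : data ∉ bad (h, i, g) := fun hb => hdata (Set.mem_iUnion.2 ⟨_, hb⟩)
      exact not_lt.1 this
    have hint : ∀ u j, Integrable (f h u) (M.μ₀ h j : Measure S) := fun u j =>
      integrable_of_bounds (hf h u) (h0 h u) (hB h u)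
    set x := features M.φ data h with hx
    have hdiff : |M.noise data h i (f h u) - M.noise data h i (f h (pt g))|
        ≤ ridgeWidth x i * B := by
      have h1 : M.noise data h i (f h u) - M.noise data h i (f h (pt g))
          = ∑ τ, ridgeCoeff x i τ * ((f h u (data τ h).2.2 - f h (pt g) (data τ h).2.2)
            - x τ ⬝ᵥ fun j => ∫ s, f h u s ∂(M.μ₀ h j : Measure S)
                - ∫ s, f h (pt g) s ∂(M.μ₀ h j : Measure S)) := by
        rw [LinearMDP.noise, LinearMDP.noise, ← Finset.sum_sub_distrib]
        refine Finset.sum_congr rfl fun τ _ => ?_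
        have : (fun j => ∫ s, f h u s ∂(M.μ₀ h j : Measure S)
              - ∫ s, f h (pt g) s ∂(M.μ₀ h j : Measure S))
            = (fun j => ∫ s, f h u s ∂(M.μ₀ h j : Measure S))
              - fun j => ∫ s, f h (pt g) s ∂(M.μ₀ h j : Measure S) := rfl
        rw [this, dotProduct_sub]
        ring
      rw [h1]
      refine (abs_sum_mul_le _ _ (ridgeWidth_nonneg x i) (b := 2 * (L * ε)) (by positivity)
        (sum_sq_ridgeCoeff_le x i) fun τ => ?_).trans ?_
      · have h2 : |x τ ⬝ᵥ fun j => ∫ s, f h u s ∂(M.μ₀ h j : Measure S)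
            - ∫ s, f h (pt g) s ∂(M.μ₀ h j : Measure S)| ≤ L * ε := by
          refine M.φ.abs_dotProduct_le _ _ fun j => ?_
          rw [← integral_sub (hint u j) (hint _ j)]
          have := norm_integral_le_of_norm_le_const (μ := (M.μ₀ h j : Measure S))
            (f := fun s => f h u s - f h (pt g) s) (Filter.Eventually.of_forall hnear)
          simpa using this
        have h3 := abs_sub (f h u (data τ h).2.2 - f h (pt g) (data τ h).2.2)
          (x τ ⬝ᵥ fun j => ∫ s, f h u s ∂(M.μ₀ h j : Measure S)
            - ∫ s, f h (pt g) s ∂(M.μ₀ h j : Measure S))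
        have h4 := hnear (data τ h).2.2
        linarith
      · rw [Fintype.card_fin]
        exact mul_le_mul_of_nonneg_left hLε (ridgeWidth_nonneg x i)
    have hmain := abs_sum_ridgeCoeff_sub_le x i (fun τ => f h u (data τ h).2.2)
      (fun j => ∫ s, f h u s ∂(M.μ₀ h j : Measure S)) hBpos.le fun j => by
        rw [abs_of_nonneg (integral_nonneg (h0 h u))]
        calc ∫ s, f h u s ∂(M.μ₀ h j : Measure S) ≤ ∫ _, B ∂(M.μ₀ h j : Measure S) :=
              integral_mono (hint u j) (integrable_const _) (hB h u)
          _ = B := by simp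
    rw [← ridge_eq] at hmain
    have hnoise : |M.noise data h i (f h u)|
        ≤ ridgeWidth x i * (B * √(t / 2)) + ridgeWidth x i * B := by
      have := abs_sub_abs_le_abs_sub (M.noise data h i (f h u)) (M.noise data h i (f h (pt g)))
      linarith
    change _ ≤ |M.noise data h i (f h u)| + _ at hmain
    linarith

end UniformEvent

/-! ### Greedy values and the accuracy of the parameter estimates -/

section GreedyValue

variable {S A : Type*} [MeasurableSpace S] [MeasurableSpace A] [Fintype A] [Nonempty A] {d : ℕ}
  (φ : FeatureMap S A d)

/-- The greedy value `s ↦ max_a ⟨φ(s, a), u⟩`, clipped to `[0, k]`. All value estimates of the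
algorithm are of this form. -/
noncomputable def greedyValue (k : ℝ) (u : Fin d → ℝ) (s : S) : ℝ :=
  Finset.univ.sup' Finset.univ_nonempty fun a : A => max (min (φ.toFun s a ⬝ᵥ u) k) 0

variable {k : ℝ} {u u' : Fin d → ℝ}

lemma measurable_greedyValue : Measurable (greedyValue φ k u) := by
  have h : ∀ a : A, Measurable fun s : S => max (min (φ.toFun s a ⬝ᵥ u) k) 0 := fun a => by
    have h1 : Measurable fun s : S => φ.toFun s a ⬝ᵥ u :=
      Finset.measurable_sum (f := fun i (s : S) => φ.toFun s a i * u i) _ fun i _ =>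
        ((φ.measurable_toFun i).comp measurable_prodMk_right).mul_const _
    exact (h1.min measurable_const).max measurable_const
  have h2 := Finset.measurable_sup' (Finset.univ_nonempty (α := A)) fun a _ => h a
  have h3 : greedyValue φ k u = Finset.univ.sup' Finset.univ_nonempty
      fun (a : A) (s : S) => max (min (φ.toFun s a ⬝ᵥ u) k) 0 := by
    funext s
    rw [Finset.sup'_apply]; rfl
  rw [h3]
  exact h2

lemma greedyValue_nonneg (s : S) : 0 ≤ greedyValue φ k u s := by
  obtain ⟨a⟩ := ‹Nonempty A›
  exact (le_max_right _ _).trans (Finset.le_sup'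
    (fun a : A => max (min (φ.toFun s a ⬝ᵥ u) k) 0) (Finset.mem_univ a))

lemma greedyValue_le (hk : 0 ≤ k) (s : S) : greedyValue φ k u s ≤ k :=
  Finset.sup'_le _ _ fun _ _ => max_le (min_le_right _ _) hk

lemma greedyValue_le_add {e : ℝ} (h : ∀ i, |u i - u' i| ≤ e) (s : S) :
    greedyValue φ k u s ≤ greedyValue φ k u' s + e := by
  refine Finset.sup'_le _ _ fun a _ => ?_
  have h1 : φ.toFun s a ⬝ᵥ u ≤ φ.toFun s a ⬝ᵥ u' + e := by
    have := φ.dotProduct_le s a (u := u - u') (b := e) fun i => (abs_le.1 (h i)).2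
    rw [dotProduct_sub] at this
    linarith
  have he : 0 ≤ e := by
    have := φ.abs_dotProduct_le s a (u := u - u') h
    exact (abs_nonneg _).trans this
  have h2 : max (min (φ.toFun s a ⬝ᵥ u') k) 0 ≤ greedyValue φ k u' s :=
    Finset.le_sup' (fun a : A => max (min (φ.toFun s a ⬝ᵥ u') k) 0) (Finset.mem_univ a)
  have h3 : max (min (φ.toFun s a ⬝ᵥ u) k) 0 ≤ max (min (φ.toFun s a ⬝ᵥ u') k) 0 + e := by
    refine max_le ?_ ?_
    · rcases le_total (φ.toFun s a ⬝ᵥ u') k with h | h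
      · rw [min_eq_left h]
        linarith [min_le_left (φ.toFun s a ⬝ᵥ u) k, le_max_left (φ.toFun s a ⬝ᵥ u') 0]
      · rw [min_eq_right h]
        linarith [min_le_right (φ.toFun s a ⬝ᵥ u) k, le_max_left k 0]
    · linarith [le_max_right (min (φ.toFun s a ⬝ᵥ u') k) 0]
  linarith

lemma abs_greedyValue_sub_le {e : ℝ} (h : ∀ i, |u i - u' i| ≤ e) (s : S) :
    |greedyValue φ k u s - greedyValue φ k u' s| ≤ e := by
  have h1 := greedyValue_le_add φ (k := k) h s
  have h2 := greedyValue_le_add φ (k := k) (u := u') (u' := u) (fun i => by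
    rw [abs_sub_comm]; exact h i) s
  exact abs_le.2 ⟨by linarith, by linarith⟩

end GreedyValue

section Estimation

lemma abs_min_sub_min_le {a b c e r : ℝ} (h1 : |a - b| ≤ r) (h2 : |c - e| ≤ r) :
    |min a c - min b e| ≤ r :=
  (abs_min_sub_min_le_max _ _ _ _).trans (max_le h1 h2)

lemma abs_iInf_sub_iInf_le {T : Type*} [Nonempty T] {f g : T → ℝ} {r : ℝ}
    (hf : ∀ s, 0 ≤ f s) (hg : ∀ s, 0 ≤ g s) (h : ∀ s, |f s - g s| ≤ r) :
    |(⨅ s, f s) - ⨅ s, g s| ≤ r := by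
  have key : ∀ f g : T → ℝ, (∀ s, 0 ≤ f s) → (∀ s, |f s - g s| ≤ r) →
      (⨅ s, f s) - r ≤ ⨅ s, g s := fun f g hf h => by
    refine le_ciInf fun s => ?_
    have h1 : ⨅ s, f s ≤ f s := ciInf_le ⟨0, by rintro _ ⟨s, rfl⟩; exact hf s⟩ s
    linarith [(abs_le.1 (h s)).2]
  have h1 := key f g hf h
  have h2 := key g f hg fun s => by rw [abs_sub_comm]; exact h s
  exact abs_le.2 ⟨by linarith, by linarith⟩

/-- The exponential is nonexpansive on the negative half-line. -/
lemma abs_exp_sub_exp_le {a b : ℝ} (ha : a ≤ 0) (hb : b ≤ 0) :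
    |Real.exp a - Real.exp b| ≤ |a - b| := by
  have key : ∀ a b : ℝ, a ≤ 0 → Real.exp a - Real.exp b ≤ |a - b| := fun a b ha => by
    have h1 := Real.add_one_le_exp (b - a)
    have h2 : Real.exp b = Real.exp a * Real.exp (b - a) := by rw [← Real.exp_add]; ring_nf
    have h3 := Real.exp_le_one_iff.2 ha
    have h4 := Real.exp_pos a
    have h5 := neg_abs_le (b - a)
    rw [abs_sub_comm a b]
    have h6 := abs_nonneg (b - a)
    rw [h2]
    nlinarith
  refine abs_le.2 ⟨?_, key a b ha⟩
  have := key b a hb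
  rw [abs_sub_comm] at this
  linarith

/-- The logarithm is Lipschitz with constant `1 / c` on `[c, ∞)`. -/
lemma abs_log_sub_log_le {a b c : ℝ} (hc : 0 < c) (ha : c ≤ a) (hb : c ≤ b) :
    |Real.log a - Real.log b| ≤ |a - b| / c := by
  have key : ∀ a b : ℝ, c ≤ a → c ≤ b → Real.log a - Real.log b ≤ |a - b| / c := fun a b ha hb => by
    have hb0 := hc.trans_le hb
    have ha0 := hc.trans_le ha
    rw [← Real.log_div ha0.ne' hb0.ne']
    refine (Real.log_le_sub_one_of_pos (by positivity)).trans ?_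
    calc a / b - 1 = (a - b) / b := by field_simp
      _ ≤ |a - b| / b := by gcongr; exact le_abs_self _
      _ ≤ |a - b| / c := by gcongr
  refine abs_le.2 ⟨?_, key a b ha hb⟩
  have := key b a hb ha
  rw [abs_sub_comm] at this
  linarith

lemma abs_csSup_image_sub_le {I : Set ℝ} (hI : I.Nonempty) {f g : ℝ → ℝ} {r : ℝ}
    (hf : BddAbove (f '' I)) (hg : BddAbove (g '' I)) (h : ∀ α ∈ I, |f α - g α| ≤ r) :
    |sSup (f '' I) - sSup (g '' I)| ≤ r := by
  have key : ∀ f g : ℝ → ℝ, BddAbove (g '' I) → (∀ α ∈ I, |f α - g α| ≤ r) →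
      sSup (f '' I) ≤ sSup (g '' I) + r := fun f g hg h => by
    refine csSup_le (hI.image f) ?_
    rintro _ ⟨α, hα, rfl⟩
    have := le_csSup hg ⟨α, hα, rfl⟩
    linarith [(abs_le.1 (h α hα)).2]
  have h1 := key f g hg h
  have h2 := key g f hf fun α hα => by rw [abs_sub_comm]; exact h α hα
  exact abs_le.2 ⟨by linarith, by linarith⟩

lemma clip_nonneg (b x : ℝ) : 0 ≤ clip b x := le_max_left _ _

lemma clip_le {b : ℝ} (hb : 0 ≤ b) (x : ℝ) : clip b x ≤ b := max_le hb (min_le_right _ _)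

/-- Clipping does not increase the distance to a point of the interval. -/
lemma abs_clip_sub_le {b x m : ℝ} (h0 : 0 ≤ m) (hb : m ≤ b) : |clip b x - m| ≤ |x - m| := by
  have hm : clip b m = m := by rw [clip, min_eq_left hb, max_eq_right h0]
  nth_rewrite 1 [← hm]
  rw [clip, clip]
  refine (abs_max_sub_max_le_max _ _ _ _).trans ?_
  rw [sub_self, abs_zero]
  refine max_le (abs_nonneg _) ((abs_min_sub_min_le_max _ _ _ _).trans ?_)
  simp

variable {S A : Type*} [MeasurableSpace S] [MeasurableSpace A] {d H K : ℕ}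

/-- A bound for the parameter estimates of the algorithm. -/
noncomputable def weightBound (D : Divergence) (H K : ℕ) (lam : ℝ) : ℝ :=
  match D with
  | .TV => H * K
  | .KL => H + lam * K
  | .chiSq => H + (H : ℝ) ^ 2 / (2 * lam)

lemma abs_weights_le (φ : FeatureMap S A d) (D : Divergence) {lam : ℝ} (hlam : 0 < lam)
    (hK : 1 ≤ K) (data : Fin K → Traj S A H) (h : Fin H) {V : S → ℝ} [Nonempty S]
    (h0 : ∀ s, 0 ≤ V s) (hB : ∀ s, V s ≤ H) (i : Fin d) :
    |weights φ D lam 1 data h V i| ≤ weightBound D H K lam := by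
  have hK1 : (1 : ℝ) ≤ K := by exact_mod_cast hK
  have hH0 : (0 : ℝ) ≤ H := Nat.cast_nonneg _
  cases D with
  | TV =>
    simp only [weights, weightBound]
    refine abs_ridge_le φ data h hH0 (fun s => ?_) i
    have h1 : 0 ≤ (⨅ s', V s') + lam := add_nonneg (Real.iInf_nonneg h0) hlam.le
    rw [abs_of_nonneg (le_min (h0 s) h1)]
    exact (min_le_left _ _).trans (hB s)
  | KL =>
    simp only [weights, weightBound]
    set r := ridge φ 1 data h (fun s => Real.exp (-V s / lam)) i with hr
    have hr1 : r ≤ K := by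
      have := abs_ridge_le φ data h (f := fun s => Real.exp (-V s / lam)) zero_le_one (fun s => by
        rw [abs_of_pos (Real.exp_pos _)]
        exact Real.exp_le_one_iff.2
          (div_nonpos_of_nonpos_of_nonneg (by linarith [h0 s]) hlam.le)) i
      rw [one_mul] at this
      exact (le_abs_self _).trans this
    have hpos := Real.exp_pos (-(H : ℝ) / lam)
    have h1 : -(H : ℝ) / lam ≤ Real.log (max r (Real.exp (-(H : ℝ) / lam))) := by
      rw [Real.le_log_iff_exp_le (hpos.trans_le (le_max_right _ _))]
      exact le_max_right _ _
    have h2 : Real.log (max r (Real.exp (-(H : ℝ) / lam))) ≤ K := by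
      have h3 : max r (Real.exp (-(H : ℝ) / lam)) ≤ K := by
        refine max_le hr1 (le_trans ?_ hK1)
        exact Real.exp_le_one_iff.2 (div_nonpos_of_nonpos_of_nonneg (by linarith) hlam.le)
      have h4 := Real.log_le_sub_one_of_pos (hpos.trans_le (le_max_right r _))
      linarith
    have h5 : lam * (-(H : ℝ) / lam) = -H := by field_simp
    have h6 := mul_le_mul_of_nonneg_left h1 hlam.le
    have h7 := mul_le_mul_of_nonneg_left h2 hlam.le
    rw [h5] at h6
    have h8 : 0 ≤ lam * K := by positivity
    refine abs_le.2 ⟨by linarith, by linarith⟩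
  | chiSq =>
    simp only [weights, weightBound]
    have hne : (Set.Icc (⨅ s, V s) (⨆ s, V s)).Nonempty :=
      Set.nonempty_Icc.2 (iInf_le_iSup_of_bounds h0 hB)
    set g : ℝ → ℝ := fun α => clip H (ridge φ 1 data h (fun s => min (V s) α) i)
          + 1 / (4 * lam) * (clip H (ridge φ 1 data h (fun s => min (V s) α) i)) ^ 2
          - 1 / (4 * lam) *
              clip ((H : ℝ) ^ 2) (ridge φ 1 data h (fun s => (min (V s) α) ^ 2) i) with hg
    have hq : 0 ≤ 1 / (4 * lam) := by positivity
    have e1 : (H : ℝ) ^ 2 / (2 * lam) = 2 * (1 / (4 * lam) * (H : ℝ) ^ 2) := by field_simp; ring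
    have e2 : 0 ≤ 1 / (4 * lam) * (H : ℝ) ^ 2 := by positivity
    have hb : ∀ α, -(1 / (4 * lam) * (H : ℝ) ^ 2) ≤ g α
        ∧ g α ≤ H + 1 / (4 * lam) * (H : ℝ) ^ 2 := fun α => by
      have h1 := clip_nonneg H (ridge φ 1 data h (fun s => min (V s) α) i)
      have h2 := clip_le hH0 (ridge φ 1 data h (fun s => min (V s) α) i)
      have h3 := clip_nonneg ((H : ℝ) ^ 2) (ridge φ 1 data h (fun s => (min (V s) α) ^ 2) i)
      have h4 := clip_le (sq_nonneg (H : ℝ)) (ridge φ 1 data h (fun s => (min (V s) α) ^ 2) i)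
      have h5 := mul_le_mul_of_nonneg_left h4 hq
      have h6 := mul_nonneg hq h3
      have h7 := mul_le_mul_of_nonneg_left (pow_le_pow_left₀ h1 h2 2) hq
      have h8 := mul_nonneg hq (sq_nonneg (clip H (ridge φ 1 data h (fun s => min (V s) α) i)))
      simp only [hg]
      exact ⟨by linarith, by linarith⟩
    have hbdd : BddAbove (g '' Set.Icc (⨅ s, V s) (⨆ s, V s)) :=
      ⟨_, by rintro _ ⟨α, _, rfl⟩; exact (hb α).2⟩
    obtain ⟨α, hα⟩ := hne
    rw [e1]
    refine abs_le.2 ⟨?_, ?_⟩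
    · have h1 := le_csSup hbdd ⟨α, hα, rfl⟩
      linarith [(hb α).1]
    · refine csSup_le (Set.Nonempty.image g ⟨α, hα⟩) ?_
      rintro _ ⟨α, _, rfl⟩
      linarith [(hb α).2]

/-- The factor by which the error of the ridge estimates is multiplied in the parameter estimate. -/
noncomputable def errorScale (D : Divergence) (H : ℕ) (lam : ℝ) : ℝ :=
  match D with
  | .TV => H
  | .KL => lam * Real.exp (H / lam)
  | .chiSq => H * (1 + 3 * H / (4 * lam))

/-- The grid spacing for the parameters of the value estimates. It is of order `1 / K`, so that the
replacement of a parameter by the nearest grid point changes each of the `K` regression targets by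
at most half of their range divided by `√K`, and the ridge estimate by at most the width times the
range. -/
noncomputable def gridSpacing (D : Divergence) (H K : ℕ) (lam : ℝ) : ℝ :=
  match D with
  | .TV => H / (2 * K)
  | .KL => lam / (2 * K)
  | .chiSq => H / (4 * K)

variable [Fintype A] [Nonempty A] (M : LinearMDP S A d H) (ρ : Measure S) [IsProbabilityMeasure ρ]
  (πb : Policy S A)

/-- With high probability, the parameter estimates are accurate simultaneously for all greedy values
with parameters in a box. The regression targets are Lipschitz functions of the parameters of the
greedy value, so that `LinearMDP.exists_uniform_event` applies, and the parameter estimates are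
Lipschitz functions of the clipped regression estimates. For the `χ²`-divergence, the truncation
level is one more parameter, and two families of targets are needed, which accounts for the factor
`4 (2 n + 1)` in `hcount`. -/
lemma LinearMDP.exists_estimation_event (D : Divergence) {lam : ℝ} (hlam : 0 < lam) (hH : 1 ≤ H)
    (hK : 1 ≤ K) {n : ℕ} {R t δ : ℝ} (ht : 0 < t) (hR : R ≤ n * gridSpacing D H K lam)
    (hRH : (H : ℝ) ≤ R)
    (hcount : 4 * H * d * (2 * n + 1 : ℝ) ^ (d + 1) * Real.exp (-t) ≤ δ) :
    ∃ E : Set (Fin K → Traj S A H), MeasurableSet E ∧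
      M.dataLaw ρ πb K Eᶜ ≤ ENNReal.ofReal δ ∧
      ∀ data ∈ E, ∀ (h : Fin H) (u : Fin d → ℝ), (∀ j, |u j| ≤ R) → ∀ i,
        |weights M.φ D lam 1 data h (greedyValue M.φ ((H : ℝ) - (h : ℕ) - 1) u) i
            - dualValue D lam (M.μ₀ h i : Measure S) (greedyValue M.φ ((H : ℝ) - (h : ℕ) - 1) u)|
          ≤ errorScale D H lam * (√(d : ℝ) + 1 + √(t / 2))
              * ridgeWidth (features M.φ data h) i := by
  have hK1 : (1 : ℝ) ≤ K := by exact_mod_cast hK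
  have hK0 : (0 : ℝ) < K := by linarith
  have hH1 : (1 : ℝ) ≤ H := by exact_mod_cast hH
  have hH0 : (0 : ℝ) < H := by linarith
  have hsK : √(K : ℝ) ≤ K := Real.sqrt_le_iff.2 ⟨by positivity, by nlinarith⟩
  have hS : Nonempty S := ρ.nonempty_of_neZero
  have hlevel : ∀ h : Fin H, 0 ≤ (H : ℝ) - (h : ℕ) - 1 := fun h => by
    have : ((h : ℕ) : ℝ) + 1 ≤ H := by exact_mod_cast h.2
    linarith
  set V : Fin H → (Fin d → ℝ) → S → ℝ := fun h u =>
    greedyValue M.φ ((H : ℝ) - (h : ℕ) - 1) u with hVdef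
  have hVm : ∀ h u, Measurable (V h u) := fun h u => measurable_greedyValue M.φ
  have hV0 : ∀ h u s, 0 ≤ V h u s := fun h u s => greedyValue_nonneg M.φ s
  have hVH : ∀ h u s, V h u s ≤ H := fun h u s =>
    (greedyValue_le M.φ (hlevel h) s).trans (by
      have : (0 : ℝ) ≤ (h : ℕ) := Nat.cast_nonneg _
      linarith)
  have hVL : ∀ h u u' e, (∀ j, |u j - u' j| ≤ e) → ∀ s, |V h u s - V h u' s| ≤ e :=
    fun h u u' e he s => abs_greedyValue_sub_le M.φ he s
  set C := √(d : ℝ) + 1 + √(t / 2) with hC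
  have hpow : (2 * n + 1 : ℝ) ^ d ≤ (2 * n + 1 : ℝ) ^ (d + 1) :=
    pow_le_pow_right₀ (by linarith [(Nat.cast_nonneg n : (0 : ℝ) ≤ n)]) (Nat.le_succ d)
  have hcount' : 2 * H * d * (2 * n + 1 : ℝ) ^ d * Real.exp (-t) ≤ δ := by
    refine le_trans ?_ hcount
    gcongr
    norm_num
  have hint0 : ∀ h u, 0 ≤ ⨅ s, V h u s := fun h u => Real.iInf_nonneg (hV0 h u)
  cases D with
  | TV =>
    obtain ⟨E, hE, hPE, hE'⟩ := M.exists_uniform_event ρ πb (m := d) (L := 1) (B := H)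
      (ε := H / (2 * K)) (R := R) (n := n) (t := t) (δ := δ)
      (fun h u s => min (V h u s) ((⨅ s', V h u s') + lam)) hH0
      (fun h u => (hVm h u).min measurable_const)
      (fun h u s => le_min (hV0 h u s) (add_nonneg (hint0 h u) hlam.le))
      (fun h u s => (min_le_left _ _).trans (hVH h u s))
      (fun h u u' e he s => by
        rw [one_mul]
        refine abs_min_sub_min_le (hVL h u u' e he s) ?_
        rw [add_sub_add_right_eq_sub]
        exact abs_iInf_sub_iInf_le (hV0 h u) (hV0 h u') (hVL h u u' e he))
      (by positivity) hR (by
        calc 2 * (1 * ((H : ℝ) / (2 * K))) * √(K : ℝ) ≤ 2 * (1 * ((H : ℝ) / (2 * K))) * K := by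
              gcongr
          _ = H := by field_simp) zero_le_one ht hcount'
    refine ⟨E, hE, hPE, fun data hdata h u hu i => ?_⟩
    refine (hE' data hdata h u hu i).trans (le_of_eq ?_)
    simp only [errorScale]
    ring
  | KL =>
    have hexp1 : ∀ h u s, -V h u s / lam ≤ 0 := fun h u s =>
      div_nonpos_of_nonpos_of_nonneg (by linarith [hV0 h u s]) hlam.le
    obtain ⟨E, hE, hPE, hE'⟩ := M.exists_uniform_event ρ πb (m := d) (L := 1 / lam) (B := 1)
      (ε := lam / (2 * K)) (R := R) (n := n) (t := t) (δ := δ)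
      (fun h u s => Real.exp (-V h u s / lam)) one_pos
      (fun h u => ((hVm h u).neg.div_const lam).exp)
      (fun h u s => (Real.exp_pos _).le)
      (fun h u s => Real.exp_le_one_iff.2 (hexp1 h u s))
      (fun h u u' e he s => by
        refine (abs_exp_sub_exp_le (hexp1 h u s) (hexp1 h u' s)).trans ?_
        rw [← sub_div, abs_div, abs_of_pos hlam, div_eq_inv_mul, one_div]
        gcongr
        rw [neg_sub_neg, abs_sub_comm]
        exact hVL h u u' e he s)
      (by positivity) hR (by
        calc 2 * (1 / lam * (lam / (2 * K))) * √(K : ℝ) ≤ 2 * (1 / lam * (lam / (2 * K))) * K := by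
              gcongr
          _ = 1 := by field_simp) (by positivity) ht hcount'
    refine ⟨E, hE, hPE, fun data hdata h u hu i => ?_⟩
    have h1 := hE' data hdata h u hu i
    simp only [weights, dualValue, errorScale]
    change |-lam * Real.log (max (ridge M.φ 1 data h (fun s => Real.exp (-V h u s / lam)) i) _)
      - -lam * Real.log (∫ s, Real.exp (-V h u s / lam) ∂(M.μ₀ h i : Measure S))| ≤ _
    set r := ridge M.φ 1 data h (fun s => Real.exp (-V h u s / lam)) i with hr
    set m := ∫ s, Real.exp (-V h u s / lam) ∂(M.μ₀ h i : Measure S) with hm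
    set c := Real.exp (-(H : ℝ) / lam) with hc
    have hc0 : 0 < c := Real.exp_pos _
    have hcm : c ≤ m := by
      calc c = ∫ _, c ∂(M.μ₀ h i : Measure S) := by simp
        _ ≤ m := integral_mono (integrable_const _)
            (integrable_exp_neg_div (hVm h u) (hV0 h u) hlam) fun s => by
              refine Real.exp_le_exp.2 ?_
              gcongr
              exact hVH h u s
    -- the lower bound `c` holds for `m`, so that imposing it on `r` does not increase the error
    have h2 : |max r c - m| ≤ |r - m| := by
      nth_rewrite 1 [← max_eq_left hcm]
      refine (abs_max_sub_max_le_max _ _ _ _).trans ?_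
      simp
    have h3 := abs_log_sub_log_le hc0 (le_max_right r c) hcm
    have h4 : 1 / c = Real.exp (H / lam) := by
      rw [hc, one_div, ← Real.exp_neg, neg_div, neg_neg]
    calc _ = lam * |Real.log (max r c) - Real.log m| := by
          rw [← mul_sub, abs_mul, abs_neg, abs_of_pos hlam]
      _ ≤ lam * (|r - m| / c) := by
          gcongr
          exact h3.trans (by gcongr)
      _ ≤ lam * ((ridgeWidth (features M.φ data h) i * (1 * C)) / c) := by gcongr
      _ = _ := by rw [← h4]; ring
  | chiSq =>
    have hcountχ : 2 * H * d * (2 * n + 1 : ℝ) ^ (d + 1) * Real.exp (-t) ≤ δ / 2 := by linarith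
    -- the first coordinate of the parameter is the truncation level
    have hmin0 : ∀ h (v : Fin (d + 1) → ℝ) s, 0 ≤ min (V h (Fin.tail v) s) |v 0| :=
      fun h v s => le_min (hV0 h _ s) (abs_nonneg _)
    have hminH : ∀ h (v : Fin (d + 1) → ℝ) s, min (V h (Fin.tail v) s) |v 0| ≤ H :=
      fun h v s => (min_le_left _ _).trans (hVH h _ s)
    have hminm : ∀ h (v : Fin (d + 1) → ℝ), Measurable fun s => min (V h (Fin.tail v) s) |v 0| :=
      fun h v => (hVm h _).min measurable_const
    have hminL : ∀ h (v v' : Fin (d + 1) → ℝ) e, (∀ j, |v j - v' j| ≤ e) → ∀ s,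
        |min (V h (Fin.tail v) s) (|v 0|) - min (V h (Fin.tail v') s) (|v' 0|)| ≤ e :=
      fun h v v' e he s => abs_min_sub_min_le (hVL h _ _ e (fun j => he j.succ) s)
        ((abs_abs_sub_abs_le_abs_sub _ _).trans (he 0))
    obtain ⟨E₁, hE₁, hPE₁, hE₁'⟩ := M.exists_uniform_event ρ πb (m := d + 1) (L := 1) (B := H)
      (ε := H / (4 * K)) (R := R) (n := n) (t := t) (δ := δ / 2)
      (fun h v s => min (V h (Fin.tail v) s) |v 0|) hH0 hminm hmin0 hminH
      (fun h v v' e he s => by rw [one_mul]; exact hminL h v v' e he s)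
      (by positivity) hR (by
        calc 2 * (1 * ((H : ℝ) / (4 * K))) * √(K : ℝ) ≤ 2 * (1 * ((H : ℝ) / (4 * K))) * K := by
              gcongr
          _ = H / 2 := by field_simp; ring
          _ ≤ H := by linarith) zero_le_one ht hcountχ
    obtain ⟨E₂, hE₂, hPE₂, hE₂'⟩ := M.exists_uniform_event ρ πb (m := d + 1) (L := 2 * H)
      (B := (H : ℝ) ^ 2) (ε := H / (4 * K)) (R := R) (n := n) (t := t) (δ := δ / 2)
      (fun h v s => (min (V h (Fin.tail v) s) |v 0|) ^ 2) (by positivity)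
      (fun h v => (hminm h v).pow_const 2) (fun h v s => sq_nonneg _)
      (fun h v s => pow_le_pow_left₀ (hmin0 h v s) (hminH h v s) 2)
      (fun h v v' e he s => by
        have h1 := hminL h v v' e he s
        set x := min (V h (Fin.tail v) s) |v 0| with hx
        set y := min (V h (Fin.tail v') s) |v' 0| with hy
        have hx0 : 0 ≤ x := hmin0 h v s
        have hy0 : 0 ≤ y := hmin0 h v' s
        have hxH : x ≤ H := hminH h v s
        have hyH : y ≤ H := hminH h v' s
        rw [sq_sub_sq, abs_mul, abs_of_nonneg (add_nonneg hx0 hy0)]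
        exact mul_le_mul (by linarith) h1 (abs_nonneg _) (by positivity))
      (by positivity) hR (by
        calc 2 * (2 * H * ((H : ℝ) / (4 * K))) * √(K : ℝ)
            ≤ 2 * (2 * H * ((H : ℝ) / (4 * K))) * K := by gcongr
          _ = (H : ℝ) ^ 2 := by field_simp; ring) (by positivity) ht hcountχ
    have hδ0 : 0 ≤ δ / 2 := le_trans (by positivity) hcountχ
    refine ⟨E₁ ∩ E₂, hE₁.inter hE₂, ?_, fun data hdata h u hu i => ?_⟩
    · rw [Set.compl_inter]
      refine (measure_union_le _ _).trans ((add_le_add hPE₁ hPE₂).trans (le_of_eq ?_))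
      rw [← ENNReal.ofReal_add hδ0 hδ0]
      congr 1
      ring
    set w := ridgeWidth (features M.φ data h) i with hw
    have hw0 : 0 ≤ w := ridgeWidth_nonneg _ i
    have hC0 : 0 ≤ C := by positivity
    have hpt : ∀ α ∈ Set.Icc (⨅ s, V h u s) (⨆ s, V h u s),
        |(clip H (ridge M.φ 1 data h (fun s => min (V h u s) α) i)
          + 1 / (4 * lam) * (clip H (ridge M.φ 1 data h (fun s => min (V h u s) α) i)) ^ 2
          - 1 / (4 * lam) *
              clip ((H : ℝ) ^ 2) (ridge M.φ 1 data h (fun s => (min (V h u s) α) ^ 2) i))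
          - chiSqDual lam (M.μ₀ h i : Measure S) (V h u) α|
        ≤ errorScale .chiSq H lam * C * w := by
      intro α hα
      have hα0 : 0 ≤ α := (hint0 h u).trans hα.1
      have hαH : α ≤ H := hα.2.trans (ciSup_le (hVH h u))
      have hcons : ∀ j, |(Fin.cons α u : Fin (d + 1) → ℝ) j| ≤ R := by
        refine Fin.cases ?_ fun j => ?_
        · rw [Fin.cons_zero, abs_of_nonneg hα0]; linarith
        · rw [Fin.cons_succ]; exact hu j
      have h1 := hE₁' data hdata.1 h (Fin.cons α u) hcons i
      have h2 := hE₂' data hdata.2 h (Fin.cons α u) hcons i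
      simp only [Fin.tail_cons, Fin.cons_zero, abs_of_nonneg hα0] at h1 h2
      rw [chiSqDual]
      set m := ∫ s, min (V h u s) α ∂(M.μ₀ h i : Measure S) with hm
      set q := ∫ s, (min (V h u s) α) ^ 2 ∂(M.μ₀ h i : Measure S) with hq
      have hm0 : 0 ≤ m := integral_nonneg fun s => le_min (hV0 h u s) hα0
      have hq0 : 0 ≤ q := integral_nonneg fun s => sq_nonneg _
      have hmH : m ≤ H := by
        calc m ≤ ∫ _, (H : ℝ) ∂(M.μ₀ h i : Measure S) :=
              integral_mono (integrable_min _ (hVm h u) (hV0 h u) hα0) (integrable_const _)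
                fun s => (min_le_left _ _).trans (hVH h u s)
          _ = H := by simp
      have hqH : q ≤ (H : ℝ) ^ 2 := by
        calc q ≤ ∫ _, (H : ℝ) ^ 2 ∂(M.μ₀ h i : Measure S) :=
              integral_mono (integrable_min_sq _ (hVm h u) (hV0 h u) hα0) (integrable_const _)
                fun s => pow_le_pow_left₀ (le_min (hV0 h u s) hα0)
                  ((min_le_left _ _).trans (hVH h u s)) 2
          _ = (H : ℝ) ^ 2 := by simp
      have h3 := (abs_clip_sub_le (x := ridge M.φ 1 data h (fun s => min (V h u s) α) i)
        hm0 hmH).trans h1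
      have h4 := (abs_clip_sub_le (x := ridge M.φ 1 data h (fun s => (min (V h u s) α) ^ 2) i)
        hq0 hqH).trans h2
      set m' := clip H (ridge M.φ 1 data h (fun s => min (V h u s) α) i) with hm'
      set q' := clip ((H : ℝ) ^ 2) (ridge M.φ 1 data h (fun s => (min (V h u s) α) ^ 2) i) with hq'
      have hm'0 : 0 ≤ m' := clip_nonneg _ _
      have hm'H : m' ≤ H := clip_le hH0.le _
      have hsq : |m' ^ 2 - m ^ 2| ≤ 2 * H * (w * (H * C)) := by
        rw [sq_sub_sq, abs_mul, abs_of_nonneg (add_nonneg hm'0 hm0)]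
        exact mul_le_mul (by linarith) h3 (abs_nonneg _) (by positivity)
      set κ := 1 / (4 * lam) with hκ
      have hκ0 : 0 ≤ κ := by positivity
      have h5 := mul_le_mul_of_nonneg_left hsq hκ0
      have h6 := mul_le_mul_of_nonneg_left h4 hκ0
      have hscale : errorScale .chiSq H lam * C * w
          = w * (H * C) + κ * (2 * H * (w * (H * C))) + κ * (w * ((H : ℝ) ^ 2 * C)) := by
        simp only [errorScale, hκ]
        field_simp
        ring
      rw [hscale]
      have h7 : m' + κ * m' ^ 2 - κ * q' - (m + κ * m ^ 2 - κ * q)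
          = (m' - m) + κ * (m' ^ 2 - m ^ 2) - κ * (q' - q) := by ring
      rw [h7]
      refine (abs_sub _ _).trans (add_le_add ((abs_add_le _ _).trans (add_le_add h3 ?_)) ?_)
      · rw [abs_mul, abs_of_nonneg hκ0]; exact h5
      · rw [abs_mul, abs_of_nonneg hκ0]; exact h6
    refine abs_csSup_image_sub_le
      (Set.nonempty_Icc.2 (iInf_le_iSup_of_bounds (hV0 h u) (hVH h u))) ?_
      (bddAbove_chiSqDual (hVm h u) (hV0 h u) (hVH h u) hlam) hpt
    obtain ⟨b, hb⟩ := bddAbove_chiSqDual (ν := (M.μ₀ h i : Measure S)) (hVm h u) (hV0 h u)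
      (hVH h u) hlam
    refine ⟨b + errorScale .chiSq H lam * C * w, ?_⟩
    rintro _ ⟨α, hα, rfl⟩
    have h1 := (abs_le.1 (hpt α hα)).2
    have h2 := hb ⟨α, hα, rfl⟩
    linarith

end Estimation

/-! ### The penalty coefficient -/

section Constants

/-- The quantity whose logarithm appears in the penalty coefficient. For the Kullback-Leibler
divergence it includes the factor `exp (H / λ)`. -/
noncomputable def logArg (D : Divergence) (d H K : ℕ) (lam δ : ℝ) : ℝ :=
  match D with
  | .TV => 1024 * H * √(d : ℝ) * K ^ 2 / δ
  | .KL => Real.exp (H / lam) * (1024 * d * lam ^ 2 * K ^ 3 * H / δ)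
  | .chiSq => 192 * K ^ 5 * H ^ 6 * d ^ 3 * (1 + H / (2 * lam)) ^ 3 / δ

variable {D : Divergence} {d H K : ℕ} {lam δ : ℝ}

lemma betaCoeff_nonneg (hlam : 0 < lam) : 0 ≤ betaCoeff D d H K lam δ := by
  cases D <;> simp only [betaCoeff] <;> positivity

lemma sqrt_log_le {X : ℝ} (hX : 1 ≤ X) : √(2 * Real.log X) ≤ X := by
  have := Real.log_le_sub_one_of_pos (by linarith : 0 < X)
  exact Real.sqrt_le_iff.2 ⟨by linarith, by nlinarith⟩

lemma sqrt_log_le' {X : ℝ} (hX : 1 ≤ X) : √(Real.log X) ≤ X :=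
  (Real.sqrt_le_sqrt (by linarith [Real.log_nonneg hX])).trans (sqrt_log_le hX)

lemma log_logArg_KL (hd : 1 ≤ d) (hH : 1 ≤ H) (hK : 1 ≤ K) (hlam : 0 < lam) (hδ : 0 < δ) :
    Real.log (logArg .KL d H K lam δ)
      = H / lam + Real.log (1024 * d * lam ^ 2 * K ^ 3 * H / δ) := by
  have : (0 : ℝ) < d := by exact_mod_cast hd
  have : (0 : ℝ) < H := by exact_mod_cast hH
  have : (0 : ℝ) < K := by exact_mod_cast hK
  rw [logArg, Real.log_mul (Real.exp_pos _).ne' (by positivity), Real.log_exp]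

/-- The factor `λ²` in the logarithm is compensated by half of the exponential. -/
lemma le_logArg_KL (hH : 1 ≤ H) (hlam : 0 < lam) (hδ : 0 < δ) :
    Real.exp (H / lam / 2) * (128 * d * K ^ 3 * H ^ 3 * (1 / δ)) ≤ logArg .KL d H K lam δ := by
  have hH0 : (0 : ℝ) < H := by exact_mod_cast hH
  set y := (H : ℝ) / lam with hy
  have hy0 : 0 < y := by positivity
  have h1 : y ^ 2 / 8 ≤ Real.exp (y / 2) := by
    have := Real.quadratic_le_exp_of_nonneg (by positivity : 0 ≤ y / 2)
    nlinarith
  have h2 : Real.exp y = Real.exp (y / 2) * Real.exp (y / 2) := by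
    rw [← Real.exp_add]; congr 1; ring
  have hl : lam = H / y := by rw [hy]; field_simp
  rw [logArg, ← hy, h2, mul_assoc (Real.exp (y / 2))]
  refine mul_le_mul_of_nonneg_left ?_ (Real.exp_pos _).le
  calc (128 * d * K ^ 3 * H ^ 3 * (1 / δ) : ℝ)
      = y ^ 2 / 8 * (1024 * d * lam ^ 2 * K ^ 3 * H / δ) := by
        rw [hl]; field_simp; ring
    _ ≤ _ := by gcongr

variable (hd : 1 ≤ d) (hH : 1 ≤ H) (hK : 1 ≤ K) (hlam : 0 < lam) (hδ0 : 0 < δ) (hδ1 : δ < 1)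

include hd hH hK hlam hδ0 hδ1

lemma le_logArg : 128 ≤ logArg D d H K lam δ := by
  have hd' : (1 : ℝ) ≤ d := by exact_mod_cast hd
  have hH' : (1 : ℝ) ≤ H := by exact_mod_cast hH
  have hK' : (1 : ℝ) ≤ K := by exact_mod_cast hK
  have hδ' : 1 ≤ 1 / δ := by rw [le_div_iff₀ hδ0]; linarith
  have hs : 1 ≤ √(d : ℝ) := Real.one_le_sqrt.2 hd'
  cases D with
  | TV =>
    calc (128 : ℝ) ≤ 1024 * 1 * 1 * 1 ^ 2 * 1 := by norm_num
      _ ≤ 1024 * H * √(d : ℝ) * K ^ 2 * (1 / δ) := by gcongr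
      _ = _ := by rw [logArg]; ring
  | KL =>
    refine le_trans ?_ (le_logArg_KL hH hlam hδ0)
    calc (128 : ℝ) = 1 * (128 * 1 * 1 ^ 3 * 1 ^ 3 * 1) := by norm_num
      _ ≤ _ := by
        gcongr
        exact Real.one_le_exp (by positivity)
  | chiSq =>
    have hz : 1 ≤ 1 + (H : ℝ) / (2 * lam) := by
      have : 0 ≤ (H : ℝ) / (2 * lam) := by positivity
      linarith
    calc (128 : ℝ) ≤ 192 * 1 ^ 5 * 1 ^ 6 * 1 ^ 3 * 1 ^ 3 * 1 := by norm_num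
      _ ≤ 192 * K ^ 5 * H ^ 6 * d ^ 3 * (1 + H / (2 * lam)) ^ 3 * (1 / δ) := by gcongr
      _ = _ := by rw [logArg]; ring

lemma errorScale_mul_le_betaCoeff :
    errorScale D H lam * (8 * d * √(Real.log (logArg D d H K lam δ)))
      ≤ betaCoeff D d H K lam δ := by
  have hlog : 0 ≤ Real.log (logArg D d H K lam δ) :=
    Real.log_nonneg (by linarith [le_logArg (D := D) hd hH hK hlam hδ0 hδ1])
  cases D with
  | TV =>
    simp only [errorScale, betaCoeff, logArg] at hlog ⊢
    set L := Real.log (1024 * H * √(d : ℝ) * K ^ 2 / δ)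
    calc (H : ℝ) * (8 * d * √L) ≤ H * (16 * d * √(2 * L)) := by
          gcongr
          · norm_num
          · linarith
      _ = _ := by ring
  | KL =>
    rw [log_logArg_KL hd hH hK hlam hδ0]
    simp only [errorScale, betaCoeff]
    set L := (H : ℝ) / lam + Real.log (1024 * d * lam ^ 2 * K ^ 3 * H / δ)
    calc lam * Real.exp (H / lam) * (8 * d * √L)
        ≤ lam * Real.exp (H / lam) * (16 * d * √L) := by
          gcongr
          norm_num
      _ = _ := by ring
  | chiSq =>
    simp only [errorScale, betaCoeff, logArg]
    exact le_of_eq (by ring)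

lemma count_le_logArg_pow : 4 * H * d / δ ≤ logArg D d H K lam δ ^ 3 := by
  have hd' : (1 : ℝ) ≤ d := by exact_mod_cast hd
  have hH' : (1 : ℝ) ≤ H := by exact_mod_cast hH
  have hK' : (1 : ℝ) ≤ K := by exact_mod_cast hK
  have hδ' : 1 ≤ 1 / δ := by rw [le_div_iff₀ hδ0]; linarith
  have hs : 1 ≤ √(d : ℝ) := Real.one_le_sqrt.2 hd'
  have hX := le_logArg (D := D) hd hH hK hlam hδ0 hδ1
  have hpow : ∀ X : ℝ, 128 ≤ X → X ≤ X ^ 3 := fun X hX =>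
    le_self_pow₀ (by linarith) (by norm_num)
  cases D with
  | TV =>
    set X := logArg .TV d H K lam δ with hXdef
    have h1 : 4 * H * (1 / δ) ≤ X := by
      calc 4 * H * (1 / δ) = 4 * H * 1 * 1 ^ 2 * (1 / δ) := by ring
        _ ≤ 1024 * H * √(d : ℝ) * K ^ 2 * (1 / δ) := by gcongr; norm_num
        _ = _ := by rw [hXdef, logArg]; ring
    have h2 : √(d : ℝ) ≤ X := by
      calc √(d : ℝ) = 1 * 1 * √(d : ℝ) * 1 ^ 2 * 1 := by ring
        _ ≤ 1024 * H * √(d : ℝ) * K ^ 2 * (1 / δ) := by gcongr; norm_num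
        _ = _ := by rw [hXdef, logArg]; ring
    have h3 : (d : ℝ) = √(d : ℝ) ^ 2 := (Real.sq_sqrt (by positivity)).symm
    calc 4 * H * d / δ = 4 * H * (1 / δ) * √(d : ℝ) ^ 2 := by rw [← h3]; ring
      _ ≤ X * X ^ 2 := by gcongr
      _ = X ^ 3 := by ring
  | KL =>
    refine le_trans ?_ (hpow _ hX)
    refine le_trans ?_ (le_logArg_KL hH hlam hδ0)
    calc 4 * H * d / δ = 1 * (4 * d * 1 ^ 3 * H ^ 1 * (1 / δ)) := by ring
      _ ≤ _ := by
        gcongr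
        · exact Real.one_le_exp (by positivity)
        · norm_num
        · norm_num
  | chiSq =>
    have hz : 1 ≤ 1 + (H : ℝ) / (2 * lam) := by
      have : 0 ≤ (H : ℝ) / (2 * lam) := by positivity
      linarith
    refine le_trans ?_ (hpow _ hX)
    calc 4 * H * d / δ = 4 * 1 ^ 5 * H ^ 1 * d ^ 1 * 1 ^ 3 * (1 / δ) := by ring
      _ ≤ 192 * K ^ 5 * H ^ 6 * d ^ 3 * (1 + H / (2 * lam)) ^ 3 * (1 / δ) := by
        gcongr <;> norm_num
      _ = _ := by rw [logArg]; ring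

/-- The radius of the parameter box is polynomial in `logArg`, relative to the grid spacing. -/
lemma radius_le_logArg_pow :
    (√(d : ℝ) + weightBound D H K lam + betaCoeff D d H K lam δ) / gridSpacing D H K lam
      ≤ 10 * logArg D d H K lam δ ^ 7 := by
  have hd' : (1 : ℝ) ≤ d := by exact_mod_cast hd
  have hH' : (1 : ℝ) ≤ H := by exact_mod_cast hH
  have hK' : (1 : ℝ) ≤ K := by exact_mod_cast hK
  have hH0 : (0 : ℝ) < H := by linarith
  have hK0 : (0 : ℝ) < K := by linarith
  have hδ' : 1 ≤ 1 / δ := by rw [le_div_iff₀ hδ0]; linarith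
  have hs : 1 ≤ √(d : ℝ) := Real.one_le_sqrt.2 hd'
  have hsd : (d : ℝ) = √(d : ℝ) ^ 2 := (Real.sq_sqrt (by positivity)).symm
  have hsd' : √(d : ℝ) ≤ d := by
    nth_rewrite 2 [hsd]
    exact le_self_pow₀ hs (by norm_num)
  have hX := le_logArg (D := D) hd hH hK hlam hδ0 hδ1
  have hpow : ∀ (X : ℝ) (k : ℕ), 128 ≤ X → k ≤ 7 → X ^ k ≤ X ^ 7 := fun X k hX hk =>
    pow_le_pow_right₀ (by linarith) hk
  cases D with
  | TV =>
    set X := logArg .TV d H K lam δ with hXdef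
    have hXeq : 1024 * H * √(d : ℝ) * K ^ 2 * (1 / δ) = X := by rw [hXdef, logArg]; ring
    have h1 : √(d : ℝ) ≤ X := by
      calc √(d : ℝ) = 1 * 1 * √(d : ℝ) * 1 ^ 2 * 1 := by ring
        _ ≤ 1024 * H * √(d : ℝ) * K ^ 2 * (1 / δ) := by gcongr; norm_num
        _ = _ := hXeq
    have h2 : (K : ℝ) ≤ X := by
      calc (K : ℝ) = 1 * 1 * 1 * K ^ 1 * 1 := by ring
        _ ≤ 1024 * H * √(d : ℝ) * K ^ 2 * (1 / δ) := by gcongr <;> norm_num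
        _ = _ := hXeq
    have h3 : √(2 * Real.log X) ≤ X := sqrt_log_le (by linarith)
    have h4 : (√(d : ℝ) + H * K + 16 * H * d * √(2 * Real.log X)) / (H / (2 * K))
        = 2 * K * (√(d : ℝ) / H + K + 16 * √(d : ℝ) ^ 2 * √(2 * Real.log X)) := by
      rw [← hsd]; field_simp
    have h5 : √(d : ℝ) / H ≤ X := (div_le_self (by positivity) hH').trans h1
    simp only [weightBound, betaCoeff, gridSpacing]
    change (√(d : ℝ) + H * K + 16 * H * d * √(2 * Real.log X)) / (H / (2 * K)) ≤ _
    rw [h4]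
    calc _ ≤ 2 * X * (X + X + X * X ^ 2 * X) := by gcongr; linarith
      _ = 4 * X ^ 2 + 2 * X ^ 5 := by ring
      _ ≤ 10 * X ^ 7 := by
        have hX7 : 0 ≤ X ^ 7 := pow_nonneg (by linarith) 7
        linarith [hpow X 2 hX (by norm_num), hpow X 5 hX (by norm_num), hX7]
  | KL =>
    have hlog := log_logArg_KL hd hH hK hlam hδ0
    have hXle := le_logArg_KL (d := d) (K := K) hH hlam hδ0
    set X := logArg .KL d H K lam δ with hXdef
    set y := (H : ℝ) / lam with hy
    have hy0 : 0 ≤ y := by positivity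
    have he1 : 1 ≤ Real.exp (y / 2) := Real.one_le_exp (by positivity)
    have h1 : √(d : ℝ) ≤ X := by
      refine le_trans ?_ hXle
      calc √(d : ℝ) ≤ 1 * (1 * d * 1 ^ 3 * 1 ^ 3 * 1) := by linarith
        _ ≤ _ := by gcongr; norm_num
    have h1' : (d : ℝ) ≤ X := by
      refine le_trans ?_ hXle
      calc (d : ℝ) ≤ 1 * (1 * d * 1 ^ 3 * 1 ^ 3 * 1) := by linarith
        _ ≤ _ := by gcongr; norm_num
    have h2 : (K : ℝ) ≤ X := by
      refine le_trans ?_ hXle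
      calc (K : ℝ) = 1 * (1 * 1 * K ^ 1 * 1 ^ 3 * 1) := by ring
        _ ≤ _ := by gcongr <;> norm_num
    have h3 : Real.exp y ≤ X ^ 2 := by
      have : Real.exp (y / 2) ≤ X := by
        refine le_trans ?_ hXle
        calc Real.exp (y / 2) = Real.exp (y / 2) * (1 * 1 * 1 ^ 3 * 1 ^ 3 * 1) := by ring
          _ ≤ _ := by gcongr; norm_num
      calc Real.exp y = Real.exp (y / 2) ^ 2 := by rw [← Real.exp_nat_mul]; congr 1; ring
        _ ≤ X ^ 2 := by gcongr
    have h4 : y ≤ X ^ 2 := (by linarith [Real.add_one_le_exp y] : y ≤ Real.exp y).trans h3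
    have h5 : √(Real.log X) ≤ X := sqrt_log_le' (by linarith)
    have h6 : √(d : ℝ) / lam ≤ X * X ^ 2 := by
      calc √(d : ℝ) / lam ≤ √(d : ℝ) * H / lam := by
            gcongr
            exact le_mul_of_one_le_right (by positivity) hH'
        _ = √(d : ℝ) * y := by rw [hy]; ring
        _ ≤ _ := by gcongr
    have h7 : (√(d : ℝ) + (H + lam * K) + 16 * d * lam * Real.exp y * √(Real.log X))
        / (lam / (2 * K))
        = 2 * K * (√(d : ℝ) / lam + y + K + 16 * d * Real.exp y * √(Real.log X)) := by
      rw [hy]; field_simp; ring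
    simp only [weightBound, betaCoeff, gridSpacing]
    rw [← hy, ← hlog, h7]
    calc _ ≤ 2 * X * (X * X ^ 2 + X ^ 2 + X + X * X * X ^ 2 * X) := by gcongr; linarith
      _ = 2 * X ^ 4 + 2 * X ^ 3 + 2 * X ^ 2 + 2 * X ^ 6 := by ring
      _ ≤ 10 * X ^ 7 := by
        have hX7 : 0 ≤ X ^ 7 := pow_nonneg (by linarith) 7
        linarith [hpow X 2 hX (by norm_num), hpow X 3 hX (by norm_num), hpow X 4 hX (by norm_num),
        hpow X 6 hX (by norm_num), hX7]
  | chiSq =>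
    set X := logArg .chiSq d H K lam δ with hXdef
    set z := (H : ℝ) / (2 * lam) with hz
    have hz0 : 0 ≤ z := by positivity
    have hz1 : 1 ≤ 1 + z := by linarith
    have hXeq : 192 * K ^ 5 * H ^ 6 * d ^ 3 * (1 + z) ^ 3 * (1 / δ) = X := by
      rw [hXdef, logArg, ← hz]; ring
    have h1 : 8 * (d : ℝ) ≤ X := by
      calc 8 * (d : ℝ) = 8 * 1 ^ 5 * 1 ^ 6 * d ^ 1 * 1 ^ 3 * 1 := by ring
        _ ≤ 192 * K ^ 5 * H ^ 6 * d ^ 3 * (1 + z) ^ 3 * (1 / δ) := by gcongr <;> norm_num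
        _ = _ := hXeq
    have h2 : 4 * (K : ℝ) ≤ X := by
      calc 4 * (K : ℝ) = 4 * K ^ 1 * 1 ^ 6 * 1 ^ 3 * 1 ^ 3 * 1 := by ring
        _ ≤ 192 * K ^ 5 * H ^ 6 * d ^ 3 * (1 + z) ^ 3 * (1 / δ) := by gcongr <;> norm_num
        _ = _ := hXeq
    have h3 : 1 + z ≤ X := by
      calc 1 + z = 1 * 1 ^ 5 * 1 ^ 6 * 1 ^ 3 * (1 + z) ^ 1 * 1 := by ring
        _ ≤ 192 * K ^ 5 * H ^ 6 * d ^ 3 * (1 + z) ^ 3 * (1 / δ) := by gcongr <;> norm_num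
        _ = _ := hXeq
    have h4 : √(Real.log X) ≤ X := sqrt_log_le' (by linarith)
    have h5 : √(d : ℝ) / H ≤ X := by
      refine (div_le_self (by positivity) hH').trans ?_
      linarith
    have h6 : (√(d : ℝ) + (H + (H : ℝ) ^ 2 / (2 * lam))
          + 8 * d * H * (1 + 3 * H / (4 * lam)) * √(Real.log X)) / (H / (4 * K))
        = 4 * K * (√(d : ℝ) / H + (1 + z) + 8 * d * (1 + 3 / 2 * z) * √(Real.log X)) := by
      rw [hz]; field_simp; ring
    simp only [weightBound, betaCoeff, gridSpacing]
    change (√(d : ℝ) + (H + (H : ℝ) ^ 2 / (2 * lam))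
          + 8 * d * H * (1 + 3 * H / (4 * lam)) * √(Real.log X)) / (H / (4 * K)) ≤ _
    rw [h6]
    calc _ ≤ X * (X + X + X * (2 * X) * X) := by gcongr; linarith
      _ = 2 * X ^ 2 + 2 * X ^ 4 := by ring
      _ ≤ 10 * X ^ 7 := by
        have hX7 : 0 ≤ X ^ 7 := pow_nonneg (by linarith) 7
        linarith [hpow X 2 hX (by norm_num), hpow X 4 hX (by norm_num), hX7]

/-- The penalty coefficient dominates the estimation error that results from the union bound over
the grid. -/
lemma exists_grid_size : ∃ (n : ℕ) (t : ℝ), 0 < t ∧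
    √(d : ℝ) + weightBound D H K lam + betaCoeff D d H K lam δ ≤ n * gridSpacing D H K lam ∧
    4 * H * d * (2 * n + 1 : ℝ) ^ (d + 1) * Real.exp (-t) ≤ δ ∧
    errorScale D H lam * (√(d : ℝ) + 1 + √(t / 2)) ≤ betaCoeff D d H K lam δ := by
  have hd' : (1 : ℝ) ≤ d := by exact_mod_cast hd
  have hH' : (1 : ℝ) ≤ H := by exact_mod_cast hH
  have hK' : (1 : ℝ) ≤ K := by exact_mod_cast hK
  have hX := le_logArg (D := D) hd hH hK hlam hδ0 hδ1
  have hcount := count_le_logArg_pow (D := D) hd hH hK hlam hδ0 hδ1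
  have hrad := radius_le_logArg_pow (D := D) hd hH hK hlam hδ0 hδ1
  have hβ := errorScale_mul_le_betaCoeff (D := D) hd hH hK hlam hδ0 hδ1
  have hgs : 0 < gridSpacing D H K lam := by
    cases D <;> simp only [gridSpacing] <;> positivity
  have hes : 0 ≤ errorScale D H lam := by
    cases D <;> simp only [errorScale] <;> positivity
  have hR0 : 0 ≤ √(d : ℝ) + weightBound D H K lam + betaCoeff D d H K lam δ := by
    have := betaCoeff_nonneg (D := D) (d := d) (H := H) (K := K) (δ := δ) hlam
    have : 0 ≤ weightBound D H K lam := by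
      cases D <;> simp only [weightBound] <;> positivity
    positivity
  set R := √(d : ℝ) + weightBound D H K lam + betaCoeff D d H K lam δ
  set X := logArg D d H K lam δ
  set n := ⌈R / gridSpacing D H K lam⌉₊ with hn
  have hX0 : 0 < X := by linarith
  have hn1 : R ≤ n * gridSpacing D H K lam := by
    rw [← div_le_iff₀ hgs]; exact Nat.le_ceil _
  have hn2 : (2 * n + 1 : ℝ) ≤ X ^ 9 := by
    have h1 := (Nat.ceil_lt_add_one (div_nonneg hR0 hgs.le)).le
    rw [← hn] at h1
    have h2 : (1 : ℝ) ≤ X ^ 7 := one_le_pow₀ (by linarith)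
    calc (2 * n + 1 : ℝ) ≤ 23 * X ^ 7 := by linarith
      _ ≤ X ^ 2 * X ^ 7 := by gcongr; nlinarith
      _ = X ^ 9 := by ring
  set N : ℝ := 4 * H * d * (2 * n + 1 : ℝ) ^ (d + 1) / δ with hN
  have hbase : (1 : ℝ) ≤ 2 * n + 1 := by linarith [(Nat.cast_nonneg n : (0 : ℝ) ≤ n)]
  have hN1 : 1 < N := by
    rw [hN, lt_div_iff₀ hδ0]
    have h1 : (1 : ℝ) ≤ (2 * n + 1 : ℝ) ^ (d + 1) := one_le_pow₀ hbase
    calc 1 * δ < 4 * 1 * 1 * 1 := by linarith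
      _ ≤ _ := by gcongr
  set L := Real.log X with hL
  have hL4 : 4 ≤ L := by
    rw [hL, Real.le_log_iff_exp_le hX0]
    have h1 : Real.exp 4 = Real.exp 1 ^ 4 := by rw [← Real.exp_nat_mul]; norm_num
    have h2 := Real.exp_one_lt_d9.le
    calc Real.exp 4 = Real.exp 1 ^ 4 := h1
      _ ≤ 2.7182818286 ^ 4 := by gcongr
      _ ≤ 128 := by norm_num
      _ ≤ X := hX
  have hlogN : Real.log N ≤ 21 * d * L := by
    have h1 : N ≤ X ^ (3 + 9 * (d + 1)) := by
      calc N = 4 * H * d / δ * (2 * n + 1 : ℝ) ^ (d + 1) := by rw [hN]; ring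
        _ ≤ X ^ 3 * (X ^ 9) ^ (d + 1) := by gcongr
        _ = _ := by rw [← pow_mul, ← pow_add]
    calc Real.log N ≤ Real.log (X ^ (3 + 9 * (d + 1))) :=
          Real.log_le_log (by linarith) h1
      _ = (3 + 9 * (d + 1)) * L := by rw [Real.log_pow]; push_cast; rfl
      _ ≤ 21 * d * L := by gcongr; linarith
  -- with `t = log N`, the union bound over the grid has failure probability at most `δ`
  refine ⟨n, Real.log N, Real.log_pos hN1, hn1, ?_, ?_⟩
  · rw [Real.exp_neg, Real.exp_log (by linarith), hN]
    refine le_of_eq ?_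
    have : (0 : ℝ) < (2 * n + 1 : ℝ) ^ (d + 1) := by positivity
    field_simp
  · refine le_trans ?_ hβ
    gcongr
    have hsL : 2 ≤ √L := Real.le_sqrt_of_sq_le (by linarith)
    have h1 : √(d : ℝ) ≤ d := Real.sqrt_le_iff.2 ⟨by positivity, by nlinarith⟩
    have h2 : √(Real.log N / 2) ≤ 4 * d * √L := by
      refine Real.sqrt_le_iff.2 ⟨by positivity, ?_⟩
      rw [mul_pow, Real.sq_sqrt (by linarith)]
      have : (d : ℝ) * L ≤ d ^ 2 * L := by gcongr; nlinarith
      nlinarith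
    nlinarith

end Constants

/-! ### Suboptimality of the output -/

section Dual

variable {S : Type*} [MeasurableSpace S] {ν : Measure S} [IsProbabilityMeasure ν] {V : S → ℝ}
  {B lam : ℝ}

lemma dualValue_nonneg (D : Divergence) (hV : Measurable V) (h0 : ∀ s, 0 ≤ V s)
    (hB : ∀ s, V s ≤ B) (hlam : 0 < lam) : 0 ≤ dualValue D lam ν V := by
  have hne : Nonempty S := ν.nonempty_of_neZero
  have hinf0 : 0 ≤ ⨅ s, V s := Real.iInf_nonneg h0
  cases D with
  | TV => exact integral_nonneg fun s => le_min (h0 s) (by positivity)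
  | KL =>
    simp only [dualValue]
    have h1 : ∫ s, Real.exp (-V s / lam) ∂ν ≤ 1 := by
      calc _ ≤ ∫ _, (1 : ℝ) ∂ν :=
            integral_mono (integrable_exp_neg_div hV h0 hlam) (integrable_const _) fun s =>
              Real.exp_le_one_iff.2
                (div_nonpos_of_nonpos_of_nonneg (by linarith [h0 s]) hlam.le)
        _ = 1 := by simp
    have h2 : 0 ≤ ∫ s, Real.exp (-V s / lam) ∂ν := integral_nonneg fun s => (Real.exp_pos _).le
    exact mul_nonneg_of_nonpos_of_nonpos (by linarith) (Real.log_nonpos h2 h1)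
  | chiSq =>
    refine hinf0.trans (le_trans (le_of_eq ?_) (le_csSup (bddAbove_chiSqDual hV h0 hB hlam)
      ⟨⨅ s, V s, ⟨le_rfl, iInf_le_iSup_of_bounds h0 hB⟩, rfl⟩))
    have hmin : ∀ s, min (V s) (⨅ s, V s) = ⨅ s, V s := fun s =>
      min_eq_right (ciInf_le ⟨0, by rintro _ ⟨s, rfl⟩; exact h0 s⟩ s)
    simp only [chiSqDual, hmin]
    simp

lemma dualValue_le (D : Divergence) (hV : Measurable V) (h0 : ∀ s, 0 ≤ V s)
    (hB : ∀ s, V s ≤ B) (hB0 : 0 ≤ B) (hlam : 0 < lam) : dualValue D lam ν V ≤ B := by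
  have h := ofReal_dualValue_le_lintegral D (ν := ν) hV h0 hB hlam
  have h1 : ∫⁻ s, ENNReal.ofReal (V s) ∂ν ≤ ENNReal.ofReal B := by
    calc _ ≤ ∫⁻ _, ENNReal.ofReal B ∂ν :=
          lintegral_mono fun s => ENNReal.ofReal_le_ofReal (hB s)
      _ = _ := by simp
  exact (ENNReal.ofReal_le_ofReal_iff hB0).1 (h.trans h1)

lemma LinearMDP.dualBackup_eq_ofReal {S A : Type*} [MeasurableSpace S] [MeasurableSpace A]
    {d H : ℕ} (M : LinearMDP S A d H) (D : Divergence) {lam : ℝ} (hlam : 0 < lam) {t : ℕ} (ht : t < H) {V : S → ℝ} {B : ℝ}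
    (hV : Measurable V) (h0 : ∀ s, 0 ≤ V s) (hB : ∀ s, V s ≤ B) (s : S) (a : A) :
    M.dualBackup D lam t V s a = ENNReal.ofReal (M.φ.toFun s a ⬝ᵥ M.θ t
      + M.φ.toFun s a ⬝ᵥ fun i => dualValue D lam (M.μ₀ t i : Measure S) V) := by
  have hw : ∀ i, 0 ≤ dualValue D lam (M.μ₀ t i : Measure S) V := fun i =>
    dualValue_nonneg D hV h0 hB hlam
  have hmul : ∀ i, 0 ≤ M.φ.toFun s a i * dualValue D lam (M.μ₀ t i : Measure S) V := fun i =>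
    mul_nonneg (M.φ.nonneg s a i) (hw i)
  have hdot : ENNReal.ofReal (M.φ.toFun s a ⬝ᵥ fun i => dualValue D lam (M.μ₀ t i : Measure S) V)
      = ∑ i, ENNReal.ofReal (M.φ.toFun s a i)
        * ENNReal.ofReal (dualValue D lam (M.μ₀ t i : Measure S) V) :=
    (ENNReal.ofReal_sum_of_nonneg fun i _ => hmul i).trans
      (Finset.sum_congr rfl fun i _ => ENNReal.ofReal_mul (M.φ.nonneg s a i))
  rw [LinearMDP.dualBackup, ← hdot]
  exact (ENNReal.ofReal_add (M.reward_nonneg t ht s a)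
    (Finset.sum_nonneg fun i _ => hmul i)).symm

end Dual

section Algorithm

variable {S A : Type*} [MeasurableSpace S] [MeasurableSpace A] {d H K : ℕ}
  (M : LinearMDP S A d H) (D : Divergence) (lam β : ℝ)
  (data : Fin K → Traj S A H) (π : Policy S A)

/-- The parameter of the value estimate at step `h` as a greedy value, computed from the next value
estimate `V`. -/
noncomputable def greedyParam (h : Fin H) (V : S → ℝ) (i : Fin d) : ℝ :=
  M.θ h i + weights M.φ D lam 1 data h V i - β * ridgeWidth (features M.φ data h) i

lemma qStep_eq (h : Fin H) (V : S → ℝ) (s : S) (a : A) :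
    qStep M D lam 1 β data h V s a
      = max (min (M.φ.toFun s a ⬝ᵥ greedyParam M D lam β data h V) ((H : ℝ) - (h : ℕ))) 0 := by
  rw [qStep, uncertainty_eq]
  congr 2
  simp only [dotProduct, greedyParam, Pi.add_apply]
  rw [Finset.mul_sum, ← Finset.sum_sub_distrib]
  refine Finset.sum_congr rfl fun i _ => ?_
  ring

variable [Fintype A]

lemma vHat_last : vHat M D lam 1 β data π (Fin.last H) = fun _ => 0 := by
  rw [vHat, Fin.reverseInduction_last]

lemma vHat_castSucc (h : Fin H) (s : S) :
    vHat M D lam 1 β data π h.castSucc s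
      = ∑ a, (π.kernel h s).real {a} * qHat M D lam 1 β data π h s a := by
  rw [vHat, Fin.reverseInduction_castSucc]
  rfl

variable [MeasurableSingletonClass A]

/-- Whatever the choice of the maximizers, the value estimates of the algorithm are greedy values. -/
lemma vHat_castSucc_eq_greedyValue [Nonempty A] (hπ : IsOutput M D lam 1 β data π) (h : Fin H) :
    vHat M D lam 1 β data π h.castSucc
      = greedyValue M.φ ((H : ℝ) - (h : ℕ))
          (greedyParam M D lam β data h (vHat M D lam 1 β data π h.succ)) := by
  funext s
  rw [vHat_castSucc]
  have hq : ∀ a, qHat M D lam 1 β data π h s a = max (min (M.φ.toFun s a ⬝ᵥ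
      greedyParam M D lam β data h (vHat M D lam 1 β data π h.succ)) ((H : ℝ) - (h : ℕ))) 0 :=
    fun a => qStep_eq M D lam β data h _ s a
  refine le_antisymm ?_ ?_
  · calc _ ≤ ∑ a, (π.kernel h s).real {a} * greedyValue M.φ ((H : ℝ) - (h : ℕ))
          (greedyParam M D lam β data h (vHat M D lam 1 β data π h.succ)) s := by
          refine Finset.sum_le_sum fun a _ => mul_le_mul_of_nonneg_left ?_ measureReal_nonneg
          rw [hq]
          exact Finset.le_sup' (fun a : A => max (min (M.φ.toFun s a ⬝ᵥ
            greedyParam M D lam β data h (vHat M D lam 1 β data π h.succ))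
              ((H : ℝ) - (h : ℕ))) 0) (Finset.mem_univ a)
      _ = _ := by 
          have : ∑ a, (π.kernel h s).real {a} = 1 := by simp
          rw [← Finset.sum_mul, this, one_mul]
  · refine Finset.sup'_le _ _ fun a _ => ?_
    rw [← hq]
    -- the output is compared with the policy that always plays `a`
    have h1 := hπ h s ⟨Measure.dirac a, inferInstance⟩
    refine le_trans (le_of_eq ?_) h1
    rw [Finset.sum_eq_single a]
    · have : (Measure.dirac a).real {a} = 1 := by simp [measureReal_def]
      change _ = (Measure.dirac a).real {a} * _
      rw [this, one_mul]
    · intro b _ hb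
      have : (Measure.dirac a).real {b} = 0 := by
        simp [measureReal_def, Ne.symm hb]
      change (Measure.dirac a).real {b} * _ = 0
      rw [this, zero_mul]
    · simp

variable {lam β} in
/-- The value estimates are greedy values with parameters in a box that does not depend on the
data. -/
lemma exists_vHat_eq_greedyValue [Nonempty A] [Nonempty S] (hlam : 0 < lam) (hβ : 0 ≤ β)
    (hK : 1 ≤ K) (hπ : IsOutput M D lam 1 β data π) (j : Fin (H + 1)) :
    ∃ u : Fin d → ℝ, (∀ i, |u i| ≤ √(d : ℝ) + weightBound D H K lam + β) ∧
      vHat M D lam 1 β data π j = greedyValue M.φ ((H : ℝ) - (j : ℕ)) u := by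
  have hw0 : 0 ≤ weightBound D H K lam := by
    cases D <;> simp only [weightBound] <;> positivity
  induction j using Fin.reverseInduction with
  | last =>
    refine ⟨0, fun i => by simp; positivity, ?_⟩
    rw [vHat_last]
    funext s
    refine le_antisymm (greedyValue_nonneg _ s) ?_
    simpa using greedyValue_le M.φ (k := (H : ℝ) - (Fin.last H : ℕ)) (u := 0) (by simp) s
  | cast h ih =>
    obtain ⟨u, _, hu⟩ := ih
    refine ⟨_, fun i => ?_, vHat_castSucc_eq_greedyValue M D lam β data π hπ h⟩
    have hlevel : 0 ≤ (H : ℝ) - (h.succ : ℕ) := by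
      have : ((h.succ : ℕ) : ℝ) ≤ H := by exact_mod_cast h.2
      linarith
    have h1 : |weights M.φ D lam 1 data h (vHat M D lam 1 β data π h.succ) i|
        ≤ weightBound D H K lam := by
      refine abs_weights_le M.φ D hlam hK data h (fun s => ?_) (fun s => ?_) i
      · rw [hu]; exact greedyValue_nonneg _ s
      · rw [hu]
        refine (greedyValue_le M.φ hlevel s).trans ?_
        have : (0 : ℝ) ≤ (h.succ : ℕ) := Nat.cast_nonneg _
        linarith
    have h2 : |M.θ h i| ≤ √(d : ℝ) := by
      have := PiLp.norm_apply_le (WithLp.toLp 2 (M.θ h)) i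
      rw [Real.norm_eq_abs] at this
      exact this.trans (M.norm_θ_le h h.2)
    have h3 : |β * ridgeWidth (features M.φ data h) i| ≤ β := by
      rw [abs_of_nonneg (mul_nonneg hβ (ridgeWidth_nonneg _ i))]
      exact mul_le_of_le_one_right hβ (ridgeWidth_le_one _ i)
    rw [greedyParam]
    refine (abs_sub _ _).trans (add_le_add ((abs_add_le _ _).trans (add_le_add h2 h1)) h3)

end Algorithm

section Main

variable {S A : Type*} [MeasurableSpace S] [MeasurableSpace A] [Fintype A]
  [MeasurableSingletonClass A] {d H K : ℕ} (M : LinearMDP S A d H) (D : Divergence)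
  {lam β : ℝ} {data : Fin K → Traj S A H}

lemma lintegral_policy_ofReal (π : Policy S A) (t : ℕ) (s : S) {q : A → ℝ} (hq : ∀ a, 0 ≤ q a) :
    ∫⁻ a, ENNReal.ofReal (q a) ∂(π.kernel t s)
      = ENNReal.ofReal (∑ a, (π.kernel t s).real {a} * q a) := by
  rw [lintegral_fintype, ENNReal.ofReal_sum_of_nonneg fun a _ =>
    mul_nonneg measureReal_nonneg (hq a)]
  refine Finset.sum_congr rfl fun a _ => ?_
  rw [ENNReal.ofReal_mul measureReal_nonneg, ofReal_measureReal, mul_comm]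

lemma measurable_uncertainty {S A : Type*} [MeasurableSpace S] [MeasurableSpace A] {d H K : ℕ}
    (φ : FeatureMap S A d) (data : Fin K → Traj S A H) (h : Fin H) :
    Measurable (Function.uncurry fun s a => ENNReal.ofReal (uncertainty φ 1 data h s a)) := by
  have : (Function.uncurry fun s a => ENNReal.ofReal (uncertainty φ 1 data h s a))
      = fun x : S × A =>
        ENNReal.ofReal (∑ i, φ.toFun x.1 x.2 i * ridgeWidth (features φ data h) i) := by
    funext x
    rw [Function.uncurry, uncertainty_eq]
  rw [this]
  exact (Finset.measurable_sum _ fun i _ => (φ.measurable_toFun i).mul_const _).ennreal_ofReal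

/-- The expected sum along the whole episode of a quantity defined at the steps `0, …, H - 1` only,
extended by zero. -/
lemma expectedSum_const_mul {S A : Type*} [MeasurableSpace S] [MeasurableSpace A] {H : ℕ}
    (π : ℕ → Kernel S A) (P : ℕ → Kernel (S × A) S) {f : Fin H → S → A → ℝ≥0∞}
    (hf : ∀ h, Measurable (Function.uncurry (f h))) (c : ℝ≥0∞) (s : S) :
    expectedSum π P (fun t s a => if ht : t < H then c * f ⟨t, ht⟩ s a else 0) H 0 s
      = c * ∑ h : Fin H, ∫⁻ τ, f h (τ h).1 (τ h).2.1 ∂(trajKernel π P H 0 s) := by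
  have hm : ∀ h : Fin H, Measurable fun τ : Traj S A H => f h (τ h).1 (τ h).2.1 := fun h => by
    have : Measurable fun τ : Traj S A H => ((τ h).1, (τ h).2.1) := by fun_prop
    exact (hf h).comp this
  rw [← lintegral_finsetSum _ fun h _ => hm h,
    ← lintegral_const_mul _ (Finset.measurable_sum _ fun h _ => hm h), expectedSum]
  refine lintegral_congr fun τ => ?_
  rw [Finset.mul_sum]
  refine Finset.sum_congr rfl fun h _ => ?_
  simp only [zero_add, dif_pos h.2]

/-- On the event that the penalty dominates the estimation errors, the suboptimality of the output
is at most twice the expected penalty along the optimal policy under a worst-case kernel of the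
admissible set. -/
lemma LinearMDP.subOpt_le_of_accurate [Nonempty A] [Nonempty S] (hH : 1 ≤ H) (hK : 1 ≤ K)
    (hlam : 0 < lam) (hβ : 0 ≤ β) {πstar πhat : Policy S A} (hstar : M.IsOptimal D lam πstar)
    (hπ : IsOutput M D lam 1 β data πhat)
    (hacc : ∀ (h : Fin H) (u : Fin d → ℝ),
      (∀ j, |u j| ≤ √(d : ℝ) + weightBound D H K lam + β) → ∀ i,
        |weights M.φ D lam 1 data h (greedyValue M.φ ((H : ℝ) - (h : ℕ) - 1) u) i
            - dualValue D lam (M.μ₀ h i : Measure S) (greedyValue M.φ ((H : ℝ) - (h : ℕ) - 1) u)|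
          ≤ β * ridgeWidth (features M.φ data h) i) (s : S) :
    M.subOpt D lam πhat s ≤ ENNReal.ofReal (2 * β) *
      ⨆ P ∈ M.admissible D lam, ∑ h : Fin H,
        ∫⁻ τ, ENNReal.ofReal (uncertainty M.φ 1 data h (τ h).1 (τ h).2.1)
          ∂(trajKernel πstar.kernel P H 0 s) := by
  set V : ℕ → S → ℝ := fun t =>
    if ht : t < H + 1 then vHat M D lam 1 β data πhat ⟨t, ht⟩ else fun _ => 0 with hVdef
  have hgreedy : ∀ t, t ≤ H → ∃ u : Fin d → ℝ,
      (∀ i, |u i| ≤ √(d : ℝ) + weightBound D H K lam + β) ∧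
        V t = greedyValue M.φ ((H : ℝ) - t) u := fun t ht => by
    obtain ⟨u, hu, h⟩ := exists_vHat_eq_greedyValue M D data πhat hlam hβ hK hπ
      ⟨t, Nat.lt_succ_of_le ht⟩
    refine ⟨u, hu, ?_⟩
    simp only [hVdef, dif_pos (Nat.lt_succ_of_le ht)]
    exact h
  have hVm : ∀ t, Measurable (V t) := fun t => by
    rcases le_or_gt t H with ht | ht
    · obtain ⟨u, -, h⟩ := hgreedy t ht
      rw [h]; exact measurable_greedyValue _
    · simp only [hVdef, dif_neg (by omega : ¬ t < H + 1)]; exact measurable_const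
  have hV0 : ∀ t s, 0 ≤ V t s := fun t s => by
    rcases le_or_gt t H with ht | ht
    · obtain ⟨u, -, h⟩ := hgreedy t ht
      rw [h]; exact greedyValue_nonneg _ s
    · simp only [hVdef, dif_neg (by omega : ¬ t < H + 1)]; exact le_rfl
  have hVle : ∀ t, t ≤ H → ∀ s, V t s ≤ (H : ℝ) - t := fun t ht s => by
    obtain ⟨u, -, h⟩ := hgreedy t ht
    rw [h]
    exact greedyValue_le _ (by have : (t : ℝ) ≤ H := by exact_mod_cast ht
                               linarith) s
  have hVB : ∀ t s, V t s ≤ H := fun t s => by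
    rcases le_or_gt t H with ht | ht
    · have : (0 : ℝ) ≤ t := Nat.cast_nonneg _
      linarith [hVle t ht s]
    · simp only [hVdef, dif_neg (by omega : ¬ t < H + 1)]; exact Nat.cast_nonneg _
  have hVH : ∀ s, V H s = 0 := fun s =>
    le_antisymm (by simpa using hVle H le_rfl s) (hV0 H s)
  -- the estimated action values and the dual values of the next value estimates
  set q : Fin H → S → A → ℝ := fun h s a => qHat M D lam 1 β data πhat h s a with hqdef
  set w : Fin H → Fin d → ℝ := fun h i => dualValue D lam (M.μ₀ h i : Measure S) (V (h + 1)) with hw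
  have hVt : ∀ (h : Fin H) s, V h s = ∑ a, (πhat.kernel h s).real {a} * q h s a := fun h s => by
    simp only [hVdef, dif_pos (by omega : (h : ℕ) < H + 1)]
    exact vHat_castSucc M D lam β data πhat h s
  have hVsucc : ∀ h : Fin H, vHat M D lam 1 β data πhat h.succ = V (h + 1) := fun h => by
    simp only [hVdef, dif_pos (by omega : (h : ℕ) + 1 < H + 1)]
    rfl
  have hest : ∀ (h : Fin H) i, |weights M.φ D lam 1 data h (V (h + 1)) i - w h i|
      ≤ β * ridgeWidth (features M.φ data h) i := fun h i => by
    obtain ⟨u, hu, hVu⟩ := hgreedy (h + 1) h.2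
    have hcast : (H : ℝ) - ((h + 1 : ℕ) : ℝ) = (H : ℝ) - (h : ℕ) - 1 := by push_cast; ring
    rw [hcast] at hVu
    have := hacc h u hu i
    rw [← hVu] at this
    exact this
  have hq : ∀ h s a, q h s a = max (min (M.φ.toFun s a ⬝ᵥ
      greedyParam M D lam β data h (V (h + 1))) ((H : ℝ) - (h : ℕ))) 0 := fun h s a => by
    rw [← hVsucc]; exact qStep_eq M D lam β data h _ s a
  have hq0 : ∀ h s a, 0 ≤ q h s a := fun h s a => by rw [hq]; exact le_max_right _ _
  set b : Fin H → S → A → ℝ := fun h s a =>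
    M.φ.toFun s a ⬝ᵥ M.θ h + M.φ.toFun s a ⬝ᵥ w h with hb
  have hbackup : ∀ (h : Fin H) s a,
      M.dualBackup D lam h (V (h + 1)) s a = ENNReal.ofReal (b h s a) := fun h s a =>
    M.dualBackup_eq_ofReal D hlam h.2 (hVm _) (hV0 _) (hVB _) s a
  have hw0 : ∀ h i, 0 ≤ w h i := fun h i => dualValue_nonneg D (hVm _) (hV0 _) (hVB _) hlam
  have hb0 : ∀ (h : Fin H) s a, 0 ≤ b h s a := fun h s a =>
    add_nonneg (M.reward_nonneg h h.2 s a)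
      (Finset.sum_nonneg fun i _ => mul_nonneg (M.φ.nonneg s a i) (hw0 h i))
  -- pessimism of the estimated action values
  have hqb : ∀ h s a, q h s a ≤ b h s a := fun h s a => by
    rw [hq]
    refine max_le ((min_le_left _ _).trans ?_) (hb0 h s a)
    simp only [hb]
    rw [← dotProduct_add]
    refine Finset.sum_le_sum fun i _ => mul_le_mul_of_nonneg_left ?_ (M.φ.nonneg s a i)
    have := (abs_le.1 (hest h i)).2
    simp only [greedyParam, Pi.add_apply]
    linarith
  -- they are off by at most twice the penalty
  have hbq : ∀ h s a, b h s a ≤ q h s a + 2 * β * uncertainty M.φ 1 data h s a := fun h s a => by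
    have hunc : 2 * β * uncertainty M.φ 1 data h s a
        = M.φ.toFun s a ⬝ᵥ fun i => 2 * β * ridgeWidth (features M.φ data h) i := by
      rw [uncertainty_eq, Finset.mul_sum, dotProduct]
      exact Finset.sum_congr rfl fun i _ => by ring
    have hunc0 : 0 ≤ 2 * β * uncertainty M.φ 1 data h s a := by
      rw [hunc]
      exact Finset.sum_nonneg fun i _ => mul_nonneg (M.φ.nonneg s a i)
        (mul_nonneg (by positivity) (ridgeWidth_nonneg _ i))
    have h1 : b h s a ≤ M.φ.toFun s a ⬝ᵥ greedyParam M D lam β data h (V (h + 1))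
        + 2 * β * uncertainty M.φ 1 data h s a := by
      rw [hunc, ← dotProduct_add]
      simp only [hb]
      rw [← dotProduct_add]
      refine Finset.sum_le_sum fun i _ => mul_le_mul_of_nonneg_left ?_ (M.φ.nonneg s a i)
      have := (abs_le.1 (hest h i)).1
      simp only [greedyParam, Pi.add_apply]
      linarith
    have h2 : b h s a ≤ (H : ℝ) - (h : ℕ) := by
      have h3 : ∀ i, w h i ≤ (H : ℝ) - ((h + 1 : ℕ) : ℝ) := fun i =>
        dualValue_le D (hVm _) (hV0 _) (hVle _ h.2) (by
          have : (((h : ℕ) + 1 : ℕ) : ℝ) ≤ H := by exact_mod_cast h.2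
          linarith) hlam
      have h4 := M.φ.dotProduct_le s a h3
      have h5 := M.reward_le_one h h.2 s a
      simp only [hb]
      push_cast at h4
      linarith
    rw [hq]
    rcases le_total (M.φ.toFun s a ⬝ᵥ greedyParam M D lam β data h (V (h + 1)))
      ((H : ℝ) - (h : ℕ)) with h3 | h3
    · rw [min_eq_left h3]
      linarith [le_max_left (M.φ.toFun s a ⬝ᵥ greedyParam M D lam β data h (V (h + 1))) 0]
    · rw [min_eq_right h3]
      linarith [le_max_left ((H : ℝ) - (h : ℕ)) 0]
  have hpess : ∀ t ≤ H, ∀ s, ENNReal.ofReal (V t s) ≤ M.value D lam πhat t s := fun t ht s => by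
    refine M.le_value D hlam hVm hV0 hVB hVH πhat (fun t ht s => ?_) t ht s
    have := hVt ⟨t, ht⟩ s
    simp only at this
    rw [this, ← lintegral_policy_ofReal πhat t s fun a => hq0 ⟨t, ht⟩ s a]
    refine lintegral_mono fun a => ?_
    rw [hbackup ⟨t, ht⟩ s a]
    exact ENNReal.ofReal_le_ofReal (hqb ⟨t, ht⟩ s a)
  set g : ℕ → S → A → ℝ≥0∞ := fun t s a =>
    if ht : t < H then ENNReal.ofReal (2 * β) * ENNReal.ofReal (uncertainty M.φ 1 data ⟨t, ht⟩ s a)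
    else 0 with hg
  have hgm : ∀ t, Measurable (Function.uncurry (g t)) := fun t => by
    by_cases ht : t < H
    · have : Function.uncurry (g t) = fun x : S × A => ENNReal.ofReal (2 * β)
          * Function.uncurry (fun s a =>
            ENNReal.ofReal (uncertainty M.φ 1 data ⟨t, ht⟩ s a)) x := by
        funext x
        simp only [Function.uncurry, hg, dif_pos ht]
      rw [this]
      exact (measurable_uncertainty M.φ data ⟨t, ht⟩).const_mul _
    · have : Function.uncurry (g t) = fun _ => 0 := by
        funext x
        simp only [Function.uncurry, hg, dif_neg ht]
      rw [this]
      exact measurable_const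
  have hupper : ∀ t < H, ∀ s, ∫⁻ a, M.dualBackup D lam t (V (t + 1)) s a ∂(πstar.kernel t s)
      ≤ ENNReal.ofReal (V t s) + ∫⁻ a, g t s a ∂(πstar.kernel t s) := fun t ht s => by
    have h1 : ∀ a, M.dualBackup D lam t (V (t + 1)) s a
        ≤ ENNReal.ofReal (q ⟨t, ht⟩ s a) + g t s a := fun a => by
      rw [hbackup ⟨t, ht⟩ s a]
      simp only [hg, dif_pos ht]
      rw [← ENNReal.ofReal_mul (by positivity)]
      exact (ENNReal.ofReal_le_ofReal (hbq ⟨t, ht⟩ s a)).trans ENNReal.ofReal_add_le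
    refine (lintegral_mono h1).trans ?_
    rw [lintegral_add_right _ ((hgm t).of_uncurry_left),
      lintegral_policy_ofReal πstar t s fun a => hq0 ⟨t, ht⟩ s a]
    gcongr
    have h2 := hVt ⟨t, ht⟩ s
    simp only at h2
    rw [h2]
    exact hπ ⟨t, ht⟩ s ⟨πstar.kernel t s, inferInstance⟩
  -- the optimal policy is evaluated under factor distributions that are almost worst-case for the
  -- value estimates; by pessimism, these are admissible
  rw [LinearMDP.subOpt, tsub_le_iff_right, ← hstar s]
  refine ENNReal.le_of_forall_pos_le_add fun ε hε _ => ?_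
  have hH0 : (0 : ℝ) < H := by exact_mod_cast hH
  have hε' : 0 < (ε : ℝ) / H := by positivity
  have hex : ∀ (t : ℕ) (i : Fin d), ∃ μ : ProbabilityMeasure S,
      ∫⁻ s, ENNReal.ofReal (V (t + 1) s) ∂(μ : Measure S)
          + ENNReal.ofReal lam * D.div (μ : Measure S) (M.μ₀ t i : Measure S)
        ≤ ENNReal.ofReal (dualValue D lam (M.μ₀ t i : Measure S) (V (t + 1)))
          + ENNReal.ofReal ((ε : ℝ) / H) ∧
      ENNReal.ofReal lam * D.div (μ : Measure S) (M.μ₀ t i : Measure S)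
        ≤ ⨆ s, ENNReal.ofReal (V (t + 1) s) := fun t i =>
    strong_duality D (M.μ₀ t i : Measure S) (hVm _) (hV0 _) (hVB _) hlam hε'
  choose μ hμ1 hμ2 using hex
  set P : ℕ → Kernel (S × A) S := fun t => M.φ.kernel (μ t) with hP
  have hadm : P ∈ M.admissible D lam := by
    refine ⟨μ, fun _ => rfl, fun h hh i => ?_⟩
    rw [ENNReal.le_div_iff_mul_le (Or.inl (by simpa using hlam)) (Or.inl ENNReal.ofReal_ne_top),
      mul_comm]
    refine (hμ2 h i).trans (iSup_mono fun s => ?_)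
    exact (hpess (h + 1) hh s).trans (le_iSup (fun π => M.value D lam π (h + 1) s) πhat)
  have hval : M.value D lam πstar 0 s
      ≤ ENNReal.ofReal (V 0 s) + expectedSum πstar.kernel P g H 0 s + ε := by
    rw [LinearMDP.value_eq]
    refine (iInf_le _ μ).trans ((M.expectedSum_le D πstar hgm hupper μ
      (ENNReal.ofReal ((ε : ℝ) / H)) (fun t _ i => hμ1 t i) H 0 (by simp) s).trans
      (le_of_eq ?_))
    congr 1
    rw [← ENNReal.ofReal_natCast, ← ENNReal.ofReal_mul hH0.le, mul_div_cancel₀ _ hH0.ne']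
    simp
  have hsum : expectedSum πstar.kernel P g H 0 s = ENNReal.ofReal (2 * β) * ∑ h : Fin H,
      ∫⁻ τ, ENNReal.ofReal (uncertainty M.φ 1 data h (τ h).1 (τ h).2.1)
        ∂(trajKernel πstar.kernel P H 0 s) :=
    expectedSum_const_mul πstar.kernel P (measurable_uncertainty M.φ data) _ s
  refine hval.trans ?_
  rw [hsum, add_comm (ENNReal.ofReal (V 0 s))]
  gcongr
  · exact le_iSup₂ (f := fun P (_ : P ∈ M.admissible D lam) => ∑ h : Fin H,
      ∫⁻ τ, ENNReal.ofReal (uncertainty M.φ 1 data h (τ h).1 (τ h).2.1)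
        ∂(trajKernel πstar.kernel P H 0 s)) P hadm
  · exact hpess 0 (Nat.zero_le _) s

end Main

end DRRMDP

theorem mainTheorem1 {S A : Type*} [MeasurableSpace S] [MeasurableSpace A] [Fintype A]
    [MeasurableSingletonClass A] {d H K : ℕ} (hH : 1 ≤ H) (hK : 1 ≤ K)
    (M : DRRMDP.LinearMDP S A d H) (D : DRRMDP.Divergence) (lam : ℝ) (hlam : 0 < lam)
    (ρ : Measure S) [IsProbabilityMeasure ρ] (πb : DRRMDP.Policy S A)
    (πstar : DRRMDP.Policy S A) (hstar : M.IsOptimal D lam πstar)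
    (δ : ℝ) (hδ : δ ∈ Set.Ioo (0 : ℝ) 1) :
    ∃ E : Set (Fin K → DRRMDP.Traj S A H), MeasurableSet E ∧
      ENNReal.ofReal (1 - δ) ≤ M.dataLaw ρ πb K E ∧
      ∀ data ∈ E, ∀ πhat : DRRMDP.Policy S A,
        DRRMDP.IsOutput M D lam 1 (DRRMDP.betaCoeff D d H K lam δ) data πhat →
        ∀ s : S, M.subOpt D lam πhat s ≤
          ENNReal.ofReal (2 * DRRMDP.betaCoeff D d H K lam δ) *
            ⨆ P ∈ M.admissible D lam, ∑ h : Fin H,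
              ∫⁻ τ, ENNReal.ofReal
                  (DRRMDP.uncertainty M.φ 1 data h (τ h).1 (τ h).2.1)
                ∂(DRRMDP.trajKernel πstar.kernel P H 0 s) := by
  have hS : Nonempty S := ρ.nonempty_of_neZero
  have hA : Nonempty A := (πb.kernel 0 hS.some).nonempty_of_neZero
  -- the features sum to one, so that there is at least one of them
  have hd : 1 ≤ d := by
    rcases Nat.eq_zero_or_pos d with rfl | h
    · simpa using M.φ.sum_eq_one hS.some hA.some
    · exact h
  obtain ⟨n, t, ht, hR, hcount, hβ⟩ := DRRMDP.exists_grid_size (D := D) hd hH hK hlam hδ.1 hδ.2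
  have hβ0 := DRRMDP.betaCoeff_nonneg (D := D) (d := d) (H := H) (K := K) (δ := δ) hlam
  have hRH : (H : ℝ) ≤ √(d : ℝ) + DRRMDP.weightBound D H K lam
      + DRRMDP.betaCoeff D d H K lam δ := by
    have h1 : (H : ℝ) ≤ DRRMDP.weightBound D H K lam := by
      have hK1 : (1 : ℝ) ≤ K := by exact_mod_cast hK
      cases D with
      | TV => exact le_mul_of_one_le_right (Nat.cast_nonneg _) hK1
      | KL => exact le_add_of_nonneg_right (by positivity)
      | chiSq => exact le_add_of_nonneg_right (by positivity)
    linarith [Real.sqrt_nonneg (d : ℝ)]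
  obtain ⟨E, hE, hPE, hacc⟩ := M.exists_estimation_event ρ πb D hlam hH hK ht hR hRH hcount
  refine ⟨E, hE, ?_, fun data hdata πhat hπ s => ?_⟩
  · rw [ENNReal.ofReal_sub _ hδ.1.le, ENNReal.ofReal_one, tsub_le_iff_right,
      ← prob_add_prob_compl (μ := M.dataLaw ρ πb K) hE]
    gcongr
  · refine M.subOpt_le_of_accurate D hH hK hlam hβ0 hstar hπ (fun h u hu i => ?_) s
    exact (hacc data hdata h u hu i).trans
      (mul_le_mul_of_nonneg_right hβ (DRRMDP.ridgeWidth_nonneg _ i))
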